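/- **Conventions.** Graphs have edges of length $1$; a point of a graph means a vertex, and $d_G$ is the graph distance. For a set $S$ of vertices, the subgraph spanned by $S$ carries its induced path metric. A function $\varphi:\mathbb R_{\ge0}\to\mathbb R_{\ge0}$ is *proper* if preimages of compact sets are compact; $g$ is a *$\varphi$-proper embedding* if $d(g(x),g(y))\le r$ implies $d(x,y)\le\varphi(r)$; $g$ is a *$(k,\epsilon)$-qi embedding* if $\frac1k d(x,y)-\epsilon\le d(g(x),g(y))\le k\,d(x,y)+\epsilon$, and a $k$-qi embedding if $\epsilon=k$. A connected graph is *$\delta$-hyperbolic* if all its geodesic triangles are $\delta$-slim. A pair $(U,V)$ is *$C$-cobounded* if the set of nearest point projections of $V$ on $U$, and that of $U$ on $V$, have diameter $\le C$. $N_R$ denotes the closed $R$-neighbourhood and $Hd$ the Hausdorff distance. **Graphs of tree-graded graphs.** A *tree-graded graph* $\Pi_T:B\to T$ is a connected graph $B$ with a surjective $1$-Lipschitz map to a tree $T$ such that each piece $B_v=\Pi_T^{-1}(v)$ is a connected subgraph and over (the interior of) every edge $[v,w]$ of $T$ there is exactly one edge $[c_v,c_w]$ of $B$, $c_v\in B_v$,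 $c_w\in B_w$. Let $f:\mathbb R_{\ge0}\to\mathbb R_{\ge0}$ be proper. A *graph of tree-graded graphs* with parameter $f$ is a connected graph $X$ with a surjective $1$-Lipschitz map $\Pi_B:X\to B$ (put $\Pi=\Pi_T\circ\Pi_B$, $X_v=\Pi^{-1}(v)$, $F_b=\Pi_B^{-1}(b)$) such that: every fiber $F_b$ is connected and $f$-properly embedded in $X$; if $b_1,b_2$ are adjacent vertices of the same piece, each vertex of $F_{b_1}$ is joined by an edge to a vertex of $F_{b_2}$; for each edge $[c_v,c_w]$ connecting two pieces there is a connected edge graph $E_{vw}$ with $f$-proper embeddings $f_s:E_{vw}\to F_{c_s}$ ($s\in\{v,w\}$), such that the edges of $X$ over $[c_v,c_w]$ are exactly the edges joining $f_v(t)$ to $f_w(t)$, $t\in V(E_{vw})$. Put $F_{vw}=\Pi_B^{-1}([c_v,c_w])$ with its path metric $d^e$. **Axiom H** (parameters $\delta_0\ge0$, $N\ge0$, $L_0\ge1$): all $F_b$, all $E_{vw}$ and $B$ are $\delta_0$-hyperbolic; all $f_s:E_{vw}\to F_{c_s}$ are $L_0$-qi embeddings; and for each $b$ the barycenter map $\partial^3F_b\to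 F_b$ is $N$-coarsely surjective. Here a barycenter map sends a triple of distinct points of the Gromov boundary to a point at distance $\le D$ from each side of an ideal triangle with vertices at these points, whose sides are $k$-quasi-geodesic lines, with uniform constants $k,D$. **Semicontinuous subgraphs.** For a subtree $S\subseteq T$ let $B_S=\Pi_T^{-1}(S)$. A *$K$-qi section* over $B_S$ is a $K$-qi embedding $s:B_S\to X$ with $\Pi_B\circ s=\mathrm{id}$, whose restriction to $B_v$ is a $K$-qi embedding into the path metric of $X_v$ for all $v\in S$, and with $d^e(s(c_v),s(c_w))\le K$ for every edge $[v,w]$ of $S$. A set $X_1\subseteq X$ *forms a $K$-metric graph bundle* over $B_S$ if $\Pi_B(X_1)=B_S$ and through each point of $X_1$ there is a $K$-qi section over $B_S$ inside $X_1$. Let $K\ge1$, $C,\epsilon\ge0$. A subset $\mathcal Y\subseteq X$ is a *$(K,C,\epsilon)$-semicontinuous subgraph* with central base $\mathcal B=\Pi_T^{-1}(\mathcal T)$ if, with $Q_b=\mathcal Y\cap F_b$: 1. $T_{\mathcal Y}=\Pi(\mathcal Y)$ and $\mathcal T\subseteq T_{\mathcal Y}$ are (non-empty) subtrees of $T$;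 put $B_{\mathcal Y}=\Pi_T^{-1}(T_{\mathcal Y})$. 2. $Q_b$ is $4\delta_0$-quasiconvex in $F_b$ for all $b\in B_{\mathcal Y}$; $\mathcal Y\cap X_v$ forms a $K$-metric graph bundle over $B_v$ for every $v\in T_{\mathcal Y}$, and $\mathcal Y\cap\Pi_B^{-1}(\mathcal B)$ forms one over $\mathcal B$. 3. If $[v,w]$ is an edge of $T_{\mathcal Y}$, $w\notin\mathcal T$ and $d_T(\mathcal T,w)>d_T(\mathcal T,v)$, then $Hd^e(P_w(Q_{c_v}),Q_{c_w})\le\epsilon$ for a nearest point projection map $P_w:F_{vw}\to F_{c_w}$, and $d^e(x,Q_{c_v})\le K$ for all $x\in Q_{c_w}$. If $v,w\in\mathcal T$ then $Hd^e(Q_{c_v},Q_{c_w})\le K$. 4. If $v\in T_{\mathcal Y}$, $w\notin T_{\mathcal Y}$ are adjacent in $T$, then $(Q_{c_v},F_{c_w})$ is $C$-cobounded in $F_{vw}$. 5. A non-empty connected subgraph $B_{\mathcal Y'}\subseteq B_{\mathcal Y}$ is given (possibly $B_{\mathcal Y'}=B_{\mathcal Y}$) which, with its path metric, is $(1,6\delta_0)$-qi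 embedded in $B$, and $Q_b$ has diameter $\le C$ in $F_b$ for all $b\in B_{\mathcal Y}\setminus B_{\mathcal Y'}$. Put $\mathcal Y'=\mathcal Y\cap\Pi_B^{-1}(B_{\mathcal Y'})$. **Theorem (Mitra's retraction).** Fix a proper function $f$, structural constants $\delta_0\ge0$, $N\ge0$, $L_0\ge1$ (and $k,D$ as above), and $K\ge1$, $C\ge0$, $\epsilon\ge0$. (a) There is a constant $L\ge 0$, depending only on these data, such that for every graph of tree-graded graphs $X$ with parameter $f$ satisfying axiom H with these constants and every $(K,C,\epsilon)$-semicontinuous subgraph $\mathcal Y$ of $X$ there is a map $\rho:X\to\mathcal Y'$ which is the identity on $\mathcal Y'$ and satisfies $d_X(\rho(x),\rho(y))\le L\,d_X(x,y)+L$ for all $x,y\in X$. The same holds with $\mathcal Y$ in place of $\mathcal Y'$. (b) For every $R\ge\max\{4\delta_0+1,2K\}$ there are a proper function $\eta$ and a constant $M\ge1$, depending only on these data and $R$, such that for all such $X$, $\mathcal Y$ and for $Z\in\{\mathcal Y',\mathcal Y\}$, the neighbourhood $N_R(Z)\subseteq X$ is connected, and with its induced path metric the inclusion $N_R(Z)\hookrightarrow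 X$ is an $\eta$-proper embedding and an $M$-qi embedding. -/

import Mathlib

open scoped NNReal

universe u₁ u₂ u₃ u₄

/-! Every graph below has edges of length one, and a metric graph is represented by its vertex set
with the graph distance.  A point of a metric graph always means a vertex of it; the induced path
metric on a subgraph spanned by a set `S` of vertices is the graph distance of `G.induce S`. -/

namespace TreeGraded

/-! ### Coarse geometry of graphs -/

section Coarse

/-- A (not necessarily continuous) function for which the preimage of each compact set is compact. -/
def IsProperFun (φ : ℝ≥0 → ℝ≥0) : Prop :=
  ∀ S : Set ℝ≥0, IsCompact S → IsCompact (φ ⁻¹' S)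

/-- `g` is a `φ`-proper embedding: `d(g x, g y) ≤ r` implies `d(x, y) ≤ φ r`. -/
def IsProperEmb {V W : Type*} (φ : ℝ≥0 → ℝ≥0) (G : SimpleGraph V) (H : SimpleGraph W)
    (g : V → W) : Prop :=
  ∀ (x y : V) (r : ℝ≥0), (H.dist (g x) (g y) : ℝ) ≤ r → (G.dist x y : ℝ) ≤ φ r

/-- `g` is a `(k, ε)`-quasi-isometric embedding. -/
def IsQIEmb {V W : Type*} (k ε : ℝ) (G : SimpleGraph V) (H : SimpleGraph W) (g : V → W) : Prop :=
  ∀ x y : V, (1 / k) * (G.dist x y : ℝ) - ε ≤ (H.dist (g x) (g y) : ℝ) ∧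
    (H.dist (g x) (g y) : ℝ) ≤ k * (G.dist x y : ℝ) + ε

/-- `G` is connected and all its geodesic triangles are `δ`-slim. -/
def IsHyperbolic {V : Type*} (G : SimpleGraph V) (δ : ℝ) : Prop :=
  G.Connected ∧
  ∀ (x y z : V) (p : G.Walk x y) (q : G.Walk y z) (r : G.Walk x z),
    p.length = G.dist x y → q.length = G.dist y z → r.length = G.dist x z →
    ∀ u ∈ p.support, ∃ v, (v ∈ q.support ∨ v ∈ r.support) ∧ (G.dist u v : ℝ) ≤ δ

/-- The closed `R`-neighbourhood of a set of vertices. -/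
def nbhd {V : Type*} (G : SimpleGraph V) (R : ℝ) (U : Set V) : Set V :=
  {x | ∃ u ∈ U, (G.dist x u : ℝ) ≤ R}

/-- All geodesics with end points in `U` stay in the `K`-neighbourhood of `U`. -/
def IsQuasiconvex {V : Type*} (G : SimpleGraph V) (K : ℝ) (U : Set V) : Prop :=
  ∀ a ∈ U, ∀ b ∈ U, ∀ p : G.Walk a b, p.length = G.dist a b →
    ∀ c ∈ p.support, c ∈ nbhd G K U

/-- The Hausdorff distance of `A` and `A'` is at most `r`. -/
def HausdorffLE {V : Type*} (G : SimpleGraph V) (A A' : Set V) (r : ℝ) : Prop :=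
  A ⊆ nbhd G r A' ∧ A' ⊆ nbhd G r A

/-- The diameter of `A` is at most `r`. -/
def DiamLE {V : Type*} (G : SimpleGraph V) (A : Set V) (r : ℝ) : Prop :=
  ∀ x ∈ A, ∀ y ∈ A, (G.dist x y : ℝ) ≤ r

/-- `a` is a nearest point projection of `x` on `A`. -/
def IsNearest {V : Type*} (G : SimpleGraph V) (A : Set V) (x a : V) : Prop :=
  a ∈ A ∧ ∀ a' ∈ A, G.dist x a ≤ G.dist x a'

/-- The set of all nearest point projections on `A` of points of `A'`. -/
def projSet {V : Type*} (G : SimpleGraph V) (A A' : Set V) : Set V :=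
  {a | ∃ x ∈ A', IsNearest G A x a}

/-- The pair `(U, U')` is `D`-cobounded. -/
def IsCobounded {V : Type*} (G : SimpleGraph V) (U U' : Set V) (D : ℝ) : Prop :=
  DiamLE G (projSet G U U') D ∧ DiamLE G (projSet G U' U) D

/-- The distance of the vertex `x` from the (non-empty) set `A`. -/
noncomputable def setDist {V : Type*} (G : SimpleGraph V) (A : Set V) (x : V) : ℕ :=
  sInf ((fun a => G.dist a x) '' A)

/-- `ρ` is an `L`-coarsely Lipschitz retraction of the graph on the subset `Z`, which is the
identity on `Z`. -/
def IsCoarseLipRetraction {V : Type*} (G : SimpleGraph V) (L : ℝ) (Z : Set V) (ρ : V → V) : Prop :=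
  (∀ x, ρ x ∈ Z) ∧ (∀ z ∈ Z, ρ z = z) ∧
  ∀ x y, (G.dist (ρ x) (ρ y) : ℝ) ≤ L * (G.dist x y : ℝ) + L

end Coarse

/-! ### Gromov boundary and barycenter maps -/

section Boundary

/-- The Gromov product of `x` and `y` based at `o`. -/
noncomputable def gromovProduct {V : Type*} (G : SimpleGraph V) (o x y : V) : ℝ :=
  ((G.dist o x : ℝ) + (G.dist o y : ℝ) - (G.dist x y : ℝ)) / 2

/-- The Gromov products `(s m | t n)` tend to infinity as `m, n → ∞`. -/
def Asymptotic {V : Type*} (G : SimpleGraph V) (s t : ℕ → V) : Prop :=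
  ∀ o : V, Filter.Tendsto (fun p : ℕ × ℕ => gromovProduct G o (s p.1) (t p.2))
    Filter.atTop Filter.atTop

/-- The Gromov (sequential) boundary: sequences converging to infinity modulo asymptoty. -/
def GromovBoundary {V : Type*} (G : SimpleGraph V) : Type _ :=
  Quot (fun s t : {s : ℕ → V // Asymptotic G s s} => Asymptotic G s.1 t.1)

/-- The sequence `s` converges to the boundary point `ζ`. -/
def ConvergesTo {V : Type*} (G : SimpleGraph V) (s : ℕ → V) (ζ : GromovBoundary G) : Prop :=
  ∃ h : Asymptotic G s s, Quot.mk _ ⟨s, h⟩ = ζ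

/-- A bi-infinite `k`-quasi-geodesic line from the boundary point `ζ` to the boundary point `ζ'`. -/
def IsQuasiLine {V : Type*} (G : SimpleGraph V) (k : ℝ) (ζ ζ' : GromovBoundary G)
    (γ : ℤ → V) : Prop :=
  (∀ m n : ℤ, (1 / k) * |(m : ℝ) - n| - k ≤ (G.dist (γ m) (γ n) : ℝ) ∧
    (G.dist (γ m) (γ n) : ℝ) ≤ k * |(m : ℝ) - n| + k) ∧
  ConvergesTo G (fun n : ℕ => γ (-(n : ℤ))) ζ ∧ ConvergesTo G (fun n : ℕ => γ (n : ℤ)) ζ'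

/-- Ordered triples of pairwise distinct boundary points. -/
def BoundaryTriple {V : Type*} (G : SimpleGraph V) : Type _ :=
  {ζ : Fin 3 → GromovBoundary G // Function.Injective ζ}

/-- `φ` sends each triple of distinct boundary points to a point which is `D`-close to all three
sides of an ideal triangle whose sides are `k`-quasi-geodesic lines joining the three points. -/
def IsBarycenterMap {V : Type*} (G : SimpleGraph V) (k D : ℝ) (φ : BoundaryTriple G → V) : Prop :=
  ∀ ζ : BoundaryTriple G, ∃ γ : Fin 3 → ℤ → V,
    ∀ i : Fin 3, IsQuasiLine G k (ζ.1 i) (ζ.1 (i + 1)) (γ i) ∧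
      φ ζ ∈ nbhd G D (Set.range (γ i))

/-- The barycenter map of `G` is `N`-coarsely surjective. -/
def BarycenterCoarselySurjective {V : Type*} (G : SimpleGraph V) (k D N : ℝ) : Prop :=
  ∃ φ : BoundaryTriple G → V, IsBarycenterMap G k D φ ∧ ∀ x, x ∈ nbhd G N (Set.range φ)

end Boundary

/-! ### Graphs of tree-graded graphs -/

/-- A tree-graded graph `projT : B → T` over a tree `T`.  The pieces are the preimages of the
vertices of `T`. -/
structure TreeGradedGraph (β τ : Type*) where
  /-- the base graph -/
  B : SimpleGraph β
  /-- the tree -/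
  T : SimpleGraph τ
  projT : β → τ
  isTree : T.IsTree
  connected_B : B.Connected
  projT_surjective : Function.Surjective projT
  projT_lipschitz : ∀ a b, B.Adj a b → projT a = projT b ∨ T.Adj (projT a) (projT b)
  piece_connected : ∀ v, (B.induce (projT ⁻¹' {v})).Connected
  /-- over the interior of each edge of `T` there is exactly one edge of `B` -/
  edge_unique : ∀ v w, T.Adj v w → ∃! c : β × β, B.Adj c.1 c.2 ∧ projT c.1 = v ∧ projT c.2 = w

/-- `[a, b]` is the edge connecting the two different pieces which contain `a` and `b`. -/
def TreeGradedGraph.Connecting {β τ : Type*} (𝔹 : TreeGradedGraph β τ) (a b : β) : Prop :=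
  𝔹.B.Adj a b ∧ 𝔹.projT a ≠ 𝔹.projT b

/-- A graph of tree-graded graphs `projB : X → B` with parameter `f`.  For an edge `e = [a, b]`
of `B` connecting two pieces, `E e` is the edge graph.  Each vertex `t` of it is (the mid point of)
an edge of `X` over `[a, b]`, whose end points over `a` and `b` are `att e t a` and `att e t b`;
all edges of `X` over `[a, b]` arise in this way. (Values of `EV`, `E`, `att` elsewhere are
irrelevant.)  The edges of `E e` are not regarded as edges of `X`. -/
structure GraphOfTreeGradedGraphs (ξ : Type u₁) (β : Type u₂) (τ : Type u₃)
    (f : ℝ≥0 → ℝ≥0) extends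
    TreeGradedGraph β τ where
  /-- the total graph -/
  X : SimpleGraph ξ
  projB : ξ → β
  connected_X : X.Connected
  projB_surjective : Function.Surjective projB
  projB_lipschitz : ∀ x y, X.Adj x y → projB x = projB y ∨ B.Adj (projB x) (projB y)
  fiber_connected : ∀ b, (X.induce (projB ⁻¹' {b})).Connected
  fiber_proper : ∀ b, IsProperEmb f (X.induce (projB ⁻¹' {b})) X Subtype.val
  /-- inside a piece, vertices of fibers are joined by edges to vertices of adjacent fibers -/
  exists_adj : ∀ a b, B.Adj a b → projT a = projT b → ∀ x, projB x = a → ∃ y, projB y = b ∧ X.Adj x y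
  /-- vertices of the edge graphs -/
  EV : Sym2 β → Type u₄
  /-- the edge graphs -/
  E : (e : Sym2 β) → SimpleGraph (EV e)
  /-- the incidence maps -/
  att : (e : Sym2 β) → EV e → β → ξ
  edge_connected : ∀ a b, toTreeGradedGraph.Connecting a b → (E s(a, b)).Connected
  att_mem : ∀ a b, toTreeGradedGraph.Connecting a b → ∀ e, e = s(a, b) →
    ∀ t : EV e, att e t a ∈ projB ⁻¹' {a}
  att_adj : ∀ a b, toTreeGradedGraph.Connecting a b → ∀ e, e = s(a, b) →
    ∀ t : EV e, X.Adj (att e t a) (att e t b)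
  exists_att : ∀ a b, toTreeGradedGraph.Connecting a b → ∀ x y, X.Adj x y →
    projB x = a → projB y = b → ∃ t : EV s(a, b), att s(a, b) t a = x ∧ att s(a, b) t b = y
  att_proper : ∀ a b (h : toTreeGradedGraph.Connecting a b) (e : Sym2 β) (he : e = s(a, b)),
    IsProperEmb f (E e) (X.induce (projB ⁻¹' {a})) (fun t => ⟨att e t a, att_mem a b h e he t⟩)

namespace GraphOfTreeGradedGraphs

variable {ξ : Type u₁} {β : Type u₂} {τ : Type u₃} {f : ℝ≥0 → ℝ≥0}
  (𝕏 : GraphOfTreeGradedGraphs.{u₁, u₂, u₃, u₄} ξ β τ f)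

/-- The projection of `X` to the tree. -/
def proj (x : ξ) : τ := 𝕏.projT (𝕏.projB x)

/-- The fiber over `b`, with its induced path metric. -/
abbrev fiber (b : β) : SimpleGraph (𝕏.projB ⁻¹' {b} : Set ξ) := 𝕏.X.induce (𝕏.projB ⁻¹' {b})

/-- The preimage of the piece over the vertex `v`, with its induced path metric. -/
abbrev pieceSpace (v : τ) : SimpleGraph (𝕏.proj ⁻¹' {v} : Set ξ) := 𝕏.X.induce (𝕏.proj ⁻¹' {v})

/-- The preimage of the edge `[a, b]`, with its induced path metric. -/
abbrev edgeSpace (a b : β) : SimpleGraph (𝕏.projB ⁻¹' {a, b} : Set ξ) :=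
  𝕏.X.induce (𝕏.projB ⁻¹' {a, b})

/-- The intersection of `Y` with the fiber over `c`, as a subset of the preimage of `[a, b]`. -/
def sliceIn (a b : β) (Y : Set ξ) (c : β) : Set (𝕏.projB ⁻¹' {a, b} : Set ξ) :=
  {x | x.1 ∈ Y ∧ 𝕏.projB x.1 = c}

/-- The incidence map from the edge graph of the connecting edge `e = [a, b]` to the fiber
over `a`. -/
def incidence {a b : β} (h : 𝕏.Connecting a b) (e : Sym2 β) (he : e = s(a, b)) (t : 𝕏.EV e) :
    (𝕏.projB ⁻¹' {a} : Set ξ) :=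
  ⟨𝕏.att e t a, 𝕏.att_mem a b h e he t⟩

/-- The hyperbolicity axioms with parameters `δ₀`, `N`, `L₀`.  The numbers `k` and `D` are the
uniform constants in the definition of the barycenter maps of the fibers. -/
structure AxiomH (δ₀ N L₀ k D : ℝ) : Prop where
  fiber_hyperbolic : ∀ b, IsHyperbolic (𝕏.fiber b) δ₀
  barycenter : ∀ b, BarycenterCoarselySurjective (𝕏.fiber b) k D N
  edge_hyperbolic : ∀ a b, 𝕏.Connecting a b → IsHyperbolic (𝕏.E s(a, b)) δ₀
  incidence_qi : ∀ a b (h : 𝕏.Connecting a b) (e : Sym2 β) (he : e = s(a, b)),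
    IsQIEmb L₀ L₀ (𝕏.E e) (𝕏.fiber a) (𝕏.incidence h e he)
  base_hyperbolic : IsHyperbolic 𝕏.B δ₀

/-- `s` is, on the preimage `B_S` of the set `S` of vertices of `T` (a subtree), a `K`-qi section
satisfying the compatibility property; values of `s` outside `B_S` are irrelevant. -/
structure IsQISection (K : ℝ) (S : Set τ) (s : β → ξ) : Prop where
  isSection : ∀ b, 𝕏.projT b ∈ S → 𝕏.projB (s b) = b
  isQIEmb : ∀ b b', 𝕏.projT b ∈ S → 𝕏.projT b' ∈ S →
    (1 / K) * (𝕏.B.dist b b' : ℝ) - K ≤ (𝕏.X.dist (s b) (s b') : ℝ) ∧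
    (𝕏.X.dist (s b) (s b') : ℝ) ≤ K * (𝕏.B.dist b b' : ℝ) + K
  /-- over each piece the section is a `K`-qi embedding for the path metrics -/
  piece_qi : ∀ v ∈ S, ∀ x y : (𝕏.proj ⁻¹' {v} : Set ξ), ∀ b b', x.1 = s b → y.1 = s b' →
    𝕏.projT b = v → 𝕏.projT b' = v →
    (1 / K) * (𝕏.B.dist b b' : ℝ) - K ≤ ((𝕏.pieceSpace v).dist x y : ℝ) ∧
    ((𝕏.pieceSpace v).dist x y : ℝ) ≤ K * (𝕏.B.dist b b' : ℝ) + K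
  /-- the values at the ends of a connecting edge are `K`-close over that edge -/
  edge_close : ∀ a b, 𝕏.Connecting a b → 𝕏.projT a ∈ S → 𝕏.projT b ∈ S →
    ∀ x y : (𝕏.projB ⁻¹' {a, b} : Set ξ), x.1 = s a → y.1 = s b →
    ((𝕏.edgeSpace a b).dist x y : ℝ) ≤ K

/-- `X₁` forms a `K`-metric graph bundle over `B_S`: it projects onto `B_S` and through each of its
points there is a `K`-qi section over `B_S` inside `X₁`. -/
def FormsMetricGraphBundle (K : ℝ) (S : Set τ) (X₁ : Set ξ) : Prop :=
  𝕏.projB '' X₁ = 𝕏.projT ⁻¹' S ∧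
  ∀ x ∈ X₁, ∃ s : β → ξ, 𝕏.IsQISection K S s ∧ s (𝕏.projB x) = x ∧
    ∀ b, 𝕏.projT b ∈ S → s b ∈ X₁

/-- `Y` is a `(K, C, ε)`-semicontinuous subgraph whose central base is the tree-graded subgraph over
the subtree `S` of `T`, and `B'` is the distinguished subgraph of `B_Y` outside which the fibers of
`Y` have diameter at most `C`. -/
structure IsSemicontinuous (δ₀ K C ε : ℝ) (Y : Set ξ) (S : Set τ) (B' : Set β) : Prop where
  tree_connected : (𝕏.T.induce (𝕏.proj '' Y)).Connected
  central_subset : S ⊆ 𝕏.proj '' Y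
  central_connected : (𝕏.T.induce S).Connected
  quasiconvex : ∀ b, 𝕏.projT b ∈ 𝕏.proj '' Y →
    IsQuasiconvex (𝕏.fiber b) (4 * δ₀) (Subtype.val ⁻¹' Y)
  bundle : ∀ v ∈ 𝕏.proj '' Y, 𝕏.FormsMetricGraphBundle K {v} (Y ∩ 𝕏.proj ⁻¹' {v})
  central_bundle : 𝕏.FormsMetricGraphBundle K S (Y ∩ 𝕏.proj ⁻¹' S)
  /-- going away from the central base across the edge `[a, b]`: with respect to a nearest point
  projection map `P` onto the fiber over `b` -/
  edge_outward : ∀ a b, 𝕏.Connecting a b → 𝕏.projT a ∈ 𝕏.proj '' Y →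
    𝕏.projT b ∈ 𝕏.proj '' Y → 𝕏.projT b ∉ S →
    setDist 𝕏.T S (𝕏.projT a) < setDist 𝕏.T S (𝕏.projT b) →
    (∃ P : (𝕏.projB ⁻¹' {a, b} : Set ξ) → (𝕏.projB ⁻¹' {a, b} : Set ξ),
      (∀ x, IsNearest (𝕏.edgeSpace a b) (𝕏.sliceIn a b Set.univ b) x (P x)) ∧
      HausdorffLE (𝕏.edgeSpace a b) (P '' 𝕏.sliceIn a b Y a) (𝕏.sliceIn a b Y b) ε) ∧
    𝕏.sliceIn a b Y b ⊆ nbhd (𝕏.edgeSpace a b) K (𝕏.sliceIn a b Y a)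
  edge_central : ∀ a b, 𝕏.Connecting a b → 𝕏.projT a ∈ S → 𝕏.projT b ∈ S →
    HausdorffLE (𝕏.edgeSpace a b) (𝕏.sliceIn a b Y a) (𝕏.sliceIn a b Y b) K
  edge_exit : ∀ a b, 𝕏.Connecting a b → 𝕏.projT a ∈ 𝕏.proj '' Y →
    𝕏.projT b ∉ 𝕏.proj '' Y →
    IsCobounded (𝕏.edgeSpace a b) (𝕏.sliceIn a b Y a) (𝕏.sliceIn a b Set.univ b) C
  sub_base : ∀ b ∈ B', 𝕏.projT b ∈ 𝕏.proj '' Y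
  sub_base_connected : (𝕏.B.induce B').Connected
  sub_base_qi : IsQIEmb 1 (6 * δ₀) (𝕏.B.induce B') 𝕏.B Subtype.val
  diam_le : ∀ b, 𝕏.projT b ∈ 𝕏.proj '' Y → b ∉ B' → DiamLE (𝕏.fiber b) (Subtype.val ⁻¹' Y) C

/-- The restriction `Y'` of `Y` over `B'`. -/
def restrict (Y : Set ξ) (B' : Set β) : Set ξ := Y ∩ 𝕏.projB ⁻¹' B'

end GraphOfTreeGradedGraphs

end TreeGraded

open TreeGraded

/-!
# Mitra's retraction for graphs of tree-graded graphs

The retraction onto a semicontinuous subgraph `Y` sends a point `x` over the tree of `Y` to a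
nearest point, *inside its fiber*, of the slice of `Y`; the part of `X` over a component of the rest
of the tree is collapsed to the projection of one point at the edge by which this component is
attached (`gate_unique`, `exists_gate`).  The issue is that adjacent points have projections at
bounded distance (`exists_isMitraRetraction`).

* In a hyperbolic graph, `p` is coarsely a nearest point to `x` in a coarsely convex set `A` exactly
  when the Gromov products `(x | a)_p`, `a ∈ A`, are bounded (`IsNearest.gromovProduct_le`).
  Boundedness of Gromov products passes through quasi-isometric embeddings in both directions
  (`exists_gromovProduct_map_le`, `exists_gromovProduct_le_of_map`), by stability of quasi-geodesics
  (`exists_morse_constant`), so projections computed in two graphs which contain a common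
  quasi-isometrically embedded graph can be compared (`exists_dist_le_of_nearest`).
* Inside a piece, this is applied to a fiber and its neighbour map to an adjacent fiber; sections
  show that the two slices correspond to each other.  Across an edge of the tree of `Y` it is
  applied to the edge graph: the conditions on `Y` provide points of the edge graph close to both
  projections.
* At an edge where the tree of `Y` ends, the projection of the slice `Q` to the edge graph is
  bounded by coboundedness.  Two points of the edge graph with distant projections to `Q` would be joined by
  a geodesic passing close to these projections, which are thus close to the edge graph; so the
  projection of the edge graph to `Q` is bounded as well.

For the restriction of `Y` over the connected subgraph `B'`, a vertex `b` of the base outside `B'`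
is projected to a nearest point `c` of `B'`, and the fiber over `b` is collapsed to the image of a
point over the last edge of a geodesic from `b` to `c`.  If this edge connects two pieces, it
separates `b` from `B'`, hence is the same for all neighbours of `b` (`IsExit.eq_of_connecting`); otherwise the
slice over `c` is bounded, and the choices for neighbours lie in the same piece and are joined by
sections (`IsMitraRetraction.exists_restrict`).

Bounded steps are proved in the stronger form that the images of adjacent points are joined by short
paths inside a neighbourhood of the target (`Joined`).  Applying the retraction to a geodesic of `X`
then yields the quasi-isometric embedding of the neighbourhood (`nbhd_embedded_of_joined`).
-/

namespace TreeGraded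

/-! ### Distances in graphs -/

section Basic

variable {V : Type*} {G : SimpleGraph V}

theorem dist_tri (hG : G.Connected) (x y z : V) :
    (G.dist x z : ℝ) ≤ G.dist x y + G.dist y z := by
  exact_mod_cast hG.dist_triangle

theorem dist_symm_real (x y : V) : (G.dist x y : ℝ) = G.dist y x := by
  rw [SimpleGraph.dist_comm]

theorem dist_add_dist_of_mem_support (hG : G.Connected) {x y u : V} (p : G.Walk x y)
    (hp : p.length = G.dist x y) (hu : u ∈ p.support) :
    G.dist x u + G.dist u y = G.dist x y := by
  classical
  have h1 := SimpleGraph.dist_le (p.takeUntil u hu)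
  have h2 := SimpleGraph.dist_le (p.dropUntil u hu)
  have h3 : (p.takeUntil u hu).length + (p.dropUntil u hu).length = p.length := by
    rw [← SimpleGraph.Walk.length_append, SimpleGraph.Walk.take_spec]
  have h4 : G.dist x y ≤ G.dist x u + G.dist u y := hG.dist_triangle
  omega

theorem dist_getVert (hG : G.Connected) {x y : V} (p : G.Walk x y)
    (hp : p.length = G.dist x y) {i j : ℕ} (hij : i ≤ j) (hj : j ≤ p.length) :
    G.dist (p.getVert i) (p.getVert j) = j - i := by
  have key : ∀ n m, n ≤ m → m ≤ p.length → G.dist (p.getVert n) (p.getVert m) ≤ m - n := by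
    intro n m hnm
    induction m, hnm using Nat.le_induction with
    | base => intro _; simp
    | succ m hnm ih =>
      intro hm
      have h1 := ih (by omega)
      have h2 : G.dist (p.getVert m) (p.getVert (m + 1)) = 1 :=
        SimpleGraph.dist_eq_one_iff_adj.2 (p.adj_getVert_succ (by omega))
      have h3 : G.dist (p.getVert n) (p.getVert (m + 1)) ≤ _ :=
        hG.dist_triangle (v := p.getVert m)
      omega
  have h1 := key i j hij hj
  have h2 := key 0 i (Nat.zero_le _) (hij.trans hj)
  have h3 := key j p.length hj le_rfl
  have h4 : G.dist x y ≤ G.dist x (p.getVert i) + G.dist (p.getVert i) y := hG.dist_triangle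
  have h5 : G.dist (p.getVert i) y ≤ G.dist (p.getVert i) (p.getVert j) + G.dist (p.getVert j) y :=
    hG.dist_triangle
  simp only [SimpleGraph.Walk.getVert_zero, SimpleGraph.Walk.getVert_length] at h2 h3
  omega

/-- A point at prescribed distance from `x` on a geodesic from `x` to `y`. -/
theorem exists_geodesic_point (hG : G.Connected) (x y : V) {n : ℕ} (hn : n ≤ G.dist x y) :
    ∃ u, G.dist x u = n ∧ G.dist u y + n = G.dist x y := by
  obtain ⟨p, hp⟩ := hG.exists_walk_length_eq_dist x y
  refine ⟨p.getVert n, ?_, ?_⟩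
  · have := dist_getVert hG p hp (Nat.zero_le n) (hp ▸ hn)
    simpa using this
  · have := dist_getVert hG p hp (hp ▸ hn) le_rfl
    rw [SimpleGraph.Walk.getVert_length] at this
    omega

/-- A geodesic starting in `P` and ending outside `P` leaves `P` along some edge. -/
theorem exists_crossing (hG : G.Connected) (P : Set V) {x y : V} (hx : x ∈ P) (hy : y ∉ P) :
    ∃ u ∈ P, ∃ u' ∉ P, G.Adj u u' ∧ G.dist x u + 1 + G.dist u' y = G.dist x y := by
  obtain ⟨p, hp⟩ := hG.exists_walk_length_eq_dist x y
  have h0 : ∃ n, n ≤ p.length ∧ p.getVert n ∉ P := ⟨p.length, le_rfl, by simpa using hy⟩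
  classical
  obtain ⟨h1, h2⟩ := Nat.find_spec h0
  set n := Nat.find h0 with hn
  have hpos : n ≠ 0 := by
    intro h
    rw [h] at h2
    exact h2 (by simpa using hx)
  obtain ⟨m, hm⟩ := Nat.exists_eq_succ_of_ne_zero hpos
  have h3 : p.getVert m ∈ P := by
    by_contra h
    exact Nat.find_min h0 (m := m) (by omega) ⟨by omega, h⟩
  refine ⟨_, h3, _, h2, ?_, ?_⟩
  · rw [hm]; exact p.adj_getVert_succ (by omega)
  · have a := dist_getVert hG p hp (Nat.zero_le m) (by omega)
    have b := dist_getVert hG p hp (i := n) (j := p.length) h1 le_rfl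
    simp only [SimpleGraph.Walk.getVert_zero, SimpleGraph.Walk.getVert_length] at a b
    omega

/-- A map sending adjacent vertices to points at distance at most `c` is `c`-Lipschitz. -/
theorem dist_le_mul_of_adj {W : Type*} {H : SimpleGraph W} (hG : G.Connected) (hH : H.Connected)
    (φ : V → W) (c : ℝ) (h : ∀ x y, G.Adj x y → (H.dist (φ x) (φ y) : ℝ) ≤ c) (x y : V) :
    (H.dist (φ x) (φ y) : ℝ) ≤ c * G.dist x y := by
  obtain ⟨p, hp⟩ := hG.exists_walk_length_eq_dist x y
  rw [← hp]
  clear hp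
  induction p with
  | nil => simp
  | @cons a b d hab q ih =>
    have := dist_tri hH (φ a) (φ b) (φ d)
    have := h _ _ hab
    rw [SimpleGraph.Walk.length_cons]
    push_cast
    linarith

theorem dist_map_le {W : Type*} {H : SimpleGraph W} (hG : G.Connected) (φ : G →g H) (x y : V) :
    H.dist (φ x) (φ y) ≤ G.dist x y := by
  obtain ⟨p, hp⟩ := hG.exists_walk_length_eq_dist x y
  rw [← hp, ← SimpleGraph.Walk.length_map φ p]
  exact SimpleGraph.dist_le _

theorem exists_isNearest (A : Set V) (hA : A.Nonempty) (x : V) : ∃ a, IsNearest G A x a := by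
  obtain ⟨a, ha, h⟩ := WellFounded.has_min (measure (fun a => G.dist x a)).wf A hA
  exact ⟨a, ha, fun a' ha' => not_lt.1 (h a' ha')⟩

theorem IsNearest.eq_of_mem (hG : G.Connected) {A : Set V} {x a : V} (hx : x ∈ A)
    (h : IsNearest G A x a) : a = x := by
  have := h.2 x hx
  rw [SimpleGraph.dist_self] at this
  exact ((hG.dist_eq_zero_iff).1 (Nat.le_zero.1 this)).symm

end Basic

/-! ### The four point condition -/

section FourPoint

variable {V : Type*} {G : SimpleGraph V} {δ : ℝ}

/-- Gromov's four point condition: of the three sums of distances of opposite sides of a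
quadrilateral, none exceeds both others by more than `2 * δ`. -/
def FourPoint (G : SimpleGraph V) (δ : ℝ) : Prop :=
  ∀ w x y z : V, (G.dist w y : ℝ) + G.dist x z ≤ G.dist w x + G.dist y z + 2 * δ ∨
    (G.dist w y : ℝ) + G.dist x z ≤ G.dist w z + G.dist x y + 2 * δ

/-- If triangles are `δ`-slim, then the distance from `w` to a geodesic `[x, z]` is at most the
Gromov product `(x | z)_w`, up to a bounded error. -/
theorem IsHyperbolic.dist_geodesic_le (h : IsHyperbolic G δ) (w x z : V) (p : G.Walk x z)
    (hp : p.length = G.dist x z) :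
    ∃ u ∈ p.support,
      2 * (G.dist w u : ℝ) ≤ G.dist w x + G.dist w z - G.dist x z + 4 * δ + 4 := by
  obtain ⟨hG, h⟩ := h
  obtain ⟨q, hq⟩ := hG.exists_walk_length_eq_dist z w
  obtain ⟨r, hr⟩ := hG.exists_walk_length_eq_dist x w
  have hslim := h x z w p q r hp hq hr
  -- the side near which a vertex of `p` lies changes between two consecutive vertices
  have h0 : ∃ n, n ≤ p.length ∧ ∃ v ∈ q.support, (G.dist (p.getVert n) v : ℝ) ≤ δ := by
    refine ⟨p.length, le_rfl, z, by simp, ?_⟩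
    have : (0 : ℝ) ≤ δ := by
      obtain ⟨v, _, hv⟩ := hslim x (by simp)
      exact le_trans (by positivity) hv
    simpa using this
  classical
  obtain ⟨h1, b, hb, hnb⟩ := Nat.find_spec h0
  set n := Nat.find h0 with hn
  have hδ : 0 ≤ δ := le_trans (by positivity) hnb
  have hm : ∃ m, m ≤ n ∧ n ≤ m + 1 ∧ ∃ a ∈ r.support, (G.dist (p.getVert m) a : ℝ) ≤ δ := by
    rcases Nat.eq_zero_or_pos n with h | h
    · exact ⟨0, by omega, by omega, x, by simp, by simpa using hδ⟩
    · refine ⟨n - 1, by omega, by omega, ?_⟩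
      obtain ⟨v, hv, hv'⟩ := hslim (p.getVert (n - 1)) (SimpleGraph.Walk.getVert_mem_support _ _)
      rcases hv with hv | hv
      · exact absurd ⟨by omega, v, hv, hv'⟩ (Nat.find_min h0 (m := n - 1) (by omega))
      · exact ⟨v, hv, hv'⟩
  obtain ⟨m, hmn, hnm, a, ha, hma⟩ := hm
  refine ⟨p.getVert n, SimpleGraph.Walk.getVert_mem_support _ _, ?_⟩
  have hmn1 : (G.dist (p.getVert m) (p.getVert n) : ℝ) ≤ 1 := by
    rw [dist_getVert hG p hp hmn h1]
    exact_mod_cast (by omega : n - m ≤ 1)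
  set u := p.getVert n
  set u' := p.getVert m
  have e1 : (G.dist x a : ℝ) + G.dist a w = G.dist x w := by
    exact_mod_cast dist_add_dist_of_mem_support hG r hr ha
  have e2 : (G.dist z b : ℝ) + G.dist b w = G.dist z w := by
    exact_mod_cast dist_add_dist_of_mem_support hG q hq hb
  have t1 := dist_tri hG w a u
  have t2 := dist_tri hG a u' u
  have t3 := dist_tri hG w b u
  have t4 := dist_tri hG x z u
  have t5 := dist_tri hG x a u
  have t6 := dist_tri hG z b u
  have t7 := dist_tri hG x u z
  rw [dist_symm_real u' a] at hma
  rw [dist_symm_real u b] at hnb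
  rw [dist_symm_real w a, dist_symm_real w x, dist_symm_real w z] at *
  rw [dist_symm_real w b] at t3
  rw [dist_symm_real u z] at t7
  linarith

/-- Slim triangles imply the four point condition: a point of `[x, z]` at distance about `(x | z)_w`
from `w` is close to `[x, y]` or to `[y, z]`, whose distances from `w` are at least `(x | y)_w` and
`(y | z)_w`. -/
theorem IsHyperbolic.fourPoint (h : IsHyperbolic G δ) : FourPoint G (3 * δ + 2) := by
  intro w x y z
  have hG := h.1
  obtain ⟨p, hp⟩ := hG.exists_walk_length_eq_dist x z
  obtain ⟨q, hq⟩ := hG.exists_walk_length_eq_dist z y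
  obtain ⟨r, hr⟩ := hG.exists_walk_length_eq_dist x y
  obtain ⟨u, hu, hwu⟩ := h.dist_geodesic_le w x z p hp
  obtain ⟨v, hv, huv⟩ := h.2 x z y p q r hp hq hr u hu
  have t0 := dist_tri hG w u v
  rcases hv with hv | hv
  · have e : (G.dist z v : ℝ) + G.dist v y = G.dist z y := by
      exact_mod_cast dist_add_dist_of_mem_support hG q hq hv
    have t1 := dist_tri hG w v y
    have t2 := dist_tri hG w v z
    rw [dist_symm_real v z] at t2
    rw [dist_symm_real y z]
    left; linarith
  · have e : (G.dist x v : ℝ) + G.dist v y = G.dist x y := by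
      exact_mod_cast dist_add_dist_of_mem_support hG r hr hv
    have t1 := dist_tri hG w v y
    have t2 := dist_tri hG w v x
    rw [dist_symm_real v x] at t2
    right; linarith

end FourPoint

/-! ### Projections to coarsely convex sets -/

section Projection

variable {V : Type*} {G : SimpleGraph V} {δ c : ℝ}

theorem gromovProduct_symm (o x y : V) : gromovProduct G o x y = gromovProduct G o y x := by
  unfold gromovProduct
  rw [dist_symm_real x y]
  ring

theorem FourPoint.min_le (h : FourPoint G δ) (w x y z : V) :
    min (gromovProduct G w x y) (gromovProduct G w y z) - δ ≤ gromovProduct G w x z := by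
  unfold gromovProduct
  rcases h w x y z with h | h
  · refine le_trans (sub_le_sub_right (min_le_right _ _) _) ?_
    linarith
  · refine le_trans (sub_le_sub_right (min_le_left _ _) _) ?_
    linarith

theorem FourPoint.le_gromovProduct (h : FourPoint G δ) {w x y z : V} {r : ℝ}
    (h1 : r ≤ gromovProduct G w x y) (h2 : r ≤ gromovProduct G w y z) :
    r - δ ≤ gromovProduct G w x z :=
  (sub_le_sub_right (le_min h1 h2) δ).trans (h.min_le w x y z)

theorem gromovProduct_nonneg (hG : G.Connected) (o x y : V) : 0 ≤ gromovProduct G o x y := by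
  unfold gromovProduct
  have := dist_tri hG x o y
  rw [dist_symm_real x o] at this
  linarith

theorem gromovProduct_le_dist (hG : G.Connected) (o x y : V) :
    gromovProduct G o x y ≤ G.dist o x := by
  unfold gromovProduct
  have := dist_tri hG o x y
  linarith

/-- `(x | y)_o` and `(o | y)_x` add up to `d(o, x)`. -/
theorem gromovProduct_add (o x y : V) :
    gromovProduct G o x y + gromovProduct G x o y = G.dist o x := by
  unfold gromovProduct
  rw [dist_symm_real x o]
  ring

/-- Moving each of the three points changes the Gromov product by at most the distances moved. -/
theorem gromovProduct_le_of_near (hG : G.Connected) (o x y o' x' y' : V) :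
    gromovProduct G o' x' y' ≤
      gromovProduct G o x y + G.dist o o' + G.dist x x' + G.dist y y' := by
  unfold gromovProduct
  have h1 := dist_tri hG o' o x'
  have h2 := dist_tri hG o x x'
  have h3 := dist_tri hG o' o y'
  have h4 := dist_tri hG o y y'
  have h5 := dist_tri hG x x' y
  have h6 := dist_tri hG x' y' y
  rw [dist_symm_real o' o] at h1 h3
  rw [dist_symm_real y' y] at h6
  linarith

/-- Any two points of `A` are joined by points of `A` which lie, up to the error `c`, on a
geodesic. -/
def CoarselyConvex (G : SimpleGraph V) (c : ℝ) (A : Set V) : Prop :=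
  ∀ p ∈ A, ∀ q ∈ A, ∀ h : ℕ, h ≤ G.dist p q →
    ∃ u ∈ A, (G.dist p u : ℝ) ≤ h + c ∧ (G.dist u q : ℝ) ≤ G.dist p q - h + c

theorem IsQuasiconvex.coarselyConvex {A : Set V} (hG : G.Connected) (h : IsQuasiconvex G c A) :
    CoarselyConvex G c A := by
  intro p hp q hq n hn
  obtain ⟨r, hr⟩ := hG.exists_walk_length_eq_dist p q
  obtain ⟨a, ha, hd⟩ := h p hp q hq r hr (r.getVert n) (SimpleGraph.Walk.getVert_mem_support _ _)
  have h1 := dist_getVert hG r hr (Nat.zero_le n) (by omega)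
  have h2 := dist_getVert hG r hr (i := n) (by omega) le_rfl
  simp only [SimpleGraph.Walk.getVert_zero, SimpleGraph.Walk.getVert_length, Nat.sub_zero] at h1 h2
  have t1 := dist_tri hG p (r.getVert n) a
  have t2 := dist_tri hG a (r.getVert n) q
  rw [dist_symm_real a (r.getVert n)] at t2
  refine ⟨a, ha, ?_, ?_⟩
  · rw [h1] at t1

    linarith
  · rw [h2, hr, Nat.cast_sub hn] at t2
    linarith

/-- A nearest point projection is close to every geodesic from the projected point into the set. -/
theorem IsNearest.gromovProduct_le (hG : G.Connected) (h4 : FourPoint G δ) {A : Set V}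
    (hA : CoarselyConvex G c A) {x p q : V} (hp : IsNearest G A x p) (hq : q ∈ A) :
    gromovProduct G p x q ≤ c + 2 * δ + 1 := by
  set g := gromovProduct G p x q with hg
  have hg0 : 0 ≤ g := gromovProduct_nonneg hG _ _ _
  have hfl := Nat.floor_le hg0
  have hfl2 := Nat.lt_floor_add_one g
  have hle : (⌊g⌋₊ : ℝ) ≤ G.dist p q := by
    refine hfl.trans ?_
    rw [hg, gromovProduct_symm]
    exact gromovProduct_le_dist hG _ _ _
  obtain ⟨u, hu, hpu, huq⟩ := hA p hp.1 q hq ⌊g⌋₊ (by exact_mod_cast hle)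
  have hxu : (G.dist x p : ℝ) ≤ G.dist x u := by exact_mod_cast hp.2 u hu
  have e : (G.dist p x : ℝ) + G.dist p q - G.dist x q = 2 * g := by
    rw [hg]; unfold gromovProduct; ring
  rw [dist_symm_real p x] at e
  have hup := dist_symm_real (G := G) p u
  have hqu := dist_symm_real (G := G) q u
  have hqp := dist_symm_real (G := G) q p
  rcases h4 x p u q with h | h <;> linarith

/-- Nearest point projections on coarsely convex sets are coarsely Lipschitz. -/
theorem IsNearest.dist_le (hG : G.Connected) (h4 : FourPoint G δ) {A : Set V}
    (hA : CoarselyConvex G c A) {x x' p p' : V} (hp : IsNearest G A x p)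
    (hp' : IsNearest G A x' p') :
    (G.dist p p' : ℝ) ≤ 2 * (c + 2 * δ + 1) + G.dist x x' := by
  have h1 := hp.gromovProduct_le hG h4 hA hp'.1
  have h2 := hp'.gromovProduct_le hG h4 hA hp.1
  have h3 := gromovProduct_le_of_near hG p' x' p p' x p
  simp only [SimpleGraph.dist_self] at h3
  have h5 := gromovProduct_add (G := G) p p' x
  rw [gromovProduct_symm p p' x, gromovProduct_symm p' p x] at h5
  rw [dist_symm_real x x']
  push_cast at h3
  linarith

/-- If the projections `p`, `p'` of `x`, `x'` are far apart then geodesics `[x, x']` pass close to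
both of them. -/
theorem IsNearest.gromovProduct_le_of_far (hG : G.Connected) (h4 : FourPoint G δ) {A : Set V}
    (hA : CoarselyConvex G c A) {x x' p p' : V} (hp : IsNearest G A x p)
    (hp' : IsNearest G A x' p') (hfar : 2 * (c + 2 * δ + 1) + δ < G.dist p p') :
    gromovProduct G p x x' ≤ c + 3 * δ + 1 := by
  have h1 := hp.gromovProduct_le hG h4 hA hp'.1
  have h2 := hp'.gromovProduct_le hG h4 hA hp.1
  have h3 := h4.min_le p x x' p'
  have h5 := gromovProduct_add (G := G) p p' x'
  rw [gromovProduct_symm p p' x', gromovProduct_symm p' p x'] at h5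
  by_contra h
  rcases min_choice (gromovProduct G p x x') (gromovProduct G p x' p') with hm | hm <;>
    rw [hm] at h3 <;> linarith

/-- A point with small Gromov product is close to a point on a geodesic. -/
theorem exists_between_of_gromovProduct_le (hG : G.Connected) (h4 : FourPoint G δ) {x y z : V}
    (h : gromovProduct G z x y ≤ c) :
    ∃ u, G.dist x u + G.dist u y = G.dist x y ∧ (G.dist z u : ℝ) ≤ 2 * c + 2 * δ := by
  obtain ⟨u, hxu, huy⟩ := exists_geodesic_point hG x y (min_le_right (G.dist x z) (G.dist x y))
  refine ⟨u, by omega, ?_⟩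
  have hg := gromovProduct_nonneg hG z x y
  unfold gromovProduct at h hg
  have hzx := dist_symm_real (G := G) z x
  have hzy := dist_symm_real (G := G) z y
  have huy' := dist_symm_real (G := G) u y
  have hux := dist_symm_real (G := G) u x
  rcases le_total (G.dist x z) (G.dist x y) with hle | hle
  · rw [min_eq_left hle] at hxu huy
    have a1 : (G.dist x u : ℝ) = G.dist x z := by exact_mod_cast hxu
    have a2 : (G.dist u y : ℝ) + G.dist x z = G.dist x y := by exact_mod_cast huy
    rcases h4 z x u y with h' | h' <;> linarith
  · rw [min_eq_right hle] at hxu huy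
    have huy0 : u = y := hG.dist_eq_zero_iff.1 (by omega)
    rw [huy0]
    have : (G.dist x y : ℝ) ≤ G.dist x z := by exact_mod_cast hle
    have hd : 0 ≤ δ := by
      rcases h4 z z z z with h' | h' <;> simp at h' <;> linarith
    linarith

end Projection

/-! ### Stability of quasi-geodesics -/

section Morse

variable {V : Type*} {G : SimpleGraph V} {δ : ℝ}

theorem FourPoint.nonneg (h : FourPoint G δ) (v : V) : 0 ≤ δ := by
  rcases h v v v v with h' | h' <;> simp at h' <;> linarith

/-- Halving the path `k` times: the Gromov product of the ends of a path of length at most `2 ^ k`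
is bounded below by those of its steps, with an error linear in `k`. -/
theorem FourPoint.le_gromovProduct_of_path (h4 : FourPoint G δ) (γ : ℕ → V) (w : V) (r : ℝ)
    (k : ℕ) : ∀ a n : ℕ, 1 ≤ n → n ≤ 2 ^ k →
      (∀ i < n, r ≤ gromovProduct G w (γ (a + i)) (γ (a + i + 1))) →
      r - k * δ ≤ gromovProduct G w (γ a) (γ (a + n)) := by
  have hδ := h4.nonneg w
  induction k with
  | zero =>
    intro a n h1 h2 h
    obtain rfl : n = 1 := by simp at h2; omega
    simpa using h 0 one_pos
  | succ k ih =>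
    intro a n h1 h2 h
    push_cast
    rcases le_or_gt n (2 ^ k) with hn | hn
    · have := ih a n h1 hn h
      linarith
    · have e : a + 2 ^ k + (n - 2 ^ k) = a + n := by omega
      have i1 := ih a (2 ^ k) Nat.one_le_two_pow le_rfl (fun i hi => h i (by omega))
      have i2 := ih (a + 2 ^ k) (n - 2 ^ k) (by omega) (by rw [pow_succ] at h2; omega)
        (fun i hi => by
          have := h (2 ^ k + i) (by omega)
          simpa only [add_assoc] using this)
      rw [e] at i2
      have := h4.le_gromovProduct i1 i2
      linarith

/-- A path of `n ≤ 2 ^ k` steps of length at most `s` passes close to every point of a geodesic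
between its ends, up to an error logarithmic in `n`. -/
theorem FourPoint.exists_dist_le_of_path (hG : G.Connected) (h4 : FourPoint G δ) (γ : ℕ → V) (w : V)
    (s : ℝ) (hs : 0 ≤ s) (k a n : ℕ) (hn : n ≤ 2 ^ k)
    (h : ∀ i < n, (G.dist (γ (a + i)) (γ (a + i + 1)) : ℝ) ≤ s) :
    ∃ j ≤ n, (G.dist w (γ (a + j)) : ℝ) ≤ gromovProduct G w (γ a) (γ (a + n)) + k * δ + s := by
  have hδ := h4.nonneg w
  rcases Nat.eq_zero_or_pos n with rfl | hpos
  · refine ⟨0, le_rfl, ?_⟩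
    have : gromovProduct G w (γ a) (γ a) = G.dist w (γ a) := by
      unfold gromovProduct; simp
    simp only [add_zero, this]
    have : 0 ≤ k * δ := by positivity
    linarith
  · by_contra! hc
    obtain ⟨i, hi, h1⟩ : ∃ i < n, gromovProduct G w (γ (a + i)) (γ (a + i + 1)) ≤
        gromovProduct G w (γ a) (γ (a + n)) + k * δ := by
      by_contra! hc'
      -- apply the bound with the smallest Gromov product of a step
      obtain ⟨i0, hi0, hmin⟩ := Finset.exists_min_image (Finset.range n)
        (fun i => gromovProduct G w (γ (a + i)) (γ (a + i + 1))) ⟨0, by simpa using hpos⟩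
      have h2 := h4.le_gromovProduct_of_path γ w _ k a n hpos hn
        (fun i hi => hmin i (by simpa using hi))
      have h3 := hc' i0 (by simpa using hi0)
      linarith
    have h2 := hc i hi.le
    have h3 := gromovProduct_add (G := G) w (γ (a + i)) (γ (a + i + 1))
    have h5 := gromovProduct_symm (G := G) (γ (a + i)) w (γ (a + i + 1))
    have h6 := gromovProduct_le_dist hG (γ (a + i)) (γ (a + i + 1)) w
    have h7 := h i hi
    linarith

/-- `γ` is on `{0, …, n}` a quasi-geodesic with constant `lam`; the lower bound for the distance is
written without division. -/
def IsQuasiGeodesic (G : SimpleGraph V) (lam : ℝ) (n : ℕ) (γ : ℕ → V) : Prop :=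
  ∀ i j : ℕ, i ≤ j → j ≤ n → ((j : ℝ) - i) ≤ lam * (G.dist (γ i) (γ j) + lam) ∧
    (G.dist (γ i) (γ j) : ℝ) ≤ lam * ((j : ℝ) - i) + lam

theorem exists_bound_of_two_pow_le (A B : ℝ) :
    ∃ k₀ : ℕ, ∀ k : ℕ, (2 : ℝ) ^ k ≤ A + B * k → k ≤ k₀ := by
  have h1 := tendsto_pow_const_div_const_pow_of_one_lt 0 (r := (2 : ℝ)) (by norm_num)
  have h2 := tendsto_pow_const_div_const_pow_of_one_lt 1 (r := (2 : ℝ)) (by norm_num)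
  have h3 := (h1.const_mul A).add (h2.const_mul B)
  simp only [mul_zero, add_zero] at h3
  obtain ⟨k₀, hk⟩ := Filter.eventually_atTop.1 (h3.eventually_lt_const (by norm_num : (0 : ℝ) < 1))
  refine ⟨k₀, fun k hle => ?_⟩
  by_contra! hlt
  have h4 := hk k hlt.le
  have hp : (0 : ℝ) < 2 ^ k := by positivity
  have : A * ((k : ℝ) ^ 0 / 2 ^ k) + B * ((k : ℝ) ^ 1 / 2 ^ k) = (A + B * k) / 2 ^ k := by
    field_simp
  rw [this, div_lt_one hp] at h4
  linarith

/-- Core estimate for stability of quasi-geodesics.  If `R` is the largest deviation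
`(γ a | γ b)_{γ i}` and is attained at `a ≤ i ≤ b`, then the portions of `γ` of length about `R`
before and after `i` fellow travel for a distance `R / 2`, which forces `R ≲ log R`. -/
theorem FourPoint.deviation_le (hG : G.Connected) (h4 : FourPoint G δ) {lam : ℝ} (hl : 1 ≤ lam)
    {n : ℕ} {γ : ℕ → V} (hγ : IsQuasiGeodesic G lam n γ) {a i b : ℕ} (hai : a ≤ i) (hib : i ≤ b)
    (hb : b ≤ n) {R : ℝ} (hR : gromovProduct G (γ i) (γ a) (γ b) = R) (hR4 : 4 * δ ≤ R)
    (hmax : ∀ a' i' b', a' ≤ i' → i' ≤ b' → b' ≤ n → gromovProduct G (γ i') (γ a') (γ b') ≤ R)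
    {k : ℕ} (hk : lam * (2 * R + lam) ≤ 2 ^ k) :
    R / 2 - 1 ≤ k * δ + 2 * lam + lam + lam ^ 2 * (2 * (k * δ) + 3 * δ + 4 * lam + lam) := by
  set w := γ i with hw
  have hδ := h4.nonneg w
  have hR0 : 0 ≤ R := by linarith
  set m : ℕ := ⌈lam * (2 * R + lam)⌉₊ with hm
  have hm1 : lam * (2 * R + lam) ≤ m := Nat.le_ceil _
  have hm2 : m ≤ 2 ^ k := by
    rw [hm]
    exact Nat.ceil_le.2 (by exact_mod_cast hk)
  have hfar : ∀ d : ℝ, (m : ℝ) ≤ lam * (d + lam) → 2 * R ≤ d := by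
    intro d hd
    have : lam * (2 * R + lam) ≤ lam * (d + lam) := hm1.trans hd
    have := le_of_mul_le_mul_left this (by linarith)
    linarith
  set a' := max a (i - m) with ha'
  set b' := min b (i + m) with hb'
  have ga : R - δ ≤ gromovProduct G w (γ a') (γ b) := by
    rcases le_total (i - m) a with h | h
    · rw [ha', max_eq_left h]; linarith
    · rcases Nat.lt_or_ge i m with hlt | hge
      · have : a = 0 := by omega
        rw [ha', max_eq_left (by omega)]; linarith
      rw [ha', max_eq_right h]
      have h1 := (hγ (i - m) i (by omega) (by omega)).1
      rw [Nat.cast_sub hge] at h1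
      have h2 := hfar (G.dist (γ (i - m)) (γ i)) (by linarith)
      have h3 := hmax a (i - m) i h (by omega) (by omega)
      have h5 := gromovProduct_add (G := G) (γ (i - m)) w (γ a)
      rw [gromovProduct_symm (γ (i - m)) w] at h5
      exact h4.le_gromovProduct (y := γ a) (by linarith) hR.ge
  have gb : R - 2 * δ ≤ gromovProduct G w (γ a') (γ b') := by
    rcases le_total b (i + m) with h | h
    · rw [hb', min_eq_left h]; linarith
    · rw [hb', min_eq_right h]
      have h1 := (hγ i (i + m) (by omega) (by omega)).1
      push_cast at h1
      have h2 := hfar (G.dist (γ i) (γ (i + m))) (by linarith)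
      have h3 := hmax i (i + m) b (by omega) h hb
      have h5 := gromovProduct_add (G := G) w (γ (i + m)) (γ b)
      rw [gromovProduct_symm w] at h5
      have := h4.le_gromovProduct (z := γ (i + m)) ga (by linarith)
      linarith
  have hai' : a' ≤ i := by omega
  have hib' : i ≤ b' := by omega
  -- a point `u` on a geodesic from `w` to `γ a'` at distance about `R / 2` from `w`
  set h : ℕ := ⌊R / 2⌋₊ with hh
  have hh1 : (h : ℝ) ≤ R / 2 := Nat.floor_le (by linarith)
  have hh2 : R / 2 < h + 1 := Nat.lt_floor_add_one _
  have hda := gromovProduct_le_dist hG w (γ a') (γ b')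
  obtain ⟨u, hwu, hua⟩ := exists_geodesic_point hG w (γ a') (n := h)
    (by have : (h : ℝ) ≤ G.dist w (γ a') := by linarith
        exact_mod_cast this)
  have hwu' : (G.dist w u : ℝ) = h := by exact_mod_cast hwu
  have hua' : (G.dist u (γ a') : ℝ) + h = G.dist w (γ a') := by exact_mod_cast hua
  have hstep : ∀ j < n, (G.dist (γ j) (γ (j + 1)) : ℝ) ≤ 2 * lam := by
    intro j hj
    have := (hγ j (j + 1) (by omega) (by omega)).2
    push_cast at this
    linarith
  obtain ⟨j, hj, hju⟩ := h4.exists_dist_le_of_path hG γ u (2 * lam) (by linarith) k a' (i - a')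
    (by omega) (fun l hl => hstep _ (by omega))
  obtain ⟨l, hl', hlu⟩ := h4.exists_dist_le_of_path hG γ u (2 * lam) (by linarith) k i (b' - i)
    (by omega) (fun l hl => hstep _ (by omega))
  rw [show a' + (i - a') = i by omega, ← hw] at hju
  rw [show i + (b' - i) = b' by omega, ← hw] at hlu
  have p1 : gromovProduct G u (γ a') w = 0 := by
    unfold gromovProduct
    rw [dist_symm_real u w, dist_symm_real (γ a') w]
    linarith
  have p2 : gromovProduct G u w (γ b') ≤ 3 * δ := by
    have q2 : gromovProduct G w (γ a') u = h := by
      unfold gromovProduct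
      rw [dist_symm_real (γ a') u]
      linarith
    have q3 := gromovProduct_add (G := G) w u (γ b')
    rw [gromovProduct_symm w u] at q3
    rw [gromovProduct_symm] at gb
    have := h4.le_gromovProduct (r := (h : ℝ) - 2 * δ) (x := γ b') (y := γ a') (z := u)
      (by linarith) (by linarith)
    linarith
  rw [p1] at hju
  have d1 := dist_tri hG (γ (a' + j)) u (γ (i + l))
  rw [dist_symm_real _ u] at d1
  have d2 := dist_tri hG w (γ (a' + j)) u
  rw [dist_symm_real (γ (a' + j)) u] at d2
  have d3 := (hγ (a' + j) i (by omega) (by omega)).2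
  have d4 := (hγ (a' + j) (i + l) (by omega) (by omega)).1
  rw [← hw, dist_symm_real _ w] at d3
  have hl0 : (0 : ℝ) ≤ l := by positivity
  push_cast at d3 d4
  have d5 : (i : ℝ) - (a' + j) ≤ lam * (2 * (k * δ) + 3 * δ + 4 * lam + lam) := by
    have : lam * ((G.dist (γ (a' + j)) (γ (i + l)) : ℝ) + lam) ≤
        lam * (2 * (k * δ) + 3 * δ + 4 * lam + lam) :=
      mul_le_mul_of_nonneg_left (by linarith) (by linarith)
    linarith
  have d6 := mul_le_mul_of_nonneg_left d5 (by linarith : (0 : ℝ) ≤ lam)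
  have e : lam * (lam * (2 * (k * δ) + 3 * δ + 4 * lam + lam)) =
      lam ^ 2 * (2 * (k * δ) + 3 * δ + 4 * lam + lam) := by ring
  linarith

/-- Stability of quasi-geodesics: all points of a quasi-geodesic are uniformly close to a geodesic
between its ends. -/
theorem exists_morse_constant (δ lam : ℝ) (hl : 1 ≤ lam) :
    ∃ c : ℝ, 0 ≤ c ∧ ∀ (V : Type u₁) (G : SimpleGraph V), G.Connected → FourPoint G δ →
      ∀ (n : ℕ) (γ : ℕ → V), IsQuasiGeodesic G lam n γ →
      ∀ i ≤ n, gromovProduct G (γ i) (γ 0) (γ n) ≤ c := by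
  -- the deviation is at most `A + B * k`, where `2 ^ k` is comparable to it
  set A : ℝ := 2 * (1 + 2 * lam + lam + lam ^ 2 * (3 * δ + 4 * lam + lam)) with hA
  set B : ℝ := 2 * (δ + lam ^ 2 * (2 * δ)) with hB
  obtain ⟨k₀, hk₀⟩ := exists_bound_of_two_pow_le (2 * (lam * (2 * A + lam))) (2 * (lam * (2 * B)))
  refine ⟨max (4 * δ) (A + |B| * k₀) ⊔ 0, le_max_right _ _, ?_⟩
  intro V G hG h4 n γ hγ i hi
  have hδ := h4.nonneg (γ i)
  have hB0 : 0 ≤ B := by positivity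
  have hA0 : 0 ≤ A := by positivity
  obtain ⟨⟨a, j, b⟩, hmem, hmax⟩ := Finset.exists_max_image
    (((Finset.range (n + 1)) ×ˢ (Finset.range (n + 1)) ×ˢ (Finset.range (n + 1))).filter
      (fun t => t.1 ≤ t.2.1 ∧ t.2.1 ≤ t.2.2))
    (fun t => gromovProduct G (γ t.2.1) (γ t.1) (γ t.2.2))
    ⟨(0, i, n), by simp; omega⟩
  simp only [Finset.mem_filter, Finset.mem_product, Finset.mem_range] at hmem hmax
  have hmax' : ∀ a' i' b', a' ≤ i' → i' ≤ b' → b' ≤ n →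
      gromovProduct G (γ i') (γ a') (γ b') ≤ gromovProduct G (γ j) (γ a) (γ b) :=
    fun a' i' b' h1 h2 h3 => hmax (a', i', b') ⟨by simp only; omega, h1, h2⟩
  refine (hmax' 0 i n (Nat.zero_le _) hi le_rfl).trans ?_
  set R := gromovProduct G (γ j) (γ a) (γ b) with hR
  have hR0 : 0 ≤ R := gromovProduct_nonneg hG _ _ _
  rcases le_or_gt R (4 * δ) with hs | hs
  · exact le_max_of_le_left (le_max_of_le_left hs)
  refine le_max_of_le_left (le_max_of_le_right ?_)
  set m : ℕ := ⌈lam * (2 * R + lam)⌉₊ with hm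
  have hm0 : (1 : ℝ) ≤ lam * (2 * R + lam) := by nlinarith
  have hk1 : lam * (2 * R + lam) ≤ (2 : ℝ) ^ Nat.clog 2 m :=
    (Nat.le_ceil _).trans (by exact_mod_cast Nat.le_pow_clog (by norm_num) m)
  have hdev := h4.deviation_le hG hl hγ hmem.2.1 hmem.2.2 (by omega) hR.symm hs.le hmax' hk1
  set k := Nat.clog 2 m with hk
  have hRk : R ≤ A + B * k := by
    rw [hA, hB]
    linarith
  have hk2 : (2 : ℝ) ^ k ≤ 2 * (lam * (2 * R + lam)) := by
    rcases Nat.eq_zero_or_pos k with h0 | h0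
    · rw [h0]; linarith
    · have h1 : 2 ^ (k - 1) < m := by
        have := (Nat.lt_clog_iff_pow_lt (b := 2) (by norm_num) (x := m) (y := k - 1)).1 (by omega)
        exact this
      have h2 : (2 : ℝ) ^ (k - 1) ≤ lam * (2 * R + lam) := by
        have := Nat.lt_ceil.1 (hm ▸ h1)
        push_cast at this
        exact this.le
      have h3 : (2 : ℝ) ^ k = 2 * 2 ^ (k - 1) := by
        rw [← pow_succ', Nat.sub_add_cancel h0]
      linarith
  have hle : lam * (2 * R + lam) ≤ lam * (2 * (A + B * k) + lam) := by gcongr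
  have hkk : (k : ℝ) ≤ k₀ := by
    exact_mod_cast hk₀ k (by nlinarith)
  have := mul_le_mul_of_nonneg_left hkk hB0
  rw [abs_of_nonneg hB0]
  linarith

end Morse

/-! ### Quasi-isometric embeddings of hyperbolic graphs -/

section QI

variable {V : Type*} {G : SimpleGraph V} {W : Type*} {H : SimpleGraph W} {δ c lam : ℝ}

theorem IsQIEmb.dist_le {φ : V → W} (h : IsQIEmb lam lam G H φ) (x y : V) :
    (H.dist (φ x) (φ y) : ℝ) ≤ lam * G.dist x y + lam := (h x y).2

theorem IsQIEmb.le_mul_dist {φ : V → W} (hl : 1 ≤ lam) (h : IsQIEmb lam lam G H φ) (x y : V) :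
    (G.dist x y : ℝ) ≤ lam * (H.dist (φ x) (φ y) + lam) := by
  have h1 := (h x y).1
  have h2 : (1 / lam) * (G.dist x y : ℝ) ≤ H.dist (φ x) (φ y) + lam := by linarith
  rw [one_div, inv_mul_le_iff₀ (by linarith)] at h2
  exact h2

theorem IsQIEmb.isQuasiGeodesic {φ : V → W} (hl : 1 ≤ lam) (hG : G.Connected)
    (h : IsQIEmb lam lam G H φ) {x y : V} (p : G.Walk x y) (hp : p.length = G.dist x y) :
    IsQuasiGeodesic H lam p.length (fun i => φ (p.getVert i)) := by
  intro i j hij hj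
  have e : (G.dist (p.getVert i) (p.getVert j) : ℝ) = j - i := by
    rw [dist_getVert hG p hp hij hj, Nat.cast_sub hij]
  have h1 := h.le_mul_dist hl (p.getVert i) (p.getVert j)
  have h2 := h.dist_le (p.getVert i) (p.getVert j)
  rw [e] at h1 h2
  exact ⟨h1, h2⟩

/-- Every geodesic triangle has an approximate centre. -/
theorem exists_centre (hG : G.Connected) (h4 : FourPoint G δ) (x y z : V) :
    ∃ m, gromovProduct G m x y ≤ 1 + δ ∧ gromovProduct G m x z ≤ 1 + δ ∧
      gromovProduct G m y z ≤ 1 + δ := by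
  have hδ := h4.nonneg x
  set g := gromovProduct G x y z with hg
  have hg0 : 0 ≤ g := gromovProduct_nonneg hG _ _ _
  have hfl := Nat.floor_le hg0
  have hfl2 := Nat.lt_floor_add_one g
  have hle : (⌊g⌋₊ : ℝ) ≤ G.dist x y := hfl.trans (gromovProduct_le_dist hG _ _ _)
  obtain ⟨m, h1, h2⟩ := exists_geodesic_point hG x y (n := ⌊g⌋₊) (by exact_mod_cast hle)
  have h1' : (G.dist x m : ℝ) = ⌊g⌋₊ := by exact_mod_cast h1
  have h2' : (G.dist m y : ℝ) + ⌊g⌋₊ = G.dist x y := by exact_mod_cast h2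
  have e : (G.dist x y : ℝ) + G.dist x z - G.dist y z = 2 * g := by
    rw [hg]; unfold gromovProduct; ring
  have s1 := dist_symm_real (G := G) m x
  have s2 := dist_symm_real (G := G) z y
  refine ⟨m, ?_, ?_, ?_⟩ <;> unfold gromovProduct <;>
    rcases h4 m x z y with h | h <;> linarith

/-- Quasi-isometric embeddings of hyperbolic graphs send points close to a geodesic `[x, y]` to
points close to the geodesics between the images. -/
theorem exists_gromovProduct_map_le (δ lam c : ℝ) (hl : 1 ≤ lam) :
    ∃ c' : ℝ, 0 ≤ c' ∧ ∀ (V : Type u₁) (G : SimpleGraph V) (W : Type u₂) (H : SimpleGraph W)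
      (φ : V → W), G.Connected → FourPoint G δ → H.Connected → FourPoint H δ →
      IsQIEmb lam lam G H φ → ∀ x y z, gromovProduct G z x y ≤ c →
      gromovProduct H (φ z) (φ x) (φ y) ≤ c' := by
  obtain ⟨c₁, hc₁, hM⟩ := exists_morse_constant.{u₂} δ lam hl
  refine ⟨max 0 (c₁ + (lam * (2 * c + 2 * δ) + lam)), le_max_left _ _, ?_⟩
  intro V G W H φ hG h4 hH h4' hφ x y z hz
  refine le_max_of_le_right ?_
  obtain ⟨u, hu, hzu⟩ := exists_between_of_gromovProduct_le hG h4 hz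
  obtain ⟨p, hp⟩ := hG.exists_walk_length_eq_dist x u
  obtain ⟨q, hq⟩ := hG.exists_walk_length_eq_dist u y
  have hpq : (p.append q).length = G.dist x y := by
    rw [SimpleGraph.Walk.length_append]; omega
  have hmem : u ∈ (p.append q).support := by
    rw [SimpleGraph.Walk.mem_support_append_iff]
    exact Or.inl (SimpleGraph.Walk.end_mem_support p)
  obtain ⟨i, hi, hin⟩ := SimpleGraph.Walk.mem_support_iff_exists_getVert.1 hmem
  have h1 := hM W H hH h4' _ _ (hφ.isQuasiGeodesic hl hG _ hpq) i hin
  simp only [SimpleGraph.Walk.getVert_zero, SimpleGraph.Walk.getVert_length, hi] at h1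
  have h2 := gromovProduct_le_of_near hH (φ u) (φ x) (φ y) (φ z) (φ x) (φ y)
  simp only [SimpleGraph.dist_self, Nat.cast_zero, add_zero] at h2
  have h3 := hφ.dist_le u z
  rw [dist_symm_real u z] at h3
  have h5 := mul_le_mul_of_nonneg_left hzu (by linarith : (0 : ℝ) ≤ lam)
  linarith

/-- Converse of `exists_gromovProduct_map_le`: a centre of the triangle `x`, `y`, `z` is sent to a
centre of the image triangle, hence close to the image of `z`. -/
theorem exists_gromovProduct_le_of_map (δ lam c : ℝ) (hl : 1 ≤ lam) :
    ∃ c' : ℝ, 0 ≤ c' ∧ ∀ (V : Type u₁) (G : SimpleGraph V) (W : Type u₂) (H : SimpleGraph W)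
      (φ : V → W), G.Connected → FourPoint G δ → H.Connected → FourPoint H δ →
      IsQIEmb lam lam G H φ → ∀ x y z, gromovProduct H (φ z) (φ x) (φ y) ≤ c →
      gromovProduct G z x y ≤ c' := by
  obtain ⟨c₁, hc₁, hM⟩ := exists_gromovProduct_map_le.{u₁, u₂} δ lam (1 + δ) hl
  refine ⟨max 0 (1 + δ + lam * (c + δ + c₁ + lam)), le_max_left _ _, ?_⟩
  intro V G W H φ hG h4 hH h4' hφ x y z hz
  refine le_max_of_le_right ?_
  obtain ⟨m, h1, h2, h3⟩ := exists_centre hG h4 x y z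
  have k2 := hM V G W H φ hG h4 hH h4' hφ x z m h2
  have k3 := hM V G W H φ hG h4 hH h4' hφ y z m h3
  have hd : (H.dist (φ m) (φ z) : ℝ) ≤ c + δ + c₁ := by
    have a1 := gromovProduct_add (G := H) (φ m) (φ z) (φ x)
    have a2 := gromovProduct_add (G := H) (φ m) (φ z) (φ y)
    rw [gromovProduct_symm (φ m)] at a1 a2
    have a3 := h4'.min_le (φ z) (φ x) (φ m) (φ y)
    rw [gromovProduct_symm (φ z) (φ x) (φ m)] at a3
    rcases min_choice (gromovProduct H (φ z) (φ m) (φ x)) (gromovProduct H (φ z) (φ m) (φ y))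
      with hm | hm <;> rw [hm] at a3 <;> linarith
  have h5 := hφ.le_mul_dist hl m z
  have h6 := gromovProduct_le_of_near hG m x y z x y
  simp only [SimpleGraph.dist_self, Nat.cast_zero, add_zero] at h6
  have h7 : lam * ((H.dist (φ m) (φ z) : ℝ) + lam) ≤ lam * (c + δ + c₁ + lam) :=
    mul_le_mul_of_nonneg_left (by linarith) (by linarith)
  linarith

/-- The image of a quasi-isometric embedding is coarsely convex: a point close to a geodesic between
two image points is close to the image. -/
theorem exists_dist_map_le (δ lam c : ℝ) (hl : 1 ≤ lam) :
    ∃ c' : ℝ, 0 ≤ c' ∧ ∀ (V : Type u₁) (G : SimpleGraph V) (W : Type u₂) (H : SimpleGraph W)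
      (φ : V → W), G.Connected → H.Connected → FourPoint H δ →
      IsQIEmb lam lam G H φ → ∀ x y p, gromovProduct H p (φ x) (φ y) ≤ c →
      ∃ t, (H.dist (φ t) p : ℝ) ≤ c' := by
  obtain ⟨c₁, hc₁, hM⟩ := exists_morse_constant.{u₂} δ lam hl
  refine ⟨max 0 (4 * c + 2 * lam + 2 * c₁ + 2 * δ), le_max_left _ _, ?_⟩
  intro V G W H φ hG hH h4 hφ x y p hp
  have hc : 0 ≤ c := (gromovProduct_nonneg hH _ _ _).trans hp
  obtain ⟨r, hr⟩ := hG.exists_walk_length_eq_dist x y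
  have hqg := hφ.isQuasiGeodesic hl hG r hr
  -- a point of the quasi-geodesic with about the same distance from `φ x` as `p`
  obtain ⟨i, hi, h1, h2⟩ : ∃ i ≤ r.length,
      (H.dist (φ x) (φ (r.getVert i)) : ℝ) ≤ H.dist (φ x) p + 2 * lam ∧
      (H.dist (φ x) p : ℝ) ≤ H.dist (φ x) (φ (r.getVert i)) + 2 * c := by
    by_cases h0 : ∃ i, i ≤ r.length ∧ (H.dist (φ x) p : ℝ) < H.dist (φ x) (φ (r.getVert i))
    · classical
      obtain ⟨h1, h2⟩ := Nat.find_spec h0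
      set n := Nat.find h0 with hn
      refine ⟨n, h1, ?_, by linarith⟩
      have hpos : n ≠ 0 := by
        intro h
        rw [h] at h2
        simp at h2
        have : (0 : ℝ) ≤ H.dist (φ x) p := by positivity
        linarith
      have h3 := Nat.find_min h0 (m := n - 1) (by omega)
      have h4 : (H.dist (φ x) (φ (r.getVert (n - 1))) : ℝ) ≤ H.dist (φ x) p := by
        by_contra! h
        exact h3 ⟨by omega, h⟩
      have h5 := (hqg (n - 1) n (by omega) h1).2
      rw [Nat.cast_sub (by omega)] at h5
      push_cast at h5
      have h6 := dist_tri hH (φ x) (φ (r.getVert (n - 1))) (φ (r.getVert n))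
      linarith
    · push Not at h0
      refine ⟨r.length, le_rfl, ?_, ?_⟩
      · have := h0 r.length le_rfl
        linarith
      · unfold gromovProduct at hp
        rw [SimpleGraph.Walk.getVert_length]
        rw [dist_symm_real p (φ x)] at hp
        have : (0 : ℝ) ≤ H.dist p (φ y) := by positivity
        linarith
  refine ⟨r.getVert i, le_max_of_le_right ?_⟩
  have h3 := hM W H hH h4 _ _ hqg i hi
  simp only [SimpleGraph.Walk.getVert_zero, SimpleGraph.Walk.getVert_length] at h3
  set z := φ (r.getVert i)
  unfold gromovProduct at h3 hp
  have s1 := dist_symm_real (G := H) z (φ x)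
  have s2 := dist_symm_real (G := H) p (φ x)
  have s3 := dist_symm_real (G := H) p (φ y)
  rcases h4 z (φ x) p (φ y) with h | h <;> linarith

end QI

/-! ### Cuts of trees and of tree-graded graphs -/

section Tree

variable {τ : Type*} {T : SimpleGraph τ}

/-- In a tree, the removal of an edge `[v, w]` separates the side of `v` from the side of `w`. -/
theorem exists_tree_cut (hT : T.IsTree) {v w : τ} (h : T.Adj v w) :
    ∃ H : Set τ, v ∈ H ∧ w ∉ H ∧ ∀ t ∈ H, ∀ t' ∉ H, T.Adj t t' → t = v ∧ t' = w := by
  have hb := SimpleGraph.isAcyclic_iff_forall_adj_isBridge.1 hT.isAcyclic h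
  rw [SimpleGraph.isBridge_iff] at hb
  have hw : ¬ (T.deleteEdges {s(v, w)}).Reachable v w := by
    exact hb
  refine ⟨{t | (T.deleteEdges {s(v, w)}).Reachable v t}, SimpleGraph.Reachable.refl _, hw, ?_⟩
  intro t ht t' ht' hadj
  by_cases he : s(t, t') = s(v, w)
  · rcases Sym2.eq_iff.1 he with h' | h'
    · exact h'
    · rw [h'.1] at ht
      exact absurd ht hw
  · refine absurd (SimpleGraph.Reachable.trans ht (SimpleGraph.Adj.reachable ?_)) ht'
    rw [SimpleGraph.deleteEdges_adj]
    exact ⟨hadj, by simpa using he⟩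

/-- Different vertices of a tree are separated by an edge. -/
theorem exists_tree_cut_of_ne (hT : T.IsTree) {t t' : τ} (h : t ≠ t') :
    ∃ v w, T.Adj v w ∧ ∃ H : Set τ, v ∈ H ∧ w ∉ H ∧
      (∀ t ∈ H, ∀ t' ∉ H, T.Adj t t' → t = v ∧ t' = w) ∧ t ∈ H ∧ t' ∉ H := by
  have hc := hT.connected
  obtain ⟨u, hu, w, -, huw, hd⟩ := exists_crossing hc {t} rfl (y := t') (by simpa using h.symm)
  obtain rfl : u = t := hu
  obtain ⟨H, h1, h2, h3⟩ := exists_tree_cut hT huw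
  refine ⟨u, w, huw, H, h1, h2, h3, h1, fun ht' => ?_⟩
  obtain ⟨a, ha, b, hb, hab, hd'⟩ := exists_crossing hc H ht' h2
  obtain ⟨rfl, rfl⟩ := h3 a ha b hb hab
  rw [SimpleGraph.dist_self] at hd hd'
  rw [SimpleGraph.dist_comm (u := t') (v := a), SimpleGraph.dist_comm (u := t') (v := b)] at hd'
  omega

/-- A connected set of vertices of a graph which meets both sides of a cut edge contains the ends
of this edge. -/
theorem mem_of_cut {V : Type*} {G : SimpleGraph V} {H S : Set V} {v w : V}
    (hcut : ∀ t ∈ H, ∀ t' ∉ H, G.Adj t t' → t = v ∧ t' = w) (hS : (G.induce S).Connected)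
    {s s' : V} (hs : s ∈ S) (hsH : s ∈ H) (hs' : s' ∈ S) (hsH' : s' ∉ H) : v ∈ S ∧ w ∈ S := by
  obtain ⟨a, ha, b, hb, hab, -⟩ := exists_crossing hS (Subtype.val ⁻¹' H)
    (x := ⟨s, hs⟩) (y := ⟨s', hs'⟩) hsH hsH'
  obtain ⟨h1, h2⟩ := hcut a.1 ha b.1 hb hab
  exact ⟨h1 ▸ a.2, h2 ▸ b.2⟩

theorem setDist_le (S : Set τ) (x : τ) {s : τ} (hs : s ∈ S) : setDist T S x ≤ T.dist s x :=
  Nat.sInf_le ⟨s, hs, rfl⟩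

theorem exists_setDist_eq (S : Set τ) (x : τ) (hS : S.Nonempty) :
    ∃ s ∈ S, T.dist s x = setDist T S x := by
  obtain ⟨s, hs, h⟩ := Nat.sInf_mem (hS.image (fun a => T.dist a x))
  exact ⟨s, hs, h⟩

/-- The ends of an edge of a tree which is not contained in the subtree `S` have different distances
from `S`. -/
theorem setDist_lt_or_lt (hT : T.IsTree) {S : Set τ} (hS : (T.induce S).Connected) {v w : τ}
    (hvw : T.Adj v w) (h : ¬ (v ∈ S ∧ w ∈ S)) :
    setDist T S v < setDist T S w ∨ setDist T S w < setDist T S v := by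
  have hc := hT.connected
  have hne : S.Nonempty := ⟨_, hS.nonempty.some.2⟩
  obtain ⟨H, h1, h2, h3⟩ := exists_tree_cut hT hvw
  by_cases hSH : S ⊆ H
  · left
    obtain ⟨s, hs, hd⟩ := exists_setDist_eq (T := T) S w hne
    obtain ⟨a, ha, b, hb, hab, hd'⟩ := exists_crossing hc H (hSH hs) h2
    obtain ⟨rfl, rfl⟩ := h3 a ha b hb hab
    have := setDist_le (T := T) S a hs
    omega
  · right
    obtain ⟨s', hs', hsH'⟩ := Set.not_subset.1 hSH
    have hSH2 : ∀ s ∈ S, s ∉ H := fun s hs hsH => h (mem_of_cut h3 hS hs hsH hs' hsH')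
    obtain ⟨s, hs, hd⟩ := exists_setDist_eq (T := T) S v hne
    obtain ⟨a, ha, b, hb, hab, hd'⟩ := exists_crossing hc H h1 (hSH2 s hs)
    obtain ⟨rfl, rfl⟩ := h3 a ha b hb hab
    have := setDist_le (T := T) S b hs
    rw [SimpleGraph.dist_comm (u := b), SimpleGraph.dist_comm (u := a) (v := s)] at hd'
    omega

/-- A component of the complement of a subtree is attached to the subtree by a single edge. -/
theorem gate_unique (hT : T.IsTree) {S : Set τ} (hS : (T.induce S).Connected) {v v' : τ}
    {w w' : (Sᶜ : Set τ)} (hv : v ∈ S) (hv' : v' ∈ S) (hwv : T.Adj w v) (hwv' : T.Adj w' v')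
    (h : (T.induce Sᶜ).Reachable w w') : w'.1 = w.1 ∧ v' = v := by
  obtain ⟨H, h1, h2, h3⟩ := exists_tree_cut hT hwv
  refine h3 w' ?_ v' ?_ hwv'
  · by_contra hw'
    obtain ⟨p⟩ := h
    obtain ⟨d, -, hd1, hd2⟩ := p.exists_boundary_dart (Subtype.val ⁻¹' H) h1 hw'
    exact d.snd.2 ((h3 _ hd1 _ hd2 d.adj).2 ▸ hv)
  · intro hvH
    exact w.2 (mem_of_cut h3 hS hv' hvH hv h2).1

/-- Every component of the complement of a subtree is attached to the subtree by an edge. -/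
theorem exists_gate (hT : T.IsTree) {S : Set τ} (hS : S.Nonempty) (t : (Sᶜ : Set τ)) :
    ∃ (w : (Sᶜ : Set τ)) (v : τ), v ∈ S ∧ T.Adj w v ∧ (T.induce Sᶜ).Reachable w t := by
  obtain ⟨s, hs⟩ := hS
  obtain ⟨a, ⟨ha, har⟩, b, hb, hab, -⟩ := exists_crossing hT.connected
    {x | ∃ h : x ∈ Sᶜ, (T.induce Sᶜ).Reachable ⟨x, h⟩ t} (x := t.1) (y := s)
    ⟨t.2, SimpleGraph.Reachable.refl _⟩ (fun ⟨h, _⟩ => h hs)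
  refine ⟨⟨a, ha⟩, b, ?_, hab, har⟩
  by_contra hbS
  refine hb ⟨hbS, SimpleGraph.Reachable.trans (SimpleGraph.Adj.reachable ?_) har⟩
  exact hab.symm

end Tree

section Base

variable {β τ : Type*} (𝔹 : TreeGradedGraph β τ)

/-- `H` is a union of pieces, containing `a` but not `b`, which is connected to its complement only
by the edge `[a, b]`. -/
structure IsBaseCut (a b : β) (H : Set β) : Prop where
  left_mem : a ∈ H
  right_notMem : b ∉ H
  saturated : ∀ z z', 𝔹.projT z = 𝔹.projT z' → z ∈ H → z' ∈ H
  eq_of_adj : ∀ z ∈ H, ∀ z' ∉ H, 𝔹.B.Adj z z' → z = a ∧ z' = b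

variable {𝔹}

theorem TreeGradedGraph.Connecting.symm {a b : β} (h : 𝔹.Connecting a b) : 𝔹.Connecting b a :=
  ⟨h.1.symm, h.2.symm⟩

theorem TreeGradedGraph.Connecting.adj {a b : β} (h : 𝔹.Connecting a b) :
    𝔹.T.Adj (𝔹.projT a) (𝔹.projT b) :=
  (𝔹.projT_lipschitz a b h.1).resolve_left h.2

theorem TreeGradedGraph.Connecting.eq_of_projT_eq {a b a' b' : β} (h : 𝔹.Connecting a b)
    (h' : 𝔹.Connecting a' b') (ha : 𝔹.projT a' = 𝔹.projT a) (hb : 𝔹.projT b' = 𝔹.projT b) :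
    a' = a ∧ b' = b := by
  have := (𝔹.edge_unique _ _ h.adj).unique (y₁ := (a', b')) (y₂ := (a, b)) ⟨h'.1, ha, hb⟩
    ⟨h.1, rfl, rfl⟩
  exact Prod.mk.inj this

theorem TreeGradedGraph.exists_connecting {v w : τ} (h : 𝔹.T.Adj v w) :
    ∃ a b, 𝔹.Connecting a b ∧ 𝔹.projT a = v ∧ 𝔹.projT b = w := by
  obtain ⟨⟨a, b⟩, ⟨h1, h2, h3⟩, -⟩ := 𝔹.edge_unique v w h
  simp only at h1 h2 h3
  exact ⟨a, b, ⟨h1, by rw [h2, h3]; exact h.ne⟩, h2, h3⟩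

theorem isBaseCut_preimage {a b : β} (h : 𝔹.Connecting a b) {H : Set τ} (ha : 𝔹.projT a ∈ H)
    (hb : 𝔹.projT b ∉ H)
    (hH : ∀ t ∈ H, ∀ t' ∉ H, 𝔹.T.Adj t t' → t = 𝔹.projT a ∧ t' = 𝔹.projT b) :
    IsBaseCut 𝔹 a b (𝔹.projT ⁻¹' H) := by
  refine ⟨ha, hb, fun z z' e hz => ?_, fun z hz z' hz' hadj => ?_⟩
  · rw [Set.mem_preimage] at hz ⊢
    exact e ▸ hz
  · have hne : 𝔹.projT z ≠ 𝔹.projT z' := fun e => hz' (e ▸ hz : 𝔹.projT z' ∈ H)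
    have hc : 𝔹.Connecting z z' := ⟨hadj, hne⟩
    obtain ⟨h1, h2⟩ := hH _ hz _ hz' hc.adj
    exact h.eq_of_projT_eq hc h1 h2

theorem TreeGradedGraph.Connecting.exists_cut {a b : β} (h : 𝔹.Connecting a b) :
    ∃ H, IsBaseCut 𝔹 a b H := by
  obtain ⟨H, h1, h2, h3⟩ := exists_tree_cut 𝔹.isTree h.adj
  exact ⟨_, isBaseCut_preimage h h1 h2 h3⟩

theorem exists_baseCut_of_ne {z z' : β} (h : 𝔹.projT z ≠ 𝔹.projT z') :
    ∃ a b, 𝔹.Connecting a b ∧ ∃ H, IsBaseCut 𝔹 a b H ∧ z ∈ H ∧ z' ∉ H := by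
  obtain ⟨v, w, hvw, H, h1, h2, h3, h4, h5⟩ := exists_tree_cut_of_ne 𝔹.isTree h
  obtain ⟨a, b, hab, rfl, rfl⟩ := 𝔹.exists_connecting hvw
  exact ⟨a, b, hab, _, isBaseCut_preimage hab h1 h2 h3, h4, h5⟩

/-- A shortest path in a connected subgraph `B'` between points of the same piece stays in this
piece. -/
theorem projT_eq_of_between {B' : Set β} (hB' : (𝔹.B.induce B').Connected) {c c' z : B'}
    (hcc' : 𝔹.projT c = 𝔹.projT c')
    (hz : (𝔹.B.induce B').dist c z + (𝔹.B.induce B').dist z c' = (𝔹.B.induce B').dist c c') :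
    𝔹.projT z = 𝔹.projT c := by
  by_contra hne
  obtain ⟨a, b, hab, H, hH, h1, h2⟩ := exists_baseCut_of_ne (Ne.symm hne)
  have h1' := hH.saturated _ _ hcc' h1
  -- the path would cross the edge `[a, b]` in both directions
  obtain ⟨u, hu, u', hu', huu', hd⟩ := exists_crossing hB' (Subtype.val ⁻¹' H) (x := c) (y := z)
    h1 h2
  obtain ⟨w, hw, w', hw', hww', hd'⟩ := exists_crossing hB' (Subtype.val ⁻¹' H) (x := c') (y := z)
    h1' h2
  have e1 := (hH.eq_of_adj _ hu _ hu' huu').1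
  have e2 := (hH.eq_of_adj _ hw _ hw' hww').1
  obtain rfl : u = w := Subtype.ext (e1.trans e2.symm)
  have t := hB'.dist_triangle (u := c) (v := u) (w := c')
  rw [SimpleGraph.dist_comm (u := u) (v := c')] at t
  rw [SimpleGraph.dist_comm (u := c') (v := z)] at hd'
  omega

end Base

/-! ### Projecting the base to a connected subgraph -/

section Exit

variable {β τ : Type*} {𝔹 : TreeGradedGraph β τ} {B' : Set β}

/-- `c` is a nearest point to `b` of `B'`, and `e` is the last vertex before `c` of a geodesic
from `b` to `c`. -/
structure IsExit (𝔹 : TreeGradedGraph β τ) (B' : Set β) (b c e : β) : Prop where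
  nearest : IsNearest 𝔹.B B' b c
  adj : 𝔹.B.Adj e c
  dist_eq : 𝔹.B.dist b e + 1 = 𝔹.B.dist b c

theorem exists_isExit (hB' : B'.Nonempty) {b : β} (hb : b ∉ B') : ∃ c e, IsExit 𝔹 B' b c e := by
  obtain ⟨c, hc⟩ := exists_isNearest (G := 𝔹.B) B' hB' b
  obtain ⟨e, -, c', hc', hadj, hd⟩ := exists_crossing 𝔹.connected_B {c}ᶜ (x := b) (y := c)
    (fun h => hb (h ▸ hc.1 : b ∈ B')) (by simp)
  obtain rfl : c' = c := by simpa using hc'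
  rw [SimpleGraph.dist_self] at hd
  exact ⟨c', e, hc, hadj, by omega⟩

variable {b b' c c' e e' : β}

theorem IsExit.notMem (h : IsExit 𝔹 B' b c e) : e ∉ B' := by
  intro he
  have := h.nearest.2 e he
  have := h.dist_eq
  omega

theorem IsExit.subset_compl (h : IsExit 𝔹 B' b c e) (hB' : (𝔹.B.induce B').Connected) {H : Set β}
    (hH : IsBaseCut 𝔹 e c H) : ∀ z ∈ B', z ∉ H := fun _ hz hzH =>
  h.notMem (mem_of_cut hH.eq_of_adj hB' hz hzH h.nearest.1 hH.right_notMem).1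

theorem IsExit.mem_cut (h : IsExit 𝔹 B' b c e) {H : Set β} (hH : IsBaseCut 𝔹 e c H) : b ∈ H := by
  by_contra hb
  obtain ⟨u, hu, u', hu', huu', hd⟩ := exists_crossing 𝔹.connected_B H hH.left_mem hb
  obtain ⟨rfl, rfl⟩ := hH.eq_of_adj u hu u' hu' huu'
  have := h.dist_eq
  rw [SimpleGraph.dist_comm (v := b), SimpleGraph.dist_comm (u := u) (v := b)] at hd
  simp only [SimpleGraph.dist_self] at hd
  omega

/-- All points behind a connecting edge through which `b` exits towards `B'` exit through the same
edge. -/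
theorem IsExit.eq_of_connecting (hB' : (𝔹.B.induce B').Connected) (h : IsExit 𝔹 B' b c e)
    (hec : 𝔹.Connecting e c) (h' : IsExit 𝔹 B' b' c' e') (hb' : b' ∉ B')
    (hbb' : b = b' ∨ 𝔹.B.Adj b b') : c' = c ∧ e' = e := by
  obtain ⟨H, hH⟩ := hec.exists_cut
  have hsub := h.subset_compl hB' hH
  have hbH := h.mem_cut hH
  have hb'H : b' ∈ H := by
    rcases hbb' with rfl | hadj
    · exact hbH
    · by_contra hn
      exact hb' ((hH.eq_of_adj b hbH b' hn hadj).2 ▸ h.nearest.1)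
  obtain rfl : c' = c := by
    obtain ⟨u, hu, u', hu', huu', hd⟩ := exists_crossing 𝔹.connected_B H hb'H
      (hsub c' h'.nearest.1)
    obtain ⟨rfl, rfl⟩ := hH.eq_of_adj u hu u' hu' huu'
    have h1 := h'.nearest.2 u' h.nearest.1
    have h2 : 𝔹.B.dist b' u' ≤ 𝔹.B.dist b' u + 𝔹.B.dist u u' := 𝔹.connected_B.dist_triangle
    rw [SimpleGraph.dist_eq_one_iff_adj.2 huu'] at h2
    exact (𝔹.connected_B.dist_eq_zero_iff.1 (by omega)).symm
  refine ⟨rfl, ?_⟩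
  have heH : e' ∈ H := by
    by_contra hn
    obtain ⟨u, hu, u', hu', huu', hd⟩ := exists_crossing 𝔹.connected_B H hb'H hn
    obtain ⟨rfl, rfl⟩ := hH.eq_of_adj u hu u' hu' huu'
    have h1 := h'.dist_eq
    have h2 : 𝔹.B.dist b' u' ≤ 𝔹.B.dist b' u + 𝔹.B.dist u u' := 𝔹.connected_B.dist_triangle
    rw [SimpleGraph.dist_eq_one_iff_adj.2 huu'] at h2
    omega
  exact (hH.eq_of_adj e' heH c' hH.right_notMem h'.adj).1

/-- If the only edge out of `H` starts in `B'`, then points whose nearest point lies outside `H`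
lie outside `H` themselves. -/
theorem IsNearest.notMem_of_cut (h : IsNearest 𝔹.B B' b c) {u u' : β} {H : Set β}
    (hcut : ∀ z ∈ H, ∀ z' ∉ H, 𝔹.B.Adj z z' → z = u ∧ z' = u') (hu : u ∈ B') (hcH : c ∉ H) :
    b ∉ H := by
  intro hb
  obtain ⟨w, hw, w', hw', hww', hd⟩ := exists_crossing 𝔹.connected_B H hb hcH
  obtain ⟨rfl, rfl⟩ := hcut w hw w' hw' hww'
  have := h.2 w hu
  omega

/-- Nearest points of adjacent vertices outside `B'` lie in the same piece. -/
theorem IsNearest.projT_eq (hB' : (𝔹.B.induce B').Connected) (h : IsNearest 𝔹.B B' b c)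
    (h' : IsNearest 𝔹.B B' b' c') (hb : b ∉ B') (hbb' : b = b' ∨ 𝔹.B.Adj b b') :
    𝔹.projT c = 𝔹.projT c' := by
  by_contra hne
  obtain ⟨u, u', huu', H, hH, hc, hc'⟩ := exists_baseCut_of_ne hne
  obtain ⟨hu, hu'⟩ := mem_of_cut hH.eq_of_adj hB' h.1 hc h'.1 hc'
  have hb'H : b' ∉ H := h'.notMem_of_cut hH.eq_of_adj hu hc'
  have hbH : b ∉ Hᶜ := h.notMem_of_cut (u := u') (u' := u)
    (fun z hz z' hz' hadj => (hH.eq_of_adj z' (not_not.1 hz') z hz hadj.symm).symm) hu'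
    (not_not.2 hc)
  rcases hbb' with rfl | hadj
  · exact hbH hb'H
  · exact hb ((hH.eq_of_adj b (not_not.1 hbH) b' hb'H hadj).1 ▸ hu)

/-- The exit edge of a vertex adjacent to `B'` starts at this vertex. -/
theorem IsExit.of_adj (hB' : (𝔹.B.induce B').Connected) (h : IsExit 𝔹 B' b' c e) (hb : b ∈ B')
    (hadj : 𝔹.B.Adj b b') :
    e = b' ∧ (𝔹.Connecting b' c → c = b) ∧
      (𝔹.projT b' = 𝔹.projT c → 𝔹.projT b = 𝔹.projT c) := by
  have h1 := h.nearest.2 b hb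
  have h2 := h.dist_eq
  rw [SimpleGraph.dist_eq_one_iff_adj.2 hadj.symm] at h1
  obtain rfl : b' = e := 𝔹.connected_B.dist_eq_zero_iff.1 (by omega)
  refine ⟨rfl, fun hc => ?_, fun hc => ?_⟩
  · obtain ⟨H, hH⟩ := hc.exists_cut
    exact (hH.eq_of_adj b' hH.left_mem b (h.subset_compl hB' hH b hb) hadj.symm).2.symm
  · by_contra hne
    have hbc : 𝔹.Connecting b' b := ⟨hadj.symm, fun h => hne (by rw [← h, hc])⟩
    obtain ⟨H, hH⟩ := hbc.exists_cut
    have hcH := hH.saturated _ _ hc hH.left_mem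
    exact h.notMem (mem_of_cut hH.eq_of_adj hB' h.nearest.1 hcH hb hH.right_notMem).1

theorem coarselyConvex_of_isQIEmb {V : Type*} {G : SimpleGraph V} {S : Set V} {c : ℝ}
    (hS : (G.induce S).Connected) (h : IsQIEmb 1 c (G.induce S) G Subtype.val)
    (hle : ∀ x y : S, G.dist x.1 y.1 ≤ (G.induce S).dist x y) : CoarselyConvex G c S := by
  intro p hp q hq n hn
  have h0 := (h ⟨p, hp⟩ ⟨q, hq⟩).1
  have h1 := hle ⟨p, hp⟩ ⟨q, hq⟩
  obtain ⟨u, hu1, hu2⟩ := exists_geodesic_point hS ⟨p, hp⟩ ⟨q, hq⟩ (hn.trans h1)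
  have a1 := hle ⟨p, hp⟩ u
  have a2 := hle u ⟨q, hq⟩
  have hu2' : ((G.induce S).dist u ⟨q, hq⟩ : ℝ) + n = (G.induce S).dist ⟨p, hp⟩ ⟨q, hq⟩ := by
    exact_mod_cast hu2
  have a1' : (G.dist p u : ℝ) ≤ n := by exact_mod_cast a1.trans hu1.le
  have a2' : (G.dist u q : ℝ) ≤ (G.induce S).dist u ⟨q, hq⟩ := by exact_mod_cast a2
  have hc : 0 ≤ c := by
    have := (h ⟨p, hp⟩ ⟨p, hp⟩).1
    simp at this
    exact this
  simp only at h0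
  exact ⟨u, u.2, by linarith, by linarith⟩

end Exit

/-! ### Fibers and edge spaces -/

theorem dist_val_le_dist_induce {V : Type*} {G : SimpleGraph V} {S : Set V}
    (hS : (G.induce S).Connected) (x y : S) : G.dist x.1 y.1 ≤ (G.induce S).dist x y :=
  dist_map_le hS (SimpleGraph.Embedding.induce S).toHom x y

/-- Points of two coarsely convex sets which correspond to each other coarsely under the
quasi-isometric embeddings `φ`, `φ'` of `E`, and which are close to the projections of the same
point `t₀` of `E`, are close to each other. -/
theorem exists_dist_le_of_nearest (δ lam κ c : ℝ) (hl : 1 ≤ lam) :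
    ∃ c' : ℝ, 0 ≤ c' ∧ ∀ (E : Type u₁) (G : SimpleGraph E) (V : Type u₂) (H : SimpleGraph V)
      (V' : Type u₃) (H' : SimpleGraph V') (φ : E → V) (φ' : E → V'),
      G.Connected → FourPoint G δ → H.Connected → FourPoint H δ → H'.Connected → FourPoint H' δ →
      IsQIEmb lam lam G H φ → IsQIEmb lam lam G H' φ' →
      ∀ (A : Set V) (A' : Set V'), CoarselyConvex H κ A → CoarselyConvex H' κ A' →
      ∀ (t₀ t₁ t₂ : E) (p a : V) (p' a' : V'), IsNearest H A (φ t₀) p → IsNearest H' A' (φ' t₀) p' →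
      a ∈ A → a' ∈ A' → (H.dist p (φ t₁) : ℝ) ≤ c → (H'.dist a' (φ' t₁) : ℝ) ≤ c →
      (H'.dist p' (φ' t₂) : ℝ) ≤ c → (H.dist a (φ t₂) : ℝ) ≤ c → (G.dist t₁ t₂ : ℝ) ≤ c' := by
  obtain ⟨c₁, hc₁, h₁⟩ := exists_gromovProduct_le_of_map.{u₁, u₂} δ lam (κ + 2 * δ + 1 + c + c) hl
  obtain ⟨c₂, hc₂, h₂⟩ := exists_gromovProduct_le_of_map.{u₁, u₃} δ lam (κ + 2 * δ + 1 + c + c) hl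
  refine ⟨c₁ + c₂, by linarith, ?_⟩
  intro E G V H V' H' φ φ' hG g4 hH h4 hH' h4' hφ hφ' A A' hA hA' t₀ t₁ t₂ p a p' a' hp hp' ha ha'
    d1 d2 d3 d4
  have k1 := h₁ E G V H φ hG g4 hH h4 hφ t₀ t₂ t₁ (by
    have := hp.gromovProduct_le hH h4 hA ha
    have := gromovProduct_le_of_near hH p (φ t₀) a (φ t₁) (φ t₀) (φ t₂)
    simp only [SimpleGraph.dist_self, Nat.cast_zero] at this
    linarith)
  have k2 := h₂ E G V' H' φ' hG g4 hH' h4' hφ' t₀ t₁ t₂ (by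
    have := hp'.gromovProduct_le hH' h4' hA' ha'
    have := gromovProduct_le_of_near hH' p' (φ' t₀) a' (φ' t₂) (φ' t₀) (φ' t₁)
    simp only [SimpleGraph.dist_self, Nat.cast_zero] at this
    linarith)
  have k3 := gromovProduct_add (G := G) t₁ t₂ t₀
  rw [gromovProduct_symm t₁, gromovProduct_symm t₂] at k3
  linarith

namespace GraphOfTreeGradedGraphs

section Fibers

variable {ξ : Type u₁} {β : Type u₂} {τ : Type u₃} {f : ℝ≥0 → ℝ≥0}
  (𝕏 : GraphOfTreeGradedGraphs.{u₁, u₂, u₃, u₄} ξ β τ f)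

/-- Distances in fibers are controlled by distances in `X`. -/
theorem fiber_dist_le {a : β} (x y : (𝕏.projB ⁻¹' {a} : Set ξ)) {r : ℝ}
    (h : (𝕏.X.dist x.1 y.1 : ℝ) ≤ r) : ((𝕏.fiber a).dist x y : ℝ) ≤ f r.toNNReal :=
  𝕏.fiber_proper a x y r.toNNReal (h.trans (Real.le_coe_toNNReal r))

theorem dist_le_fiber_dist {a : β} (x y : (𝕏.projB ⁻¹' {a} : Set ξ)) :
    (𝕏.X.dist x.1 y.1 : ℝ) ≤ (𝕏.fiber a).dist x y := by
  exact_mod_cast dist_val_le_dist_induce (𝕏.fiber_connected a) x y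

/-- A vertex of the fiber over `a`, as a vertex of the preimage of `[a, b]`. -/
def inLeft {a : β} (b : β) (x : (𝕏.projB ⁻¹' {a} : Set ξ)) : (𝕏.projB ⁻¹' {a, b} : Set ξ) :=
  ⟨x.1, Or.inl x.2⟩

/-- A vertex of the fiber over `b`, as a vertex of the preimage of `[a, b]`. -/
def inRight (a : β) {b : β} (x : (𝕏.projB ⁻¹' {b} : Set ξ)) : (𝕏.projB ⁻¹' {a, b} : Set ξ) :=
  ⟨x.1, Or.inr x.2⟩

variable {𝕏}

/-- The end point over `b` of the edge of `X` given by the vertex `t` of the edge graph. -/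
def incidenceRight {a b : β} (h : 𝕏.Connecting a b) (t : 𝕏.EV s(a, b)) :
    (𝕏.projB ⁻¹' {b} : Set ξ) :=
  𝕏.incidence h.symm s(a, b) Sym2.eq_swap t

/-- The end point over `a` of the edge of `X` given by the vertex `t` of the edge graph. -/
def incidenceLeft {a b : β} (h : 𝕏.Connecting a b) (t : 𝕏.EV s(a, b)) :
    (𝕏.projB ⁻¹' {a} : Set ξ) :=
  𝕏.incidence h s(a, b) rfl t

theorem incidence_adj {a b : β} (h : 𝕏.Connecting a b) (t : 𝕏.EV s(a, b)) :
    𝕏.X.Adj (incidenceLeft h t).1 (incidenceRight h t).1 :=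
  𝕏.att_adj a b h _ rfl t

theorem exists_incidence {a b : β} (h : 𝕏.Connecting a b) {x y : ξ} (hxy : 𝕏.X.Adj x y)
    (hx : 𝕏.projB x = a) (hy : 𝕏.projB y = b) :
    ∃ t, (incidenceLeft h t).1 = x ∧ (incidenceRight h t).1 = y :=
  𝕏.exists_att a b h x y hxy hx hy

theorem edgeSpace_connected {a b : β} (h : 𝕏.Connecting a b) : (𝕏.edgeSpace a b).Connected := by
  have hne := (𝕏.edge_connected a b h).nonempty
  obtain ⟨t⟩ := hne
  have hl : ∀ x : (𝕏.projB ⁻¹' {a} : Set ξ),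
      (𝕏.edgeSpace a b).Reachable (𝕏.inLeft b (incidenceLeft h t)) (𝕏.inLeft b x) := fun x =>
    ((𝕏.fiber_connected a).preconnected _ _).map
      (SimpleGraph.induceHomOfLE 𝕏.X
        (s := 𝕏.projB ⁻¹' {a}) (s' := 𝕏.projB ⁻¹' {a, b})
        (fun x hx => Or.inl hx)).toHom
  have hr : ∀ x : (𝕏.projB ⁻¹' {b} : Set ξ),
      (𝕏.edgeSpace a b).Reachable (𝕏.inRight a (incidenceRight h t)) (𝕏.inRight a x) := fun x =>
    ((𝕏.fiber_connected b).preconnected _ _).map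
      (SimpleGraph.induceHomOfLE 𝕏.X
        (s := 𝕏.projB ⁻¹' {b}) (s' := 𝕏.projB ⁻¹' {a, b})
        (fun x hx => Or.inr hx)).toHom
  have hadj : (𝕏.edgeSpace a b).Adj (𝕏.inLeft b (incidenceLeft h t))
      (𝕏.inRight a (incidenceRight h t)) := incidence_adj h t
  have hall : ∀ x, (𝕏.edgeSpace a b).Reachable (𝕏.inLeft b (incidenceLeft h t)) x := by
    rintro ⟨x, hx⟩
    rcases hx with hx | hx
    · exact hl ⟨x, hx⟩
    · exact hadj.reachable.trans (hr ⟨x, hx⟩)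
  exact { preconnected := fun x y => (hall x).symm.trans (hall y)
          nonempty := ⟨𝕏.inLeft b (incidenceLeft h t)⟩ }

theorem dist_le_edgeSpace_dist {a b : β} (h : 𝕏.Connecting a b)
    (x y : (𝕏.projB ⁻¹' {a, b} : Set ξ)) :
    (𝕏.X.dist x.1 y.1 : ℝ) ≤ (𝕏.edgeSpace a b).dist x y := by
  exact_mod_cast dist_val_le_dist_induce (edgeSpace_connected h) x y

theorem edgeSpace_dist_inLeft_le {a : β} (b : β) (x y : (𝕏.projB ⁻¹' {a} : Set ξ)) :
    (𝕏.edgeSpace a b).dist (𝕏.inLeft b x) (𝕏.inLeft b y) ≤ (𝕏.fiber a).dist x y :=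
  dist_map_le (𝕏.fiber_connected a)
    (SimpleGraph.induceHomOfLE 𝕏.X
      (s := 𝕏.projB ⁻¹' {a}) (s' := 𝕏.projB ⁻¹' {a, b})
      (fun _ hx => Or.inl hx)).toHom x y

/-- A geodesic of the preimage of `[a, b]` between the two fibers uses one of the edges over
`[a, b]`. -/
theorem exists_incidence_near {a b : β} (h : 𝕏.Connecting a b) (x y : (𝕏.projB ⁻¹' {a, b} : Set ξ))
    (hx : 𝕏.projB x.1 = a) (hy : 𝕏.projB y.1 = b) :
    ∃ t, (𝕏.X.dist x.1 (incidenceLeft h t).1 : ℝ) ≤ (𝕏.edgeSpace a b).dist x y ∧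
      (𝕏.X.dist y.1 (incidenceRight h t).1 : ℝ) ≤ (𝕏.edgeSpace a b).dist x y := by
  have hne : a ≠ b := h.1.ne
  obtain ⟨u, hu, u', hu', hadj, hd⟩ := exists_crossing (edgeSpace_connected h)
    {z | 𝕏.projB z.1 = a} (x := x) (y := y) hx (fun e => hne (e.symm.trans hy))
  have hub : 𝕏.projB u'.1 = b := u'.2.resolve_left hu'
  obtain ⟨t, ht1, ht2⟩ := exists_incidence h hadj hu hub
  refine ⟨t, ?_, ?_⟩
  · rw [ht1]
    refine (dist_le_edgeSpace_dist h x u).trans ?_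
    exact_mod_cast (by omega)
  · rw [ht2]
    refine (dist_le_edgeSpace_dist h y u').trans ?_
    rw [SimpleGraph.dist_comm (u := y)]
    exact_mod_cast (by omega)

/-- Passing to neighbours is a quasi-isometry between the fibers over adjacent vertices of a
piece. -/
theorem isQIEmb_of_adj {a b : β} (φ : (𝕏.projB ⁻¹' {a} : Set ξ) → (𝕏.projB ⁻¹' {b} : Set ξ))
    (ψ : (𝕏.projB ⁻¹' {b} : Set ξ) → (𝕏.projB ⁻¹' {a} : Set ξ))
    (hφ : ∀ x, 𝕏.X.Adj x.1 (φ x).1) (hψ : ∀ x, 𝕏.X.Adj x.1 (ψ x).1) {lam : ℝ}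
    (hl : lam = 1 + f (3 : ℝ).toNNReal + 2 * f (2 : ℝ).toNNReal) :
    IsQIEmb lam lam (𝕏.fiber a) (𝕏.fiber b) φ := by
  have f3 : (0 : ℝ) ≤ f (3 : ℝ).toNNReal := NNReal.coe_nonneg _
  have f2 : (0 : ℝ) ≤ f (2 : ℝ).toNNReal := NNReal.coe_nonneg _
  have hX := 𝕏.connected_X
  have h3 : ∀ x x' y y', 𝕏.X.Adj x x' → 𝕏.X.Adj x y → 𝕏.X.Adj x' y' →
      (𝕏.X.dist y y' : ℝ) ≤ 3 := by
    intro x x' y y' h1 h2 h3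
    have e1 := SimpleGraph.dist_eq_one_iff_adj.2 h1
    have e2 := SimpleGraph.dist_eq_one_iff_adj.2 h2.symm
    have e3 := SimpleGraph.dist_eq_one_iff_adj.2 h3
    have t1 : 𝕏.X.dist y y' ≤ 𝕏.X.dist y x + 𝕏.X.dist x y' := hX.dist_triangle
    have t2 : 𝕏.X.dist x y' ≤ 𝕏.X.dist x x' + 𝕏.X.dist x' y' := hX.dist_triangle
    exact_mod_cast (by omega : 𝕏.X.dist y y' ≤ 3)
  have u1 := dist_le_mul_of_adj (𝕏.fiber_connected a) (𝕏.fiber_connected b) φ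
    (f (3 : ℝ).toNNReal) (fun x y hxy => 𝕏.fiber_dist_le _ _ (h3 x.1 y.1 _ _ hxy (hφ x) (hφ y)))
  have u2 := dist_le_mul_of_adj (𝕏.fiber_connected b) (𝕏.fiber_connected a) ψ
    (f (3 : ℝ).toNNReal) (fun x y hxy => 𝕏.fiber_dist_le _ _ (h3 x.1 y.1 _ _ hxy (hψ x) (hψ y)))
  have u3 : ∀ x, ((𝕏.fiber a).dist x (ψ (φ x)) : ℝ) ≤ f (2 : ℝ).toNNReal := by
    intro x
    refine 𝕏.fiber_dist_le _ _ ?_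
    have t1 : 𝕏.X.dist x.1 (ψ (φ x)).1 ≤ 𝕏.X.dist x.1 (φ x).1 + 𝕏.X.dist (φ x).1 (ψ (φ x)).1 :=
      hX.dist_triangle
    rw [SimpleGraph.dist_eq_one_iff_adj.2 (hφ x), SimpleGraph.dist_eq_one_iff_adj.2 (hψ _)] at t1
    exact_mod_cast t1
  intro x y
  have d0 : (0 : ℝ) ≤ (𝕏.fiber a).dist x y := by positivity
  have d0' : (0 : ℝ) ≤ (𝕏.fiber b).dist (φ x) (φ y) := by positivity
  have hl1 : 1 ≤ lam := by linarith
  constructor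
  · have t1 := dist_tri (𝕏.fiber_connected a) x (ψ (φ x)) y
    have t2 := dist_tri (𝕏.fiber_connected a) (ψ (φ x)) (ψ (φ y)) y
    have v1 := u3 x
    have v2 := u3 y
    rw [dist_symm_real y] at v2
    have v3 := u2 (φ x) (φ y)
    rw [sub_le_iff_le_add, one_div, inv_mul_le_iff₀ (by linarith)]
    have w1 : f (3 : ℝ).toNNReal * ((𝕏.fiber b).dist (φ x) (φ y) : ℝ) ≤
        lam * (𝕏.fiber b).dist (φ x) (φ y) := mul_le_mul_of_nonneg_right (by linarith) d0'
    have w2 : lam * 1 ≤ lam * lam := mul_le_mul_of_nonneg_left hl1 (by linarith)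
    rw [mul_add]
    linarith
  · have v := u1 x y
    have w1 : f (3 : ℝ).toNNReal * ((𝕏.fiber a).dist x y : ℝ) ≤ lam * (𝕏.fiber a).dist x y :=
      mul_le_mul_of_nonneg_right (by linarith) d0
    linarith

/-! ### Projections inside the fibers -/

variable (𝕏) in
/-- `p` is a nearest point projection of `x` on `Y`, inside the fiber over `a`. -/
def IsFiberProj (Y : Set ξ) (a : β) (x p : ξ) : Prop :=
  ∃ (hx : 𝕏.projB x = a) (hp : 𝕏.projB p = a),
    IsNearest (𝕏.fiber a) (Subtype.val ⁻¹' Y) ⟨x, hx⟩ ⟨p, hp⟩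

theorem IsFiberProj.mem {Y : Set ξ} {a : β} {x p : ξ} (h : 𝕏.IsFiberProj Y a x p) : p ∈ Y :=
  h.2.2.1

theorem IsFiberProj.projB_eq {Y : Set ξ} {a : β} {x p : ξ} (h : 𝕏.IsFiberProj Y a x p) :
    𝕏.projB p = a := h.2.1

variable {δ₀ N L₀ k D K C ε : ℝ} {Y : Set ξ} {S : Set τ} {B' : Set β}

theorem AxiomH.fourPoint (H : 𝕏.AxiomH δ₀ N L₀ k D) (a : β) :
    FourPoint (𝕏.fiber a) (3 * δ₀ + 2) := (H.fiber_hyperbolic a).fourPoint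

theorem IsSemicontinuous.coarselyConvex (hY : 𝕏.IsSemicontinuous δ₀ K C ε Y S B') {a : β}
    (ha : 𝕏.projT a ∈ 𝕏.proj '' Y) :
    CoarselyConvex (𝕏.fiber a) (4 * δ₀) (Subtype.val ⁻¹' Y) :=
  (hY.quasiconvex a ha).coarselyConvex (𝕏.fiber_connected a)

theorem IsSemicontinuous.exists_mem (hY : 𝕏.IsSemicontinuous δ₀ K C ε Y S B') {a : β}
    (ha : 𝕏.projT a ∈ 𝕏.proj '' Y) : ∃ y ∈ Y, 𝕏.projB y = a := by
  have h : a ∈ 𝕏.projT ⁻¹' {𝕏.projT a} := rfl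
  rw [← (hY.bundle _ ha).1] at h
  obtain ⟨y, hy, e⟩ := h
  exact ⟨y, hy.1, e⟩

/-- Through each point of `Y` there is a coarsely Lipschitz section inside `Y` over its piece. -/
theorem IsSemicontinuous.exists_section (hY : 𝕏.IsSemicontinuous δ₀ K C ε Y S B') {p : ξ}
    (hp : p ∈ Y) :
    ∃ s : β → ξ, s (𝕏.projB p) = p ∧
      (∀ b, 𝕏.projT b = 𝕏.proj p → s b ∈ Y ∧ 𝕏.projB (s b) = b) ∧
      ∀ b b', 𝕏.projT b = 𝕏.proj p → 𝕏.projT b' = 𝕏.proj p →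
        (𝕏.X.dist (s b) (s b') : ℝ) ≤ K * (𝕏.B.dist b b' : ℝ) + K := by
  obtain ⟨s, hs, h1, h2⟩ := (hY.bundle (𝕏.proj p) ⟨p, hp, rfl⟩).2 p ⟨hp, rfl⟩
  exact ⟨s, h1, fun b hb => ⟨(h2 b hb).1, hs.isSection b hb⟩, fun b b' hb hb' =>
    (hs.isQIEmb b b' hb hb').2⟩

theorem IsSemicontinuous.exists_near (hY : 𝕏.IsSemicontinuous δ₀ K C ε Y S B') {p : ξ}
    (hp : p ∈ Y) {b : β} (hpb : 𝕏.B.Adj (𝕏.projB p) b) (hb : 𝕏.projT b = 𝕏.proj p) :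
    ∃ q ∈ Y, 𝕏.projB q = b ∧ (𝕏.X.dist p q : ℝ) ≤ 2 * K := by
  obtain ⟨s, h1, h2, h3⟩ := hY.exists_section hp
  refine ⟨s b, (h2 b hb).1, (h2 b hb).2, ?_⟩
  have := h3 (𝕏.projB p) b rfl hb
  rw [h1, SimpleGraph.dist_eq_one_iff_adj.2 hpb] at this
  push_cast at this
  linarith

theorem IsSemicontinuous.exists_isFiberProj (hY : 𝕏.IsSemicontinuous δ₀ K C ε Y S B') {x : ξ}
    (hx : 𝕏.proj x ∈ 𝕏.proj '' Y) : ∃ p, 𝕏.IsFiberProj Y (𝕏.projB x) x p := by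
  obtain ⟨y, hy, hyb⟩ := hY.exists_mem hx
  obtain ⟨⟨p, hp⟩, h⟩ := exists_isNearest (G := 𝕏.fiber (𝕏.projB x)) (Subtype.val ⁻¹' Y)
    ⟨⟨y, hyb⟩, hy⟩ ⟨x, rfl⟩
  exact ⟨p, rfl, hp, h⟩

/-! ### Projections of adjacent points -/

theorem IsFiberProj.dist_le (H : 𝕏.AxiomH δ₀ N L₀ k D) (hY : 𝕏.IsSemicontinuous δ₀ K C ε Y S B')
    {a : β} (ha : 𝕏.projT a ∈ 𝕏.proj '' Y) {x x' p p' : ξ} (hp : 𝕏.IsFiberProj Y a x p)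
    (hp' : 𝕏.IsFiberProj Y a x' p') {r : ℝ} (hr : (𝕏.X.dist x x' : ℝ) ≤ r) :
    (𝕏.X.dist p p' : ℝ) ≤ 2 * (4 * δ₀ + 2 * (3 * δ₀ + 2) + 1) + f r.toNNReal := by
  obtain ⟨hx, hpa, h⟩ := hp
  obtain ⟨hx', hpa', h'⟩ := hp'
  have h1 := h.dist_le (𝕏.fiber_connected a) (H.fourPoint a) (hY.coarselyConvex ha) h'
  have h2 := 𝕏.fiber_dist_le (a := a) ⟨x, hx⟩ ⟨x', hx'⟩ hr
  have h3 := 𝕏.dist_le_fiber_dist (a := a) ⟨p, hpa⟩ ⟨p', hpa'⟩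
  exact h3.trans (h1.trans (by linarith))

/-- Adjacent points over the same piece. -/
theorem exists_dist_fiberProj_le_of_piece (f : ℝ≥0 → ℝ≥0) (δ₀ K : ℝ) :
    ∃ c : ℝ, 0 ≤ c ∧ ∀ (ξ : Type u₁) (β : Type u₂) (τ : Type u₃)
      (𝕏 : GraphOfTreeGradedGraphs.{u₁, u₂, u₃, u₄} ξ β τ f) (N L₀ k D C ε : ℝ),
      𝕏.AxiomH δ₀ N L₀ k D →
      ∀ (Y : Set ξ) (S : Set τ) (B' : Set β), 𝕏.IsSemicontinuous δ₀ K C ε Y S B' →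
      ∀ a b x x' p p', 𝕏.B.Adj a b → 𝕏.projT a = 𝕏.projT b → 𝕏.projT a ∈ 𝕏.proj '' Y →
      𝕏.X.Adj x x' → 𝕏.IsFiberProj Y a x p → 𝕏.IsFiberProj Y b x' p' →
      (𝕏.X.dist p p' : ℝ) ≤ c := by
  set lam : ℝ := 1 + f (3 : ℝ).toNNReal + 2 * f (2 : ℝ).toNNReal with hlam
  have hl : 1 ≤ lam := by
    have : (0 : ℝ) ≤ f (3 : ℝ).toNNReal := NNReal.coe_nonneg _
    have : (0 : ℝ) ≤ f (2 : ℝ).toNNReal := NNReal.coe_nonneg _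
    linarith
  set r : ℝ := 2 * K + 1 with hr
  set c₀ : ℝ := (f r.toNNReal : ℝ) with hc₀
  have hc₀' : 0 ≤ c₀ := NNReal.coe_nonneg _
  obtain ⟨c, hc, hmain⟩ := exists_dist_le_of_nearest.{u₁, u₁, u₁} (3 * δ₀ + 2) lam (4 * δ₀) c₀ hl
  refine ⟨c₀ + 1 + c, by linarith, ?_⟩
  intro ξ β τ 𝕏 N L₀ k D C ε H Y S B' hY a b x x' p p' hab hT haY hxx' ⟨hx, hpa, hp⟩ ⟨hx', hpb, hp'⟩
  have hX := 𝕏.connected_X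
  have hbY : 𝕏.projT b ∈ 𝕏.proj '' Y := hT ▸ haY
  -- the neighbour map is chosen to send `x` to `x'`
  have hφ : ∀ z : (𝕏.projB ⁻¹' {a} : Set ξ), ∃ y : (𝕏.projB ⁻¹' {b} : Set ξ), 𝕏.X.Adj z.1 y.1 ∧
      (z.1 = x → y.1 = x') := by
    intro z
    by_cases hz : z.1 = x
    · exact ⟨⟨x', hx'⟩, hz ▸ hxx', fun _ => rfl⟩
    · obtain ⟨y, hy, hzy⟩ := 𝕏.exists_adj a b hab hT z.1 z.2
      exact ⟨⟨y, hy⟩, hzy, fun h => absurd h hz⟩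
  have hψ : ∀ z : (𝕏.projB ⁻¹' {b} : Set ξ), ∃ y : (𝕏.projB ⁻¹' {a} : Set ξ), 𝕏.X.Adj z.1 y.1 := by
    intro z
    obtain ⟨y, hy, hzy⟩ := 𝕏.exists_adj b a hab.symm hT.symm z.1 z.2
    exact ⟨⟨y, hy⟩, hzy⟩
  choose φ hφ1 hφ2 using hφ
  choose ψ hψ1 using hψ
  have hqi := isQIEmb_of_adj φ ψ hφ1 hψ1 hlam
  have hid : IsQIEmb lam lam (𝕏.fiber a) (𝕏.fiber a) id := by
    intro y z
    have d0 : (0 : ℝ) ≤ (𝕏.fiber a).dist y z := by positivity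
    have h1 : 1 / lam ≤ 1 := by rw [div_le_one (by linarith)]; exact hl
    have h2 := mul_le_mul_of_nonneg_right h1 d0
    have h3 := mul_le_mul_of_nonneg_right hl d0
    simp only [id]
    constructor <;> linarith
  obtain ⟨q, hqY, hqb, hpq⟩ := hY.exists_near hp.1 (b := b) (by rw [hpa]; exact hab)
    (by unfold proj; rw [hpa, hT])
  obtain ⟨q', hqY', hqa', hpq'⟩ := hY.exists_near hp'.1 (b := a) (by rw [hpb]; exact hab.symm)
    (by unfold proj; rw [hpb, hT])
  have e0 : ∀ u v, 𝕏.X.Adj u v → (𝕏.X.dist u v : ℝ) ≤ 1 := fun u v huv => by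
    rw [SimpleGraph.dist_eq_one_iff_adj.2 huv]; simp
  have hφx : φ ⟨x, hx⟩ = ⟨x', hx'⟩ := Subtype.ext (hφ2 _ rfl)
  -- `t₁ = p`, and `t₂` is a point of the slice over `a` close to `p'`
  have key := hmain _ (𝕏.fiber a) _ (𝕏.fiber a) _ (𝕏.fiber b) id φ (𝕏.fiber_connected a)
    (H.fourPoint a) (𝕏.fiber_connected a) (H.fourPoint a) (𝕏.fiber_connected b) (H.fourPoint b)
    hid hqi _ _ (hY.coarselyConvex haY) (hY.coarselyConvex hbY) ⟨x, hx⟩ ⟨p, hpa⟩ ⟨q', hqa'⟩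
    ⟨p, hpa⟩ ⟨q', hqa'⟩ ⟨p', hpb⟩ ⟨q, hqb⟩ hp (hφx ▸ hp') hqY' hqY
    (by simpa using hc₀') (by
      refine 𝕏.fiber_dist_le _ _ ?_
      have := dist_tri hX q p (φ ⟨p, hpa⟩).1
      have := e0 _ _ (hφ1 ⟨p, hpa⟩)
      rw [dist_symm_real q p] at *
      simp only at *
      linarith) (by
      refine 𝕏.fiber_dist_le _ _ ?_
      have := dist_tri hX p' q' (φ ⟨q', hqa'⟩).1
      have := e0 _ _ (hφ1 ⟨q', hqa'⟩)
      simp only at *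
      linarith) (by simpa using hc₀')
  have h1 := 𝕏.dist_le_fiber_dist (a := a) ⟨p, hpa⟩ ⟨q', hqa'⟩
  have h2 : ((𝕏.fiber b).dist (φ ⟨q', hqa'⟩) ⟨p', hpb⟩ : ℝ) ≤ c₀ := by
    refine 𝕏.fiber_dist_le _ _ ?_
    have := dist_tri hX (φ ⟨q', hqa'⟩).1 q' p'
    have := e0 _ _ (hφ1 ⟨q', hqa'⟩).symm
    rw [dist_symm_real p' q'] at hpq'
    simp only at *
    linarith
  have h3 := 𝕏.dist_le_fiber_dist (φ ⟨q', hqa'⟩) ⟨p', hpb⟩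
  have h4 := e0 _ _ (hφ1 ⟨q', hqa'⟩)
  have h5 := dist_tri hX p q' p'
  have h6 := dist_tri hX q' (φ ⟨q', hqa'⟩).1 p'
  simp only at *
  linarith

end Fibers

/-! ### Projections across connecting edges -/

section

variable {ξ : Type u₁} {β : Type u₂} {τ : Type u₃} {f : ℝ≥0 → ℝ≥0}
  {𝕏 : GraphOfTreeGradedGraphs.{u₁, u₂, u₃, u₄} ξ β τ f}
  {δ₀ N L₀ k D K C ε : ℝ} {Y : Set ξ} {S : Set τ} {B' : Set β}

variable (𝕏) in
/-- Across the edge `[a, b]`, the slice of `Y` over `b` is coarsely contained in the slice over `a`,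
and either this holds the other way round as well, or the slice over `b` is coarsely the projection
of the slice over `a`. -/
def IsOutward (K ε : ℝ) (Y : Set ξ) (a b : β) : Prop :=
  𝕏.sliceIn a b Y b ⊆ nbhd (𝕏.edgeSpace a b) K (𝕏.sliceIn a b Y a) ∧
    (𝕏.sliceIn a b Y a ⊆ nbhd (𝕏.edgeSpace a b) K (𝕏.sliceIn a b Y b) ∨
      ∃ P : (𝕏.projB ⁻¹' {a, b} : Set ξ) → (𝕏.projB ⁻¹' {a, b} : Set ξ),
        (∀ x, IsNearest (𝕏.edgeSpace a b) (𝕏.sliceIn a b Set.univ b) x (P x)) ∧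
        P '' 𝕏.sliceIn a b Y a ⊆ nbhd (𝕏.edgeSpace a b) ε (𝕏.sliceIn a b Y b))

theorem IsSemicontinuous.isOutward_or (hY : 𝕏.IsSemicontinuous δ₀ K C ε Y S B') {a b : β}
    (h : 𝕏.Connecting a b) (ha : 𝕏.projT a ∈ 𝕏.proj '' Y) (hb : 𝕏.projT b ∈ 𝕏.proj '' Y) :
    𝕏.IsOutward K ε Y a b ∨ 𝕏.IsOutward K ε Y b a := by
  by_cases hS : 𝕏.projT a ∈ S ∧ 𝕏.projT b ∈ S
  · left
    have := hY.edge_central a b h hS.1 hS.2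
    exact ⟨this.2, Or.inl this.1⟩
  · have hmem : ∀ v w, setDist 𝕏.T S v < setDist 𝕏.T S w → w ∉ S := by
      intro v w hlt hw
      have := setDist_le (T := 𝕏.T) S w hw
      rw [SimpleGraph.dist_self] at this
      omega
    rcases setDist_lt_or_lt 𝕏.isTree hY.central_connected h.adj hS with hlt | hlt
    · left
      obtain ⟨⟨P, h1, h2⟩, h3⟩ := hY.edge_outward a b h ha hb (hmem _ _ hlt) hlt
      exact ⟨h3, Or.inr ⟨P, h1, h2.1⟩⟩
    · right
      obtain ⟨⟨P, h1, h2⟩, h3⟩ := hY.edge_outward b a h.symm hb ha (hmem _ _ hlt) hlt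
      exact ⟨h3, Or.inr ⟨P, h1, h2.1⟩⟩

/-- A point of the slice over `b` is close to the slice over `a`, by way of the edge graph. -/
theorem exists_near_of_subset_nbhd {a b : β} (h : 𝕏.Connecting a b) {r : ℝ} {q : ξ} (hq : q ∈ Y)
    (hqb : 𝕏.projB q = b)
    (hsub : 𝕏.sliceIn a b Y b ⊆ nbhd (𝕏.edgeSpace a b) r (𝕏.sliceIn a b Y a)) :
    ∃ y ∈ Y, 𝕏.projB y = a ∧ (𝕏.X.dist q y : ℝ) ≤ r ∧ ∃ t,
      (𝕏.X.dist y (incidenceLeft h t).1 : ℝ) ≤ r ∧ (𝕏.X.dist q (incidenceRight h t).1 : ℝ) ≤ r := by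
  obtain ⟨y, ⟨hy, hya⟩, hd⟩ := @hsub ⟨q, Or.inr hqb⟩ ⟨hq, hqb⟩
  have h0 := dist_le_edgeSpace_dist h ⟨q, Or.inr hqb⟩ y
  obtain ⟨t, h1, h2⟩ := exists_incidence_near h y ⟨q, Or.inr hqb⟩ hya hqb
  rw [dist_symm_real y] at h1 h2
  exact ⟨y.1, hy, hya, h0.trans hd, t, h1.trans hd, h2.trans hd⟩

end

/-- The projection to `Y` of an end point of an edge over `[a, b]` is close to the image of the edge
graph, provided some point of `Y` over `a` is. -/
theorem exists_fiberProj_near_incidence (f : ℝ≥0 → ℝ≥0) (δ₀ L₀ c₀ : ℝ) (hL₀ : 1 ≤ L₀) :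
    ∃ c : ℝ, 0 ≤ c ∧ ∀ (ξ : Type u₁) (β : Type u₂) (τ : Type u₃)
      (𝕏 : GraphOfTreeGradedGraphs.{u₁, u₂, u₃, u₄} ξ β τ f) (N k D K C ε : ℝ),
      𝕏.AxiomH δ₀ N L₀ k D →
      ∀ (Y : Set ξ) (S : Set τ) (B' : Set β), 𝕏.IsSemicontinuous δ₀ K C ε Y S B' →
      ∀ a b (h : 𝕏.Connecting a b), 𝕏.projT a ∈ 𝕏.proj '' Y →
      ∀ (t₀ t : 𝕏.EV s(a, b)) (p y : (𝕏.projB ⁻¹' {a} : Set ξ)), y.1 ∈ Y →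
      ((𝕏.fiber a).dist y (incidenceLeft h t) : ℝ) ≤ c₀ →
      IsNearest (𝕏.fiber a) (Subtype.val ⁻¹' Y) (incidenceLeft h t₀) p →
      ∃ t₁, ((𝕏.fiber a).dist (incidenceLeft h t₁) p : ℝ) ≤ c := by
  obtain ⟨c, hc, hmain⟩ := exists_dist_map_le.{u₄, u₁} (3 * δ₀ + 2) L₀
    (4 * δ₀ + 2 * (3 * δ₀ + 2) + 1 + c₀) hL₀
  refine ⟨c, hc, ?_⟩
  intro ξ β τ 𝕏 N k D K C ε H Y S B' hY a b h haY t₀ t p y hy hyt hp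
  refine hmain _ (𝕏.E s(a, b)) _ (𝕏.fiber a) (incidenceLeft h) (𝕏.edge_connected a b h)
    (𝕏.fiber_connected a) (H.fourPoint a) (H.incidence_qi a b h _ rfl) t₀ t p ?_
  have h1 := hp.gromovProduct_le (𝕏.fiber_connected a) (H.fourPoint a) (hY.coarselyConvex haY) hy
  have h2 := gromovProduct_le_of_near (𝕏.fiber_connected a) p (incidenceLeft h t₀) y p
    (incidenceLeft h t₀) (incidenceLeft h t)
  simp only [SimpleGraph.dist_self, Nat.cast_zero] at h2
  linarith

/-- Adjacent points over an edge of the tree of `Y`. -/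
theorem exists_dist_fiberProj_le_of_isOutward (f : ℝ≥0 → ℝ≥0) (δ₀ L₀ K ε : ℝ) (hL₀ : 1 ≤ L₀) :
    ∃ c : ℝ, 0 ≤ c ∧ ∀ (ξ : Type u₁) (β : Type u₂) (τ : Type u₃)
      (𝕏 : GraphOfTreeGradedGraphs.{u₁, u₂, u₃, u₄} ξ β τ f) (N k D C : ℝ),
      𝕏.AxiomH δ₀ N L₀ k D →
      ∀ (Y : Set ξ) (S : Set τ) (B' : Set β), 𝕏.IsSemicontinuous δ₀ K C ε Y S B' →
      ∀ a b x x' p p', 𝕏.Connecting a b → 𝕏.IsOutward K ε Y a b → 𝕏.projT a ∈ 𝕏.proj '' Y →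
      𝕏.projT b ∈ 𝕏.proj '' Y →
      𝕏.X.Adj x x' → 𝕏.IsFiberProj Y a x p → 𝕏.IsFiberProj Y b x' p' →
      (𝕏.X.dist p p' : ℝ) ≤ c := by
  set c₀ : ℝ := (f K.toNNReal : ℝ) with hc₀
  have hc₀' : 0 ≤ c₀ := NNReal.coe_nonneg _
  obtain ⟨c₁, hc₁, hnear⟩ := exists_fiberProj_near_incidence.{u₁, u₂, u₃, u₄} f δ₀ L₀ c₀ hL₀
  obtain ⟨r, hr1, hr2⟩ : ∃ r : ℝ, K ≤ r ∧ c₁ + 1 + ε ≤ r :=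
    ⟨max K (c₁ + 1 + ε), le_max_left _ _, le_max_right _ _⟩
  set c₂ : ℝ := (f r.toNNReal : ℝ) with hc₂
  have hc₂' : 0 ≤ c₂ := NNReal.coe_nonneg _
  obtain ⟨c, hc, hmain⟩ := exists_dist_le_of_nearest.{u₄, u₁, u₁} (3 * δ₀ + 2) L₀ (4 * δ₀)
    (max c₀ c₂) hL₀
  refine ⟨max 0 (r + 1 + (L₀ * c + L₀) + K), le_max_left _ _, ?_⟩
  intro ξ β τ 𝕏 N k D C H Y S B' hY a b x x' p p' hab hout haY hbY hxx' ⟨hx, hpa, hp⟩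
    ⟨hx', hpb, hp'⟩
  refine le_max_of_le_right ?_
  have hX := 𝕏.connected_X
  obtain ⟨t₀, ht₀, ht₀'⟩ := exists_incidence hab hxx' hx hx'
  have hl : incidenceLeft hab t₀ = ⟨x, hx⟩ := Subtype.ext ht₀
  have hri : incidenceRight hab t₀ = ⟨x', hx'⟩ := Subtype.ext ht₀'
  rw [← hl] at hp
  rw [← hri] at hp'
  -- `p'` is close to the slice over `a`
  obtain ⟨y, hy, hya, -, t₂, ht₂, ht₂'⟩ := exists_near_of_subset_nbhd hab hp'.1 hpb hout.1
  -- `p` is close to the slice over `b`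
  have hpd : ∃ q : (𝕏.projB ⁻¹' {a, b} : Set ξ), q.1 ∈ Y ∧ 𝕏.projB q.1 = b ∧
      ((𝕏.edgeSpace a b).dist (𝕏.inLeft b (⟨p, hpa⟩ : (𝕏.projB ⁻¹' {a} : Set ξ))) q : ℝ) ≤ r := by
    rcases hout.2 with hsub | ⟨P, hP, hsub⟩
    · obtain ⟨q, ⟨hq, hqb⟩, hd⟩ := @hsub (𝕏.inLeft b (⟨p, hpa⟩ : (𝕏.projB ⁻¹' {a} : Set ξ)))
        ⟨hp.1, hpa⟩
      exact ⟨q, hq, hqb, hd.trans hr1⟩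
    · obtain ⟨t₃, ht₃⟩ := hnear ξ β τ 𝕏 N k D K C ε H Y S B' hY a b hab haY t₀ t₂ ⟨p, hpa⟩ ⟨y, hya⟩
        hy (𝕏.fiber_dist_le _ _ ht₂) hp
      set p₀ := 𝕏.inLeft b (⟨p, hpa⟩ : (𝕏.projB ⁻¹' {a} : Set ξ)) with hp₀
      obtain ⟨q, ⟨hq, hqb⟩, hd⟩ := @hsub (P p₀) ⟨p₀, ⟨hp.1, hpa⟩, rfl⟩
      refine ⟨q, hq, hqb, le_trans ?_ hr2⟩
      have hE := edgeSpace_connected hab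
      have h1 := (hP p₀).2 (𝕏.inRight a (incidenceRight hab t₃))
        ⟨Set.mem_univ _, (incidenceRight hab t₃).2⟩
      have h1' : ((𝕏.edgeSpace a b).dist p₀ (P p₀) : ℝ) ≤
          (𝕏.edgeSpace a b).dist p₀ (𝕏.inRight a (incidenceRight hab t₃)) := by exact_mod_cast h1
      have h2 := dist_tri hE p₀ (𝕏.inLeft b (incidenceLeft hab t₃))
        (𝕏.inRight a (incidenceRight hab t₃))
      have h3 : (𝕏.edgeSpace a b).Adj (𝕏.inLeft b (incidenceLeft hab t₃))
        (𝕏.inRight a (incidenceRight hab t₃)) := incidence_adj hab t₃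
      rw [SimpleGraph.dist_eq_one_iff_adj.2 h3] at h2
      have h4 : ((𝕏.edgeSpace a b).dist p₀ (𝕏.inLeft b (incidenceLeft hab t₃)) : ℝ) ≤
          (𝕏.fiber a).dist ⟨p, hpa⟩ (incidenceLeft hab t₃) := by
        exact_mod_cast edgeSpace_dist_inLeft_le b _ _
      rw [dist_symm_real (G := 𝕏.fiber a)] at h4
      have h5 := dist_tri hE p₀ (P p₀) q
      push_cast at h2
      linarith
  obtain ⟨q, hq, hqb, hpq⟩ := hpd
  obtain ⟨t₁, ht₁, ht₁'⟩ := exists_incidence_near hab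
    (𝕏.inLeft b (⟨p, hpa⟩ : (𝕏.projB ⁻¹' {a} : Set ξ))) q hpa hqb
  have hqi : IsQIEmb L₀ L₀ (𝕏.E s(a, b)) (𝕏.fiber a) (incidenceLeft hab) :=
    H.incidence_qi a b hab _ rfl
  have hqi' : IsQIEmb L₀ L₀ (𝕏.E s(a, b)) (𝕏.fiber b) (incidenceRight hab) :=
    H.incidence_qi b a hab.symm _ Sym2.eq_swap
  have k1 : ((𝕏.fiber a).dist ⟨p, hpa⟩ (incidenceLeft hab t₁) : ℝ) ≤ max c₀ c₂ :=
    le_trans (𝕏.fiber_dist_le _ _ (ht₁.trans hpq)) (le_max_right _ _)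
  have k2 : ((𝕏.fiber b).dist ⟨q.1, hqb⟩ (incidenceRight hab t₁) : ℝ) ≤ max c₀ c₂ :=
    le_trans (𝕏.fiber_dist_le _ _ (ht₁'.trans hpq)) (le_max_right _ _)
  have k3 : ((𝕏.fiber b).dist ⟨p', hpb⟩ (incidenceRight hab t₂) : ℝ) ≤ max c₀ c₂ :=
    le_trans (𝕏.fiber_dist_le _ _ ht₂') (le_max_left _ _)
  have k4 : ((𝕏.fiber a).dist ⟨y, hya⟩ (incidenceLeft hab t₂) : ℝ) ≤ max c₀ c₂ :=
    le_trans (𝕏.fiber_dist_le _ _ ht₂) (le_max_left _ _)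
  have key := hmain _ (𝕏.E s(a, b)) _ (𝕏.fiber a) _ (𝕏.fiber b) (incidenceLeft hab)
    (incidenceRight hab) (𝕏.edge_connected a b hab) (H.edge_hyperbolic a b hab).fourPoint
    (𝕏.fiber_connected a) (H.fourPoint a) (𝕏.fiber_connected b) (H.fourPoint b) hqi hqi'
    _ _ (hY.coarselyConvex haY) (hY.coarselyConvex hbY) t₀ t₁ t₂ ⟨p, hpa⟩ ⟨y, hya⟩ ⟨p', hpb⟩
    ⟨q.1, hqb⟩ hp hp' hy hq k1 k2 k3 k4
  have h1 := hqi.dist_le t₁ t₂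
  have h2 := mul_le_mul_of_nonneg_left key (by linarith : 0 ≤ L₀)
  have h3 := 𝕏.dist_le_fiber_dist (incidenceLeft hab t₁) (incidenceLeft hab t₂)
  have h4 := dist_tri hX p (incidenceLeft hab t₁).1 p'
  have h5 := dist_tri hX (incidenceLeft hab t₁).1 (incidenceLeft hab t₂).1 p'
  have h6 := dist_tri hX (incidenceLeft hab t₂).1 (incidenceRight hab t₂).1 p'
  rw [SimpleGraph.dist_eq_one_iff_adj.2 (incidence_adj hab t₂)] at h6
  rw [dist_symm_real p'] at ht₂'
  have h7 : (𝕏.X.dist p (incidenceLeft hab t₁).1 : ℝ) ≤ r := ht₁.trans hpq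
  push_cast at h6
  linarith

/-- Over an edge at which the tree of `Y` ends, the end points of the edges of `X` have projections
close to each other. -/
theorem exists_dist_fiberProj_le_of_exit (f : ℝ≥0 → ℝ≥0) (δ₀ L₀ C : ℝ) (hL₀ : 1 ≤ L₀) (hC : 0 ≤ C) :
    ∃ c : ℝ, 0 ≤ c ∧ ∀ (ξ : Type u₁) (β : Type u₂) (τ : Type u₃)
      (𝕏 : GraphOfTreeGradedGraphs.{u₁, u₂, u₃, u₄} ξ β τ f) (N k D K ε : ℝ),
      𝕏.AxiomH δ₀ N L₀ k D →
      ∀ (Y : Set ξ) (S : Set τ) (B' : Set β), 𝕏.IsSemicontinuous δ₀ K C ε Y S B' →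
      ∀ a b x x' y y' p p', 𝕏.Connecting a b → 𝕏.projT a ∈ 𝕏.proj '' Y →
      𝕏.projT b ∉ 𝕏.proj '' Y → 𝕏.X.Adj x y → 𝕏.X.Adj x' y' →
      𝕏.projB y = b → 𝕏.projB y' = b → 𝕏.IsFiberProj Y a x p → 𝕏.IsFiberProj Y a x' p' →
      (𝕏.X.dist p p' : ℝ) ≤ c := by
  set κ : ℝ := 4 * δ₀ + 3 * (3 * δ₀ + 2) + 1 with hκ
  obtain ⟨c, hc, hmain⟩ := exists_dist_map_le.{u₄, u₁} (3 * δ₀ + 2) L₀ κ hL₀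
  refine ⟨max (2 * (4 * δ₀ + 2 * (3 * δ₀ + 2) + 1) + (3 * δ₀ + 2)) (2 * c + 2 + C),
    le_max_of_le_right (by linarith), ?_⟩
  intro ξ β τ 𝕏 N k D K ε H Y S B' hY a b x x' y y' p p' hab haY hbY hxy hxy' hy hy'
    ⟨hx, hpa, hp⟩ ⟨hx', hpa', hp'⟩
  have hF := 𝕏.fiber_connected a
  have h4 := H.fourPoint a
  have hcc := hY.coarselyConvex haY
  have hle := 𝕏.dist_le_fiber_dist (a := a) ⟨p, hpa⟩ ⟨p', hpa'⟩
  rcases le_or_gt ((𝕏.fiber a).dist ⟨p, hpa⟩ ⟨p', hpa'⟩ : ℝ)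
    (2 * (4 * δ₀ + 2 * (3 * δ₀ + 2) + 1) + (3 * δ₀ + 2)) with hs | hs
  · exact le_max_of_le_left (hle.trans hs)
  refine le_max_of_le_right ?_
  have g1 := hp.gromovProduct_le_of_far hF h4 hcc hp' hs
  have g2 := hp'.gromovProduct_le_of_far hF h4 hcc hp (by rw [dist_symm_real]; exact hs)
  rw [gromovProduct_symm] at g2
  obtain ⟨t, ht, -⟩ := exists_incidence hab hxy hx hy
  obtain ⟨t', ht', -⟩ := exists_incidence hab hxy' hx' hy'
  have e : incidenceLeft hab t = ⟨x, hx⟩ := Subtype.ext ht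
  have e' : incidenceLeft hab t' = ⟨x', hx'⟩ := Subtype.ext ht'
  -- both projections are close to the image of the edge graph, hence to the fiber over `b`
  have hnear : ∀ q : (𝕏.projB ⁻¹' {a} : Set ξ), q.1 ∈ Y →
      gromovProduct (𝕏.fiber a) q ⟨x, hx⟩ ⟨x', hx'⟩ ≤ κ →
      ∃ z ∈ projSet (𝕏.edgeSpace a b) (𝕏.sliceIn a b Set.univ b) (𝕏.sliceIn a b Y a),
        ((𝕏.edgeSpace a b).dist (𝕏.inLeft b q) z : ℝ) ≤ c + 1 := by
    intro q hq hg
    obtain ⟨t₁, ht₁⟩ := hmain _ (𝕏.E s(a, b)) _ (𝕏.fiber a) (incidenceLeft hab)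
      (𝕏.edge_connected a b hab) hF h4 (H.incidence_qi a b hab _ rfl) t t' q
      (by rw [e, e']; exact hg)
    obtain ⟨z, hz⟩ := exists_isNearest (G := 𝕏.edgeSpace a b) (𝕏.sliceIn a b Set.univ b)
      ⟨𝕏.inRight a (incidenceRight hab t), Set.mem_univ _, (incidenceRight hab t).2⟩ (𝕏.inLeft b q)
    refine ⟨z, ⟨𝕏.inLeft b q, ⟨hq, q.2⟩, hz⟩, ?_⟩
    have hE := edgeSpace_connected hab
    have h1 : ((𝕏.edgeSpace a b).dist (𝕏.inLeft b q) z : ℝ) ≤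
        (𝕏.edgeSpace a b).dist (𝕏.inLeft b q) (𝕏.inRight a (incidenceRight hab t₁)) := by
      exact_mod_cast hz.2 (𝕏.inRight a (incidenceRight hab t₁))
        ⟨Set.mem_univ _, (incidenceRight hab t₁).2⟩
    have h2 := dist_tri hE (𝕏.inLeft b q) (𝕏.inLeft b (incidenceLeft hab t₁))
      (𝕏.inRight a (incidenceRight hab t₁))
    have h3 : (𝕏.edgeSpace a b).Adj (𝕏.inLeft b (incidenceLeft hab t₁))
      (𝕏.inRight a (incidenceRight hab t₁)) := incidence_adj hab t₁
    rw [SimpleGraph.dist_eq_one_iff_adj.2 h3] at h2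
    have h5 : ((𝕏.edgeSpace a b).dist (𝕏.inLeft b q) (𝕏.inLeft b (incidenceLeft hab t₁)) : ℝ) ≤
        (𝕏.fiber a).dist q (incidenceLeft hab t₁) := by
      exact_mod_cast edgeSpace_dist_inLeft_le b _ _
    rw [dist_symm_real (G := 𝕏.fiber a)] at h5
    push_cast at h2
    linarith
  obtain ⟨z, hz, hpz⟩ := hnear ⟨p, hpa⟩ hp.1 (by linarith)
  obtain ⟨z', hz', hpz'⟩ := hnear ⟨p', hpa'⟩ hp'.1 (by linarith)
  have hzz' := (hY.edge_exit a b hab haY hbY).2 z hz z' hz'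
  have hE := edgeSpace_connected hab
  have h1 := dist_le_edgeSpace_dist hab (𝕏.inLeft b ⟨p, hpa⟩) (𝕏.inLeft b ⟨p', hpa'⟩)
  have h2 := dist_tri hE (𝕏.inLeft b ⟨p, hpa⟩) z (𝕏.inLeft b ⟨p', hpa'⟩)
  have h3 := dist_tri hE z z' (𝕏.inLeft b ⟨p', hpa'⟩)
  rw [dist_symm_real _ z'] at hpz'
  have h5 : (𝕏.X.dist p p' : ℝ) ≤ _ := h1
  linarith

/-! ### The retraction to the whole semicontinuous subgraph -/

/-- The defining properties of Mitra's retraction on `Y`: it is the nearest point projection in the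
fibers which meet `Y`, constant on the parts of `X` over the components of the rest of the tree, and
moves adjacent points to points at distance at most `c`. -/
structure IsMitraRetraction {ξ : Type u₁} {β : Type u₂} {τ : Type u₃} {f : ℝ≥0 → ℝ≥0}
    (𝕏 : GraphOfTreeGradedGraphs.{u₁, u₂, u₃, u₄} ξ β τ f) (Y : Set ξ) (c : ℝ) (ρ : ξ → ξ) :
    Prop where
  isFiberProj : ∀ x, 𝕏.proj x ∈ 𝕏.proj '' Y → 𝕏.IsFiberProj Y (𝕏.projB x) x (ρ x)
  mem : ∀ x, ρ x ∈ Y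
  eq_of_outside : ∀ x x', 𝕏.proj x ∉ 𝕏.proj '' Y → 𝕏.proj x' ∉ 𝕏.proj '' Y →
    𝕏.projB x = 𝕏.projB x' ∨ 𝕏.X.Adj x x' → ρ x = ρ x'
  projB_of_exit : ∀ x x', 𝕏.X.Adj x x' → 𝕏.proj x ∈ 𝕏.proj '' Y → 𝕏.proj x' ∉ 𝕏.proj '' Y →
    𝕏.projB (ρ x') = 𝕏.projB x
  dist_le : ∀ x x', 𝕏.X.Adj x x' → (𝕏.X.dist (ρ x) (ρ x') : ℝ) ≤ c

section

variable {ξ : Type u₁} {β : Type u₂} {τ : Type u₃} {f : ℝ≥0 → ℝ≥0}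
  {𝕏 : GraphOfTreeGradedGraphs.{u₁, u₂, u₃, u₄} ξ β τ f}
  {δ₀ N L₀ k D K C ε : ℝ} {Y : Set ξ} {S : Set τ} {B' : Set β}

theorem proj_eq_or_adj {x x' : ξ} (h : 𝕏.X.Adj x x') :
    𝕏.proj x = 𝕏.proj x' ∨ 𝕏.T.Adj (𝕏.proj x) (𝕏.proj x') := by
  rcases 𝕏.projB_lipschitz x x' h with e | e
  · exact Or.inl (congrArg 𝕏.projT e)
  · exact 𝕏.projT_lipschitz _ _ e

theorem connecting_of_adj {x x' : ξ} (h : 𝕏.X.Adj x x') (hne : 𝕏.proj x ≠ 𝕏.proj x') :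
    𝕏.Connecting (𝕏.projB x) (𝕏.projB x') :=
  ⟨(𝕏.projB_lipschitz x x' h).resolve_left (fun e => hne (congrArg 𝕏.projT e)), hne⟩

theorem exists_adj_of_adj {a b : β} (h : 𝕏.B.Adj a b) :
    ∃ x y, 𝕏.X.Adj x y ∧ 𝕏.projB x = a ∧ 𝕏.projB y = b := by
  by_cases hT : 𝕏.projT a = 𝕏.projT b
  · obtain ⟨x, hx⟩ := 𝕏.projB_surjective a
    obtain ⟨y, hy, hxy⟩ := 𝕏.exists_adj a b h hT x hx
    exact ⟨x, y, hxy, hx, hy⟩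
  · have hc : 𝕏.Connecting a b := ⟨h, hT⟩
    obtain ⟨t⟩ := (𝕏.edge_connected a b hc).nonempty
    exact ⟨_, _, incidence_adj hc t, (incidenceLeft hc t).2, (incidenceRight hc t).2⟩

/-- The edges of `X` by which a component of the complement of the tree of `Y` is attached to it
all lie over the same edge of `B`. -/
theorem IsSemicontinuous.exit_unique (hY : 𝕏.IsSemicontinuous δ₀ K C ε Y S B') {x x' z z' : ξ}
    (hx : 𝕏.proj x ∈ 𝕏.proj '' Y) (hx' : 𝕏.proj x' ∈ (𝕏.proj '' Y)ᶜ) (h : 𝕏.X.Adj x x')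
    (hz : 𝕏.proj z ∈ 𝕏.proj '' Y) (hz' : 𝕏.proj z' ∈ (𝕏.proj '' Y)ᶜ) (hzz' : 𝕏.X.Adj z z')
    (hr : (𝕏.T.induce (𝕏.proj '' Y)ᶜ).Reachable ⟨_, hx'⟩ ⟨_, hz'⟩) :
    𝕏.projB z = 𝕏.projB x ∧ 𝕏.projB z' = 𝕏.projB x' := by
  have h1 := connecting_of_adj h (fun e => hx' (e ▸ hx))
  have h2 := connecting_of_adj hzz' (fun e => hz' (e ▸ hz))
  obtain ⟨e1, e2⟩ := gate_unique 𝕏.isTree hY.tree_connected hx hz h1.adj.symm h2.adj.symm hr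
  exact h1.eq_of_projT_eq h2 e2 e1

end

theorem exists_isMitraRetraction (f : ℝ≥0 → ℝ≥0) (δ₀ L₀ K C ε : ℝ) (hδ₀ : 0 ≤ δ₀) (hL₀ : 1 ≤ L₀)
    (hC : 0 ≤ C) :
    ∃ c : ℝ, 0 ≤ c ∧ ∀ (ξ : Type u₁) (β : Type u₂) (τ : Type u₃)
      (𝕏 : GraphOfTreeGradedGraphs.{u₁, u₂, u₃, u₄} ξ β τ f) (N k D : ℝ),
      𝕏.AxiomH δ₀ N L₀ k D →
      ∀ (Y : Set ξ) (S : Set τ) (B' : Set β), 𝕏.IsSemicontinuous δ₀ K C ε Y S B' →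
      ∃ ρ, 𝕏.IsMitraRetraction Y c ρ := by
  obtain ⟨c₁, hc₁, hpiece⟩ := exists_dist_fiberProj_le_of_piece.{u₁, u₂, u₃, u₄} f δ₀ K
  obtain ⟨c₂, hc₂, hedge⟩ := exists_dist_fiberProj_le_of_isOutward.{u₁, u₂, u₃, u₄} f δ₀ L₀ K ε hL₀
  obtain ⟨c₃, hc₃, hexit⟩ := exists_dist_fiberProj_le_of_exit.{u₁, u₂, u₃, u₄} f δ₀ L₀ C hL₀ hC
  set c₀ : ℝ := 2 * (4 * δ₀ + 2 * (3 * δ₀ + 2) + 1) + (f (1 : ℝ).toNNReal : ℝ) with hc₀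
  have hc₀' : 0 ≤ c₀ := by
    have : (0 : ℝ) ≤ f (1 : ℝ).toNNReal := NNReal.coe_nonneg _
    linarith
  refine ⟨c₀ + c₁ + c₂ + c₃, by linarith, ?_⟩
  intro ξ β τ 𝕏 N k D H Y S B' hY
  classical
  have hne : (𝕏.proj '' Y).Nonempty := ⟨_, hY.tree_connected.nonempty.some.2⟩
  have hin : ∀ x, ∃ p, 𝕏.proj x ∈ 𝕏.proj '' Y → 𝕏.IsFiberProj Y (𝕏.projB x) x p := by
    intro x
    by_cases hx : 𝕏.proj x ∈ 𝕏.proj '' Y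
    · obtain ⟨p, hp⟩ := hY.exists_isFiberProj hx
      exact ⟨p, fun _ => hp⟩
    · exact ⟨x, fun h => absurd h hx⟩
  choose r hr using hin
  -- for each component of the rest of the tree, an edge of `X` by which it is attached
  have hout : ∀ κ : (𝕏.T.induce (𝕏.proj '' Y)ᶜ).ConnectedComponent, ∃ z, 𝕏.proj z ∈ 𝕏.proj '' Y ∧
      ∃ z', 𝕏.X.Adj z z' ∧ ∃ h : 𝕏.proj z' ∈ (𝕏.proj '' Y)ᶜ,
        (𝕏.T.induce (𝕏.proj '' Y)ᶜ).connectedComponentMk ⟨𝕏.proj z', h⟩ = κ := by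
    intro κ
    induction κ using SimpleGraph.ConnectedComponent.ind with
    | _ t =>
      obtain ⟨w, v, hv, hwv, hrw⟩ := exists_gate 𝕏.isTree hne t
      obtain ⟨a, b, hab, ha, hb⟩ := 𝕏.exists_connecting hwv
      obtain ⟨z', z, hzz', hz', hz⟩ := exists_adj_of_adj hab.1
      have e' : 𝕏.proj z' = w := by unfold proj; rw [hz', ha]
      have e : 𝕏.proj z = v := by unfold proj; rw [hz, hb]
      refine ⟨z, e ▸ hv, z', hzz'.symm, e' ▸ w.2, ?_⟩
      rw [SimpleGraph.ConnectedComponent.eq]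
      have : (⟨𝕏.proj z', e' ▸ w.2⟩ : ((𝕏.proj '' Y)ᶜ : Set τ)) = w := Subtype.ext e'
      rw [this]
      exact hrw
  choose zo hzo zo' hzz' hzo' hκ using hout
  set ρ : ξ → ξ := fun x => if h : 𝕏.proj x ∈ 𝕏.proj '' Y then r x else
    r (zo ((𝕏.T.induce (𝕏.proj '' Y)ᶜ).connectedComponentMk ⟨𝕏.proj x, h⟩)) with hρ
  have hρin : ∀ x, 𝕏.proj x ∈ 𝕏.proj '' Y → ρ x = r x := fun x hx => dif_pos hx
  have hρout : ∀ x (h : 𝕏.proj x ∈ (𝕏.proj '' Y)ᶜ), ρ x =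
      r (zo ((𝕏.T.induce (𝕏.proj '' Y)ᶜ).connectedComponentMk ⟨𝕏.proj x, h⟩)) :=
    fun x hx => dif_neg hx
  have hfp : ∀ x, 𝕏.proj x ∈ 𝕏.proj '' Y → 𝕏.IsFiberProj Y (𝕏.projB x) x (ρ x) :=
    fun x hx => by rw [hρin x hx]; exact hr x hx
  have houtside : ∀ x x', 𝕏.proj x ∉ 𝕏.proj '' Y → 𝕏.proj x' ∉ 𝕏.proj '' Y →
      𝕏.projB x = 𝕏.projB x' ∨ 𝕏.X.Adj x x' → ρ x = ρ x' := by
    intro x x' hx hx' h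
    rw [hρout x hx, hρout x' hx']
    congr 2
    rw [SimpleGraph.ConnectedComponent.eq]
    have h' : 𝕏.proj x = 𝕏.proj x' ∨ 𝕏.T.Adj (𝕏.proj x) (𝕏.proj x') := by
      rcases h with h | h
      · exact Or.inl (congrArg 𝕏.projT h)
      · exact proj_eq_or_adj h
    rcases h' with h' | h'
    · have : (⟨𝕏.proj x, hx⟩ : ((𝕏.proj '' Y)ᶜ : Set τ)) = ⟨𝕏.proj x', hx'⟩ := Subtype.ext h'
      rw [this]
    · exact SimpleGraph.Adj.reachable h'
  -- the step out of the tree of `Y`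
  have hstep : ∀ x x', 𝕏.X.Adj x x' → 𝕏.proj x ∈ 𝕏.proj '' Y → 𝕏.proj x' ∉ 𝕏.proj '' Y →
      𝕏.projB (ρ x') = 𝕏.projB x ∧ (𝕏.X.dist (ρ x) (ρ x') : ℝ) ≤ c₃ := by
    intro x x' hadj hx hx'
    set κ := (𝕏.T.induce (𝕏.proj '' Y)ᶜ).connectedComponentMk ⟨𝕏.proj x', hx'⟩ with hκ'
    have e := hY.exit_unique hx hx' hadj (hzo κ) (hzo' κ) (hzz' κ)
      (SimpleGraph.ConnectedComponent.eq.1 (hκ κ).symm)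
    have h1 := hr (zo κ) (hzo κ)
    rw [e.1, ← hρout x' hx'] at h1
    refine ⟨h1.projB_eq, ?_⟩
    exact hexit ξ β τ 𝕏 N k D K ε H Y S B' hY (𝕏.projB x) (𝕏.projB x') x (zo κ) x' (zo' κ) _ _
      (connecting_of_adj hadj (fun e => hx' (e ▸ hx))) hx hx' hadj (hzz' κ) rfl e.2 (hfp x hx) h1
  refine ⟨ρ, hfp, ?_, houtside, fun x x' h h1 h2 => (hstep x x' h h1 h2).1, ?_⟩
  · intro x
    by_cases hx : 𝕏.proj x ∈ 𝕏.proj '' Y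
    · exact (hfp x hx).mem
    · rw [hρout x hx]
      exact (hr _ (hzo _)).mem
  · intro x x' hadj
    by_cases hx : 𝕏.proj x ∈ 𝕏.proj '' Y <;> by_cases hx' : 𝕏.proj x' ∈ 𝕏.proj '' Y
    · have hp := hfp x hx
      have hp' := hfp x' hx'
      rcases 𝕏.projB_lipschitz x x' hadj with e | e
      · rw [← e] at hp'
        have := hp.dist_le H hY hx hp' (r := 1)
          (by rw [SimpleGraph.dist_eq_one_iff_adj.2 hadj]; simp)
        linarith
      · by_cases hT : 𝕏.projT (𝕏.projB x) = 𝕏.projT (𝕏.projB x')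
        · have := hpiece ξ β τ 𝕏 N L₀ k D C ε H Y S B' hY _ _ _ _ _ _ e hT hx hadj hp hp'
          linarith
        · have hc : 𝕏.Connecting (𝕏.projB x) (𝕏.projB x') := ⟨e, hT⟩
          rcases hY.isOutward_or hc hx hx' with ho | ho
          · have := hedge ξ β τ 𝕏 N k D C H Y S B' hY _ _ _ _ _ _ hc ho hx hx' hadj hp hp'
            linarith
          · have := hedge ξ β τ 𝕏 N k D C H Y S B' hY _ _ _ _ _ _ hc.symm ho hx' hx hadj.symm hp' hp
            rw [dist_symm_real] at this
            linarith
    · have := (hstep x x' hadj hx hx').2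
      linarith
    · have := (hstep x' x hadj.symm hx' hx).2
      rw [dist_symm_real] at this
      linarith
    · rw [houtside x x' hx hx' (Or.inr hadj)]
      simp only [SimpleGraph.dist_self, Nat.cast_zero]
      linarith

end GraphOfTreeGradedGraphs

/-! ### Paths inside a neighbourhood -/

section Joined

variable {V : Type*} {G : SimpleGraph V} {R : ℝ} {Z : Set V} {L L' : ℝ} {p q r : V}

/-- `p` and `q` are joined by a path of length at most `L` in the `R`-neighbourhood of `Z`. -/
def Joined (G : SimpleGraph V) (R : ℝ) (Z : Set V) (L : ℝ) (p q : V) : Prop :=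
  ∃ w : G.Walk p q, (w.length : ℝ) ≤ L ∧ ∀ z ∈ w.support, z ∈ nbhd G R Z

theorem mem_nbhd (hR : 0 ≤ R) (hp : p ∈ Z) : p ∈ nbhd G R Z :=
  ⟨p, hp, by simpa using hR⟩

theorem Joined.refl (hL : 0 ≤ L) (hp : p ∈ nbhd G R Z) : Joined G R Z L p p :=
  ⟨SimpleGraph.Walk.nil, by simpa using hL, by simpa using hp⟩

theorem Joined.symm (h : Joined G R Z L p q) : Joined G R Z L q p := by
  obtain ⟨w, h1, h2⟩ := h
  exact ⟨w.reverse, by simpa using h1, by simpa using h2⟩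

theorem Joined.trans (h : Joined G R Z L p q) (h' : Joined G R Z L' q r) :
    Joined G R Z (L + L') p r := by
  obtain ⟨w, h1, h2⟩ := h
  obtain ⟨w', h1', h2'⟩ := h'
  refine ⟨w.append w', ?_, fun z hz => ?_⟩
  · rw [SimpleGraph.Walk.length_append]
    push_cast
    linarith
  · rw [SimpleGraph.Walk.mem_support_append_iff] at hz
    exact hz.elim (h2 z) (h2' z)

theorem Joined.mono (h : Joined G R Z L p q) (hL : L ≤ L') : Joined G R Z L' p q := by
  obtain ⟨w, h1, h2⟩ := h
  exact ⟨w, h1.trans hL, h2⟩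

theorem Joined.mono_radius {R' : ℝ} (h : Joined G R Z L p q) (hR : R ≤ R') :
    Joined G R' Z L p q := by
  obtain ⟨w, h1, h2⟩ := h
  refine ⟨w, h1, fun z hz => ?_⟩
  obtain ⟨u, hu, hd⟩ := h2 z hz
  exact ⟨u, hu, hd.trans hR⟩

theorem Joined.dist_le (h : Joined G R Z L p q) : (G.dist p q : ℝ) ≤ L := by
  obtain ⟨w, h1, -⟩ := h
  refine le_trans ?_ h1
  exact_mod_cast SimpleGraph.dist_le w

theorem Joined.induce (h : Joined G R Z L p q) (hp : p ∈ nbhd G R Z) (hq : q ∈ nbhd G R Z) :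
    (G.induce (nbhd G R Z)).Reachable ⟨p, hp⟩ ⟨q, hq⟩ ∧
      ((G.induce (nbhd G R Z)).dist ⟨p, hp⟩ ⟨q, hq⟩ : ℝ) ≤ L := by
  obtain ⟨w, h1, h2⟩ := h
  have h3 := SimpleGraph.dist_le (w.induce _ h2)
  have h4 : (w.induce _ h2).length = w.length := by
    rw [← SimpleGraph.Walk.length_map (SimpleGraph.Embedding.induce _).toHom,
      SimpleGraph.Walk.map_induce]
    rfl
  rw [h4] at h3
  exact ⟨⟨w.induce _ h2⟩, le_trans (by exact_mod_cast h3) h1⟩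

theorem joined_of_induced_walk {S : Set V} {x y : S} (w : (G.induce S).Walk x y)
    (h : ∀ u ∈ w.support, u.1 ∈ nbhd G R Z) : Joined G R Z w.length x.1 y.1 := by
  have h1 := SimpleGraph.Walk.length_map (SimpleGraph.Embedding.induce S).toHom w
  have h2 := SimpleGraph.Walk.support_map (SimpleGraph.Embedding.induce S).toHom w
  refine ⟨w.map (SimpleGraph.Embedding.induce S).toHom, by exact_mod_cast h1.le, fun z hz => ?_⟩
  obtain ⟨u, hu, rfl⟩ := List.mem_map.1 (h2 ▸ hz)
  exact h u hu

theorem joined_of_dist_le (hG : G.Connected) (hq : q ∈ Z) (h : (G.dist p q : ℝ) ≤ L) (hL : L ≤ R) :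
    Joined G R Z L p q := by
  obtain ⟨w, hw⟩ := hG.exists_walk_length_eq_dist p q
  refine ⟨w, by rw [hw]; exact h, fun z hz => ⟨q, hq, ?_⟩⟩
  have h1 := dist_add_dist_of_mem_support hG w hw hz
  have h2 : (G.dist z q : ℝ) ≤ G.dist p q := by exact_mod_cast (by omega)
  linarith

/-- A retraction which moves the ends of edges to points joined by short paths in `N_R(Z)`. -/
theorem Joined.of_adj (hR : 0 ≤ R) {ρ : V → V} (hρ : ∀ x, ρ x ∈ Z) (hG : G.Connected)
    (h : ∀ x y, G.Adj x y → Joined G R Z L (ρ x) (ρ y)) (x y : V) :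
    Joined G R Z (L * G.dist x y) (ρ x) (ρ y) := by
  obtain ⟨w, hw⟩ := hG.exists_walk_length_eq_dist x y
  rw [← hw]
  clear hw
  induction w with
  | nil => exact Joined.refl (by simp) (mem_nbhd hR (hρ _))
  | @cons a b d hab q ih =>
    refine ((h a b hab).trans ih).mono ?_
    rw [SimpleGraph.Walk.length_cons]
    push_cast
    linarith

theorem isCoarseLipRetraction_of_joined (hR : 0 ≤ R) (hL : 0 ≤ L) {ρ : V → V} (hρ : ∀ x, ρ x ∈ Z)
    (hid : ∀ z ∈ Z, ρ z = z) (hG : G.Connected)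
    (h : ∀ x y, G.Adj x y → Joined G R Z L (ρ x) (ρ y)) : IsCoarseLipRetraction G L Z ρ := by
  refine ⟨hρ, hid, fun x y => ?_⟩
  have := (Joined.of_adj hR hρ hG h x y).dist_le
  linarith

theorem isProperFun_affine (a b : ℝ≥0) (ha : 1 ≤ a) : IsProperFun (fun r => a * r + b) := by
  intro S hS
  obtain ⟨m, hm⟩ := hS.bddAbove
  refine IsCompact.of_isClosed_subset (isCompact_Icc (a := 0) (b := m))
    (hS.isClosed.preimage (by fun_prop)) (fun r hr => ⟨zero_le, ?_⟩)
  calc r = 1 * r := (one_mul r).symm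
    _ ≤ a * r := by gcongr
    _ ≤ a * r + b := le_self_add
    _ ≤ m := hm hr

/-- The neighbourhood of a retract, with its path metric, is quasi-isometrically embedded. -/
theorem nbhd_embedded_of_joined (hR : 0 ≤ R) (hL : 0 ≤ L) {ρ : V → V} (hρ : ∀ x, ρ x ∈ Z)
    (hid : ∀ z ∈ Z, ρ z = z) (hG : G.Connected)
    (h : ∀ x y, G.Adj x y → Joined G R Z L (ρ x) (ρ y)) {M : ℝ≥0}
    (hM : (M : ℝ) = 1 + L + 2 * L * R + 2 * R) :
    (G.induce (nbhd G R Z)).Connected ∧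
      IsProperEmb (fun r => M * r + M) (G.induce (nbhd G R Z)) G Subtype.val ∧
      IsQIEmb M M (G.induce (nbhd G R Z)) G Subtype.val := by
  have key : ∀ x y : nbhd G R Z, (G.induce (nbhd G R Z)).Reachable x y ∧
      ((G.induce (nbhd G R Z)).dist x y : ℝ) ≤ L * (G.dist x.1 y.1 + 2 * R) + 2 * R := by
    intro x y
    obtain ⟨z, hz, hxz⟩ := x.2
    obtain ⟨z', hz', hyz⟩ := y.2
    have h1 := joined_of_dist_le hG hz hxz le_rfl
    have h2 := joined_of_dist_le hG hz' hyz le_rfl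
    have h3 := Joined.of_adj hR hρ hG h z z'
    rw [hid z hz, hid z' hz'] at h3
    obtain ⟨h4, h5⟩ := ((h1.trans h3).trans h2.symm).induce x.2 y.2
    refine ⟨h4, h5.trans ?_⟩
    have t1 := dist_tri hG z x.1 z'
    have t2 := dist_tri hG x.1 y.1 z'
    rw [dist_symm_real z x.1] at t1
    have t3 : L * (G.dist z z' : ℝ) ≤ L * (G.dist x.1 y.1 + 2 * R) :=
      mul_le_mul_of_nonneg_left (by linarith) hL
    linarith
  have hne : Nonempty (nbhd G R Z) := ⟨⟨_, mem_nbhd hR (hρ hG.nonempty.some)⟩⟩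
  have hconn : (G.induce (nbhd G R Z)).Connected :=
    { preconnected := fun x y => (key x y).1, nonempty := hne }
  have hLR : 0 ≤ L * R := mul_nonneg hL hR
  have hM1 : (1 : ℝ) ≤ M := by rw [hM]; linarith
  have key2 : ∀ x y : nbhd G R Z, ((G.induce (nbhd G R Z)).dist x y : ℝ) ≤
      M * G.dist x.1 y.1 + M := by
    intro x y
    have h1 := (key x y).2
    have h2 : L * (G.dist x.1 y.1 : ℝ) ≤ M * G.dist x.1 y.1 :=
      mul_le_mul_of_nonneg_right (by rw [hM]; linarith) (by positivity)
    linarith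
  refine ⟨hconn, fun x y r hr => ?_, fun x y => ⟨?_, ?_⟩⟩
  · refine (key2 x y).trans ?_
    push_cast
    gcongr
  · have h1 := key2 x y
    have h2 : (M : ℝ) * 1 ≤ M * M := by gcongr
    rw [sub_le_iff_le_add, one_div, inv_mul_le_iff₀ (by linarith), mul_add]
    linarith
  · have h1 : (G.dist x.1 y.1 : ℝ) ≤ (G.induce (nbhd G R Z)).dist x y := by
      exact_mod_cast dist_val_le_dist_induce hconn x y
    have h2 : 1 * ((G.induce (nbhd G R Z)).dist x y : ℝ) ≤
        M * (G.induce (nbhd G R Z)).dist x y := by gcongr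
    linarith

end Joined

namespace GraphOfTreeGradedGraphs

variable {ξ : Type u₁} {β : Type u₂} {τ : Type u₃} {f : ℝ≥0 → ℝ≥0}
  {𝕏 : GraphOfTreeGradedGraphs.{u₁, u₂, u₃, u₄} ξ β τ f}
  {δ₀ N L₀ k D K C ε : ℝ} {Y : Set ξ} {S : Set τ} {B' : Set β} {R : ℝ} {Z : Set ξ} {p q : ξ}

/-! ### Joining points of the semicontinuous subgraph near it -/

/-- Points of the same slice are joined by a fiber geodesic, which stays close to the slice. -/
theorem IsSemicontinuous.joined_of_projB_eq (hY : 𝕏.IsSemicontinuous δ₀ K C ε Y S B')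
    (hR : 4 * δ₀ ≤ R) {a : β} (hZ : ∀ y ∈ Y, 𝕏.projB y = a → y ∈ Z) (hp : p ∈ Y) (hq : q ∈ Y)
    (hpa : 𝕏.projB p = a) (hqa : 𝕏.projB q = a) {r : ℝ} (hr : (𝕏.X.dist p q : ℝ) ≤ r) :
    Joined 𝕏.X R Z (f r.toNNReal) p q := by
  obtain ⟨w, hw⟩ := (𝕏.fiber_connected a).exists_walk_length_eq_dist ⟨p, hpa⟩ ⟨q, hqa⟩
  have hqc := hY.quasiconvex a (hpa ▸ ⟨p, hp, rfl⟩) ⟨p, hpa⟩ hp ⟨q, hqa⟩ hq w hw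
  refine (joined_of_induced_walk w fun u hu => ?_).mono ?_
  · obtain ⟨v, hv, hd⟩ := hqc u hu
    exact ⟨v.1, hZ v.1 hv v.2, (𝕏.dist_le_fiber_dist u v).trans (hd.trans hR)⟩
  · rw [hw]
    exact 𝕏.fiber_dist_le (a := a) ⟨p, hpa⟩ ⟨q, hqa⟩ hr

theorem exists_near_of_isOutward {a b : β} (h : 𝕏.Connecting a b) (ho : 𝕏.IsOutward K ε Y a b)
    (hq : q ∈ Y) (hqb : 𝕏.projB q = b) :
    ∃ y ∈ Y, 𝕏.projB y = a ∧ (𝕏.X.dist q y : ℝ) ≤ K := by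
  obtain ⟨y, h1, h2, h3, -⟩ := exists_near_of_subset_nbhd h hq hqb ho.1
  exact ⟨y, h1, h2, h3⟩

/-- Points of slices over the ends of an edge of the base are joined in a neighbourhood of these
slices: one of them can be moved to the fiber of the other one. -/
theorem IsSemicontinuous.joined_of_adj (hY : 𝕏.IsSemicontinuous δ₀ K C ε Y S B') (hK : 1 ≤ K)
    (hR : 4 * δ₀ ≤ R) (hRK : 2 * K ≤ R) {a b : β} (hab : a = b ∨ 𝕏.B.Adj a b)
    (hZa : ∀ y ∈ Y, 𝕏.projB y = a → y ∈ Z) (hZb : ∀ y ∈ Y, 𝕏.projB y = b → y ∈ Z)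
    (hp : p ∈ Y) (hq : q ∈ Y) (hpa : 𝕏.projB p = a) (hqb : 𝕏.projB q = b) {r : ℝ}
    (hr : (𝕏.X.dist p q : ℝ) ≤ r) :
    Joined 𝕏.X R Z (2 * K + f (2 * K + r).toNNReal) p q := by
  have hX := 𝕏.connected_X
  -- the common end of the arguments: `p` or `q` has been moved to a point over the other vertex
  have hfrom : ∀ p' ∈ Y, 𝕏.projB p' = b → (𝕏.X.dist p p' : ℝ) ≤ 2 * K →
      Joined 𝕏.X R Z (2 * K + f (2 * K + r).toNNReal) p q := by
    intro p' hp' hpb' hd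
    refine (joined_of_dist_le hX (hZb p' hp' hpb') hd hRK).trans
      (hY.joined_of_projB_eq hR hZb hp' hq hpb' hqb ?_)
    have := dist_tri hX p' p q
    rw [dist_symm_real p' p] at this
    linarith
  have hto : ∀ q' ∈ Y, 𝕏.projB q' = a → (𝕏.X.dist q q' : ℝ) ≤ 2 * K →
      Joined 𝕏.X R Z (2 * K + f (2 * K + r).toNNReal) p q := by
    intro q' hq' hqa' hd
    refine Joined.symm ((joined_of_dist_le hX (hZa q' hq' hqa') hd hRK).trans
      (hY.joined_of_projB_eq hR hZa hq' hp hqa' hpa ?_))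
    have := dist_tri hX q' q p
    rw [dist_symm_real q' q, dist_symm_real q p] at this
    linarith
  have ha : 𝕏.projT a ∈ 𝕏.proj '' Y := hpa ▸ ⟨p, hp, rfl⟩
  have hb : 𝕏.projT b ∈ 𝕏.proj '' Y := hqb ▸ ⟨q, hq, rfl⟩
  rcases hab with rfl | hab
  · exact hfrom p hp hpa (by simp; linarith)
  by_cases hT : 𝕏.projT a = 𝕏.projT b
  · obtain ⟨p', h1, h2, h3⟩ := hY.exists_near hp (b := b) (hpa ▸ hab) (by unfold proj; rw [hpa, hT])
    exact hfrom p' h1 h2 h3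
  · have hc : 𝕏.Connecting a b := ⟨hab, hT⟩
    rcases hY.isOutward_or hc ha hb with ho | ho
    · obtain ⟨y, h1, h2, h3⟩ := exists_near_of_isOutward hc ho hq hqb
      exact hto y h1 h2 (by linarith)
    · obtain ⟨y, h1, h2, h3⟩ := exists_near_of_isOutward hc.symm ho hp hpa
      exact hfrom y h1 h2 (by linarith)

theorem mem_restrict (hy : p ∈ Y) {b : β} (hb : b ∈ B') (h : 𝕏.projB p = b) :
    p ∈ 𝕏.restrict Y B' :=
  ⟨hy, by rw [Set.mem_preimage, h]; exact hb⟩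

/-- Moving a point along a section over a path of `B'` inside a piece. -/
theorem IsSemicontinuous.joined_section (hY : 𝕏.IsSemicontinuous δ₀ K C ε Y S B') (hK : 1 ≤ K)
    (hRK : 2 * K ≤ R) (hp : p ∈ Y) {b b' : B'} (hpb : 𝕏.projB p = b)
    (hbb' : 𝕏.projT b = 𝕏.projT b') :
    ∃ p' ∈ Y, 𝕏.projB p' = b' ∧
      Joined 𝕏.X R (𝕏.restrict Y B') (2 * K * (𝕏.B.induce B').dist b b') p p' := by
  obtain ⟨s, h1, h2, h3⟩ := hY.exists_section hp
  have hpp : 𝕏.proj p = 𝕏.projT b := by unfold proj; rw [hpb]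
  rw [hpp] at h2 h3
  rw [hpb] at h1
  have hconn := hY.sub_base_connected
  refine ⟨s b', (h2 b' hbb'.symm).1, (h2 b' hbb'.symm).2, ?_⟩
  rw [← h1]
  clear h1 hpb hpp hp
  have key : ∀ n : ℕ, ∀ c : B', 𝕏.projT c = 𝕏.projT b → (𝕏.B.induce B').dist c b' = n →
      Joined 𝕏.X R (𝕏.restrict Y B') (2 * K * n) (s c) (s b') := by
    intro n
    induction n with
    | zero =>
      intro c hc hd
      obtain rfl : c = b' := hconn.dist_eq_zero_iff.1 hd
      exact Joined.refl (by simp)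
        (mem_nbhd (by linarith) (mem_restrict (h2 _ hc).1 c.2 (h2 _ hc).2))
    | succ n ih =>
      intro c hc hd
      obtain ⟨u, hu1, hu2⟩ := exists_geodesic_point hconn c b' (n := 1) (by omega)
      have hu : 𝕏.projT u = 𝕏.projT b :=
        (projT_eq_of_between hconn (hc.trans hbb') (z := u) (by omega)).trans hc
      have hadj : (𝕏.B.induce B').Adj c u := SimpleGraph.dist_eq_one_iff_adj.1 hu1
      have hd1 := h3 c u hc hu
      rw [SimpleGraph.dist_eq_one_iff_adj.2 (SimpleGraph.induce_adj.1 hadj)] at hd1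
      push_cast at hd1
      have hj : Joined 𝕏.X R (𝕏.restrict Y B') (2 * K) (s c) (s u) :=
        joined_of_dist_le 𝕏.connected_X (mem_restrict (h2 _ hu).1 u.2 (h2 _ hu).2)
          (by linarith) hRK
      refine (hj.trans (ih u hu (by omega))).mono ?_
      push_cast
      linarith
  exact key _ b rfl rfl

/-- A slice over a vertex which is adjacent, inside its piece, to a vertex outside `B'` is
bounded. -/
theorem IsSemicontinuous.dist_le_of_adj_notMem (hY : 𝕏.IsSemicontinuous δ₀ K C ε Y S B') {b e : β}
    (he : e ∉ B') (hbe : 𝕏.B.Adj b e) (hT : 𝕏.projT b = 𝕏.projT e) (hp : p ∈ Y) (hq : q ∈ Y)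
    (hpb : 𝕏.projB p = b) (hqb : 𝕏.projB q = b) : (𝕏.X.dist p q : ℝ) ≤ C + 4 * K := by
  have hX := 𝕏.connected_X
  obtain ⟨p', h1, h2, h3⟩ := hY.exists_near hp (b := e) (hpb ▸ hbe) (by unfold proj; rw [hpb, hT])
  obtain ⟨q', h1', h2', h3'⟩ := hY.exists_near hq (b := e) (hqb ▸ hbe)
    (by unfold proj; rw [hqb, hT])
  have h4 := hY.diam_le e (h2 ▸ ⟨p', h1, rfl⟩) he ⟨p', h2⟩ h1 ⟨q', h2'⟩ h1'
  have h5 : (𝕏.X.dist p' q' : ℝ) ≤ C := (𝕏.dist_le_fiber_dist (a := e) ⟨p', h2⟩ ⟨q', h2'⟩).trans h4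
  have t1 := dist_tri hX p p' q
  have t2 := dist_tri hX p' q' q
  rw [dist_symm_real q] at h3'
  linarith

/-- Points over vertices of `B'` in the same piece are joined, if the second slice is bounded. -/
theorem IsSemicontinuous.joined_of_bounded (hY : 𝕏.IsSemicontinuous δ₀ K C ε Y S B') (hK : 1 ≤ K)
    (hR : 4 * δ₀ ≤ R) (hRK : 2 * K ≤ R) {b b' e : β} (hb : b ∈ B') (hb' : b' ∈ B') (he : e ∉ B')
    (hbe : 𝕏.B.Adj b' e) (hT : 𝕏.projT b' = 𝕏.projT e) (hbb' : 𝕏.projT b = 𝕏.projT b') {m : ℝ}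
    (hm : (𝕏.B.dist b b' : ℝ) ≤ m) (hp : p ∈ Y) (hq : q ∈ Y) (hpb : 𝕏.projB p = b)
    (hqb : 𝕏.projB q = b') :
    Joined 𝕏.X R (𝕏.restrict Y B') (2 * K * (m + 6 * δ₀) + f (C + 4 * K).toNNReal) p q := by
  obtain ⟨p', h1, h2, h3⟩ := hY.joined_section hK hRK hp (b := ⟨b, hb⟩) (b' := ⟨b', hb'⟩) hpb hbb'
  have h4 := hY.joined_of_projB_eq hR (fun y hy h => mem_restrict hy hb' h) h1 hq h2 hqb
    (hY.dist_le_of_adj_notMem he hbe hT h1 hq h2 hqb)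
  have h5 := (hY.sub_base_qi ⟨b, hb⟩ ⟨b', hb'⟩).1
  simp only [div_one, one_mul] at h5
  have h6 : 2 * K * ((𝕏.B.induce B').dist ⟨b, hb⟩ ⟨b', hb'⟩ : ℝ) ≤ 2 * K * (m + 6 * δ₀) :=
    mul_le_mul_of_nonneg_left (by linarith) (by linarith)
  exact (h3.trans h4).mono (by linarith)

/-! ### The retractions to `Y` and to its restriction -/

theorem IsMitraRetraction.eq_self {c : ℝ} {ρ : ξ → ξ} (hρ : 𝕏.IsMitraRetraction Y c ρ) {y : ξ}
    (hy : y ∈ Y) : ρ y = y := by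
  obtain ⟨_, _, h⟩ := hρ.isFiberProj y ⟨y, hy, rfl⟩
  exact congrArg Subtype.val (h.eq_of_mem (𝕏.fiber_connected _) hy)

theorem IsMitraRetraction.projB_eq {c : ℝ} {ρ : ξ → ξ} (hρ : 𝕏.IsMitraRetraction Y c ρ) {x : ξ}
    (hx : 𝕏.proj x ∈ 𝕏.proj '' Y) : 𝕏.projB (ρ x) = 𝕏.projB x :=
  (hρ.isFiberProj x hx).projB_eq

theorem IsMitraRetraction.joined (hY : 𝕏.IsSemicontinuous δ₀ K C ε Y S B') (hK : 1 ≤ K)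
    (hR : 4 * δ₀ ≤ R) (hRK : 2 * K ≤ R) {c : ℝ} {ρ : ξ → ξ} (hρ : 𝕏.IsMitraRetraction Y c ρ)
    {x x' : ξ} (h : 𝕏.X.Adj x x') :
    Joined 𝕏.X R Y (2 * K + f (2 * K + c).toNNReal) (ρ x) (ρ x') := by
  have h0 : (0 : ℝ) ≤ 2 * K + f (2 * K + c).toNNReal := by
    have : (0 : ℝ) ≤ f (2 * K + c).toNNReal := NNReal.coe_nonneg _
    linarith
  have hkey : 𝕏.projB (ρ x) = 𝕏.projB (ρ x') ∨ 𝕏.B.Adj (𝕏.projB (ρ x)) (𝕏.projB (ρ x')) →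
      Joined 𝕏.X R Y (2 * K + f (2 * K + c).toNNReal) (ρ x) (ρ x') := fun hadj =>
    hY.joined_of_adj hK hR hRK hadj (fun y hy _ => hy) (fun y hy _ => hy) (hρ.mem x) (hρ.mem x')
      rfl rfl (hρ.dist_le x x' h)
  by_cases hx : 𝕏.proj x ∈ 𝕏.proj '' Y <;> by_cases hx' : 𝕏.proj x' ∈ 𝕏.proj '' Y
  · apply hkey
    rw [hρ.projB_eq hx, hρ.projB_eq hx']
    exact 𝕏.projB_lipschitz x x' h
  · exact hkey (Or.inl ((hρ.projB_eq hx).trans (hρ.projB_of_exit x x' h hx hx').symm))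
  · exact hkey (Or.inl ((hρ.projB_of_exit x' x h.symm hx' hx).trans (hρ.projB_eq hx').symm))
  · rw [hρ.eq_of_outside x x' hx hx' (Or.inr h)]
    exact Joined.refl h0 (mem_nbhd (by linarith) (hρ.mem x'))

/-- The fibers over vertices outside `B'` are collapsed to sets of diameter at most `C`. -/
theorem IsMitraRetraction.dist_le_of_notMem (hC : 0 ≤ C)
    (hY : 𝕏.IsSemicontinuous δ₀ K C ε Y S B') {c : ℝ} {ρ : ξ → ξ}
    (hρ : 𝕏.IsMitraRetraction Y c ρ) {x x' : ξ} (hxx' : 𝕏.projB x = 𝕏.projB x')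
    (hx : 𝕏.projB x ∉ B') : (𝕏.X.dist (ρ x) (ρ x') : ℝ) ≤ C := by
  have hp : 𝕏.proj x' = 𝕏.proj x := congrArg 𝕏.projT hxx'.symm
  by_cases hxY : 𝕏.proj x ∈ 𝕏.proj '' Y
  · have h1 := hρ.projB_eq hxY
    have h2 := (hρ.projB_eq (hp ▸ hxY)).trans hxx'.symm
    have h3 := hY.diam_le _ hxY hx ⟨ρ x, h1⟩ (hρ.mem x) ⟨ρ x', h2⟩ (hρ.mem x')
    exact (𝕏.dist_le_fiber_dist (a := 𝕏.projB x) ⟨ρ x, h1⟩ ⟨ρ x', h2⟩).trans h3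
  · rw [hρ.eq_of_outside x x' hxY (hp ▸ hxY) (Or.inl hxx')]
    simpa using hC

/-- The retraction to the restriction of `Y` over `B'`: points over a vertex `b` outside `B'` are
sent to the image of a point over the edge through which `b` exits towards `B'`. -/
theorem IsMitraRetraction.exists_restrict (hδ₀ : 0 ≤ δ₀) (hC : 0 ≤ C)
    (H : 𝕏.AxiomH δ₀ N L₀ k D) (hY : 𝕏.IsSemicontinuous δ₀ K C ε Y S B') (hK : 1 ≤ K)
    (hR : 4 * δ₀ ≤ R) (hRK : 2 * K ≤ R) {c : ℝ} {ρ : ξ → ξ}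
    (hρ : 𝕏.IsMitraRetraction Y c ρ) {L : ℝ}
    (hL : L = (2 * K + f (2 * K + c).toNNReal) + f (2 * c + C).toNNReal +
      (2 * K * (2 * (6 * δ₀ + 2 * (3 * δ₀ + 2) + 1) + 1 + 6 * δ₀) + f (C + 4 * K).toNNReal)) :
    ∃ ρ' : ξ → ξ, (∀ x, ρ' x ∈ 𝕏.restrict Y B') ∧ (∀ z ∈ 𝕏.restrict Y B', ρ' z = z) ∧
      ∀ x x', 𝕏.X.Adj x x' → Joined 𝕏.X R (𝕏.restrict Y B') L (ρ' x) (ρ' x') := by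
  classical
  have hX := 𝕏.connected_X
  have hB := hY.sub_base_connected
  have hne : B'.Nonempty := ⟨_, hB.nonempty.some.2⟩
  set m : ℝ := 2 * (6 * δ₀ + 2 * (3 * δ₀ + 2) + 1) + 1 with hm
  have f1 : (0 : ℝ) ≤ f (2 * K + c).toNNReal := NNReal.coe_nonneg _
  have f2 : (0 : ℝ) ≤ f (2 * c + C).toNNReal := NNReal.coe_nonneg _
  have f3 : (0 : ℝ) ≤ f (C + 4 * K).toNNReal := NNReal.coe_nonneg _
  have hKm : 0 ≤ 2 * K * (m + 6 * δ₀) := by positivity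
  have hexit : ∀ b, ∃ t : β × β, b ∉ B' → IsExit 𝕏.toTreeGradedGraph B' b t.1 t.2 := by
    intro b
    by_cases hb : b ∈ B'
    · exact ⟨(b, b), fun h => absurd hb h⟩
    · obtain ⟨u, e, h⟩ := exists_isExit hne hb
      exact ⟨(u, e), fun _ => h⟩
  choose t ht using hexit
  have hedge : ∀ t : β × β, ∃ x : ξ, 𝕏.B.Adj t.1 t.2 →
      𝕏.projB x = t.1 ∧ ∃ y, 𝕏.projB y = t.2 ∧ 𝕏.X.Adj x y := by
    intro t
    by_cases h : 𝕏.B.Adj t.1 t.2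
    · obtain ⟨x, y, h1, h2, h3⟩ := exists_adj_of_adj h
      exact ⟨x, fun _ => ⟨h2, y, h3, h1⟩⟩
    · exact ⟨hX.nonempty.some, fun h' => absurd h' h⟩
  choose σ hσ using hedge
  set ρ' : ξ → ξ := fun x => if 𝕏.projB x ∈ B' then ρ x else ρ (σ (t (𝕏.projB x))) with hρ'
  have hin : ∀ x, 𝕏.projB x ∈ B' → ρ' x = ρ x := fun x hx => if_pos hx
  have hout : ∀ x, 𝕏.projB x ∉ B' → ρ' x = ρ (σ (t (𝕏.projB x))) := fun x hx => if_neg hx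
  have hρB : ∀ x, 𝕏.projB x ∈ B' → 𝕏.projB (ρ x) = 𝕏.projB x := fun x hx =>
    hρ.projB_eq (hY.sub_base _ hx)
  -- the point over the exit edge of `b`
  have hσb : ∀ b (_ : b ∉ B'), 𝕏.projB (σ (t b)) = (t b).1 ∧
      (∃ y, 𝕏.projB y = (t b).2 ∧ 𝕏.X.Adj (σ (t b)) y) ∧ 𝕏.projB (ρ (σ (t b))) = (t b).1 := by
    intro b hb
    obtain ⟨h1, h2⟩ := hσ (t b) (ht b hb).adj.symm
    exact ⟨h1, h2, (hρB _ (h1 ▸ (ht b hb).nearest.1)).trans h1⟩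
  have hmem : ∀ x, ρ' x ∈ 𝕏.restrict Y B' := by
    intro x
    by_cases hx : 𝕏.projB x ∈ B'
    · rw [hin x hx]
      exact mem_restrict (hρ.mem x) hx (hρB x hx)
    · rw [hout x hx]
      exact mem_restrict (hρ.mem _) (ht _ hx).nearest.1 (hσb _ hx).2.2
  have hcoarse : CoarselyConvex 𝕏.B (6 * δ₀) B' :=
    coarselyConvex_of_isQIEmb hB hY.sub_base_qi (dist_val_le_dist_induce hB)
  -- leaving `B'`
  have hleave : ∀ x x', 𝕏.X.Adj x x' → 𝕏.projB x ∈ B' → 𝕏.projB x' ∉ B' →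
      Joined 𝕏.X R (𝕏.restrict Y B') L (ρ' x) (ρ' x') := by
    intro x x' hadj hx hx'
    rw [hin x hx, hout x' hx']
    have hbb' : 𝕏.B.Adj (𝕏.projB x) (𝕏.projB x') :=
      (𝕏.projB_lipschitz x x' hadj).resolve_left (fun e => hx' (e ▸ hx))
    have hE := ht _ hx'
    obtain ⟨e1, e2, e3⟩ := hE.of_adj hB hx hbb'
    obtain ⟨s1, ⟨y, s2, s3⟩, s4⟩ := hσb _ hx'
    have h1 := hE.adj
    rw [e1] at h1
    by_cases hT : 𝕏.projT (𝕏.projB x') = 𝕏.projT (t (𝕏.projB x')).1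
    · refine (hY.joined_of_bounded hK hR hRK (m := m) hx hE.nearest.1 hx' h1.symm hT.symm
        (e3 hT) ?_ (hρ.mem _) (hρ.mem _) (hρB x hx) s4).mono (by linarith)
      have h2 := dist_tri 𝕏.connected_B (𝕏.projB x) (𝕏.projB x') (t (𝕏.projB x')).1
      rw [SimpleGraph.dist_eq_one_iff_adj.2 h1, SimpleGraph.dist_eq_one_iff_adj.2 hbb'] at h2
      push_cast at h2
      linarith
    · have hxe := e2 ⟨h1, hT⟩
      refine (hY.joined_of_projB_eq hR (a := 𝕏.projB x) (fun y hy h => mem_restrict hy hx h)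
        (hρ.mem _) (hρ.mem _) (hρB x hx) (s4.trans hxe) (r := 2 * c + C) ?_).mono (by linarith)
      have d1 := hρ.dist_le x x' hadj
      have d2 := hρ.dist_le_of_notMem hC hY (x := x') (x' := y) (e1.symm.trans s2.symm) hx'
      have d3 := hρ.dist_le _ _ s3
      rw [dist_symm_real] at d3
      have t1 := dist_tri hX (ρ x) (ρ x') (ρ (σ (t (𝕏.projB x'))))
      have t2 := dist_tri hX (ρ x') (ρ y) (ρ (σ (t (𝕏.projB x'))))
      linarith
  refine ⟨ρ', hmem, fun z hz => (hin z hz.2).trans (hρ.eq_self hz.1), fun x x' hadj => ?_⟩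
  by_cases hx : 𝕏.projB x ∈ B' <;> by_cases hx' : 𝕏.projB x' ∈ B'
  · rw [hin x hx, hin x' hx']
    exact (hY.joined_of_adj hK hR hRK (𝕏.projB_lipschitz x x' hadj)
      (fun y hy h => mem_restrict hy hx h) (fun y hy h => mem_restrict hy hx' h) (hρ.mem x)
      (hρ.mem x') (hρB x hx) (hρB x' hx') (hρ.dist_le x x' hadj)).mono (by linarith)
  · exact hleave x x' hadj hx hx'
  · exact (hleave x' x hadj.symm hx' hx).symm
  · have hE := ht _ hx
    have hE' := ht _ hx'
    have hbb' := 𝕏.projB_lipschitz x x' hadj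
    have hself : t (𝕏.projB x) = t (𝕏.projB x') →
        Joined 𝕏.X R (𝕏.restrict Y B') L (ρ' x) (ρ' x') := by
      intro h
      have : ρ' x = ρ' x' := by rw [hout x hx, hout x' hx', h]
      rw [this]
      exact Joined.refl (by linarith) (mem_nbhd (by linarith) (hmem x'))
    by_cases hT : 𝕏.projT (t (𝕏.projB x)).1 = 𝕏.projT (t (𝕏.projB x)).2
    · by_cases hT' : 𝕏.projT (t (𝕏.projB x')).1 = 𝕏.projT (t (𝕏.projB x')).2
      · rw [hout x hx, hout x' hx']
        refine (hY.joined_of_bounded hK hR hRK (m := m) hE.nearest.1 hE'.nearest.1 hE'.notMem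
          hE'.adj.symm hT' (hE.nearest.projT_eq hB hE'.nearest hx hbb') ?_ (hρ.mem _) (hρ.mem _)
          (hσb _ hx).2.2 (hσb _ hx').2.2).mono (by linarith)
        have h1 := hE.nearest.dist_le 𝕏.connected_B H.base_hyperbolic.fourPoint hcoarse hE'.nearest
        have h2 : (𝕏.B.dist (𝕏.projB x) (𝕏.projB x') : ℝ) ≤ 1 := by
          rcases hbb' with e | e
          · rw [e]; simp
          · rw [SimpleGraph.dist_eq_one_iff_adj.2 e]; simp
        linarith
      · obtain ⟨h1, h2⟩ := hE'.eq_of_connecting hB ⟨hE'.adj, Ne.symm hT'⟩ hE hx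
          (hbb'.imp Eq.symm SimpleGraph.Adj.symm)
        exact hself (Prod.ext h1 h2)
    · obtain ⟨h1, h2⟩ := hE.eq_of_connecting hB ⟨hE.adj, Ne.symm hT⟩ hE' hx' hbb'
      exact hself (Prod.ext h1 h2).symm

end GraphOfTreeGradedGraphs

/-- Retractions to `Y` and to its restriction which send adjacent points to points joined by a short
path near the respective subset. -/
theorem exists_joined_retractions (f : ℝ≥0 → ℝ≥0) (δ₀ L₀ K C ε : ℝ) (hδ₀ : 0 ≤ δ₀) (hL₀ : 1 ≤ L₀)
    (hK : 1 ≤ K) (hC : 0 ≤ C) :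
    ∃ L : ℝ, 0 ≤ L ∧ ∀ (ξ : Type u₁) (β : Type u₂) (τ : Type u₃)
      (𝕏 : GraphOfTreeGradedGraphs.{u₁, u₂, u₃, u₄} ξ β τ f) (N k D : ℝ),
      𝕏.AxiomH δ₀ N L₀ k D →
      ∀ (Y : Set ξ) (S : Set τ) (B' : Set β), 𝕏.IsSemicontinuous δ₀ K C ε Y S B' →
      ∀ Z : Set ξ, Z = 𝕏.restrict Y B' ∨ Z = Y →
      ∃ ρ : ξ → ξ, (∀ x, ρ x ∈ Z) ∧ (∀ z ∈ Z, ρ z = z) ∧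
        ∀ R, max (4 * δ₀ + 1) (2 * K) ≤ R →
          ∀ x x', 𝕏.X.Adj x x' → Joined 𝕏.X R Z L (ρ x) (ρ x') := by
  obtain ⟨c, hc, hmain⟩ := GraphOfTreeGradedGraphs.exists_isMitraRetraction.{u₁, u₂, u₃, u₄}
    f δ₀ L₀ K C ε hδ₀ hL₀ hC
  obtain ⟨L, hL⟩ : ∃ L : ℝ, L = (2 * K + f (2 * K + c).toNNReal) + f (2 * c + C).toNNReal +
      (2 * K * (2 * (6 * δ₀ + 2 * (3 * δ₀ + 2) + 1) + 1 + 6 * δ₀) + f (C + 4 * K).toNNReal) :=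
    ⟨_, rfl⟩
  have f1 : (0 : ℝ) ≤ f (2 * K + c).toNNReal := NNReal.coe_nonneg _
  have f2 : (0 : ℝ) ≤ f (2 * c + C).toNNReal := NNReal.coe_nonneg _
  have f3 : (0 : ℝ) ≤ f (C + 4 * K).toNNReal := NNReal.coe_nonneg _
  have hKm : 0 ≤ 2 * K * (2 * (6 * δ₀ + 2 * (3 * δ₀ + 2) + 1) + 1 + 6 * δ₀) := by positivity
  refine ⟨L, by linarith, ?_⟩
  intro ξ β τ 𝕏 N k D H Y S B' hY Z hZ
  obtain ⟨ρ, hρ⟩ := hmain ξ β τ 𝕏 N k D H Y S B' hY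
  have hr1 : 4 * δ₀ ≤ max (4 * δ₀ + 1) (2 * K) := le_trans (by linarith) (le_max_left _ _)
  have hr2 : 2 * K ≤ max (4 * δ₀ + 1) (2 * K) := le_max_right _ _
  rcases hZ with rfl | rfl
  · obtain ⟨ρ', h1, h2, h3⟩ := hρ.exists_restrict hδ₀ hC H hY hK hr1 hr2 hL
    exact ⟨ρ', h1, h2, fun R hR x x' h => (h3 x x' h).mono_radius hR⟩
  · exact ⟨ρ, hρ.mem, fun z hz => hρ.eq_self hz, fun R hR x x' h =>
      ((hρ.joined hY hK hr1 hr2 h).mono (by linarith)).mono_radius hR⟩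

end TreeGraded

theorem mainTheorem6 (f : ℝ≥0 → ℝ≥0) (hf : IsProperFun f) (δ₀ N L₀ k D : ℝ)
    (hδ₀ : 0 ≤ δ₀) (hN : 0 ≤ N) (hL₀ : 1 ≤ L₀) (K C ε : ℝ) (hK : 1 ≤ K) (hC : 0 ≤ C) (hε : 0 ≤ ε) :
    (∃ L : ℝ, 0 ≤ L ∧
      ∀ (ξ : Type u₁) (β : Type u₂) (τ : Type u₃)
        (𝕏 : GraphOfTreeGradedGraphs.{u₁, u₂, u₃, u₄} ξ β τ f), 𝕏.AxiomH δ₀ N L₀ k D →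
      ∀ (Y : Set ξ) (S : Set τ) (B' : Set β), 𝕏.IsSemicontinuous δ₀ K C ε Y S B' →
      (∃ ρ : ξ → ξ, IsCoarseLipRetraction 𝕏.X L (𝕏.restrict Y B') ρ) ∧
      (∃ ρ : ξ → ξ, IsCoarseLipRetraction 𝕏.X L Y ρ)) ∧
    (∀ R : ℝ, max (4 * δ₀ + 1) (2 * K) ≤ R →
      ∃ (η : ℝ≥0 → ℝ≥0) (M : ℝ), IsProperFun η ∧ 1 ≤ M ∧
      ∀ (ξ : Type u₁) (β : Type u₂) (τ : Type u₃)
        (𝕏 : GraphOfTreeGradedGraphs.{u₁, u₂, u₃, u₄} ξ β τ f), 𝕏.AxiomH δ₀ N L₀ k D →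
      ∀ (Y : Set ξ) (S : Set τ) (B' : Set β), 𝕏.IsSemicontinuous δ₀ K C ε Y S B' →
      ∀ Z : Set ξ, Z = 𝕏.restrict Y B' ∨ Z = Y →
        (𝕏.X.induce (nbhd 𝕏.X R Z)).Connected ∧
        IsProperEmb η (𝕏.X.induce (nbhd 𝕏.X R Z)) 𝕏.X Subtype.val ∧
        IsQIEmb M M (𝕏.X.induce (nbhd 𝕏.X R Z)) 𝕏.X Subtype.val) := by
  obtain ⟨L, hL, hmain⟩ := exists_joined_retractions.{u₁, u₂, u₃, u₄} f δ₀ L₀ K C ε hδ₀ hL₀ hK hC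
  have hR₀ : 0 ≤ max (4 * δ₀ + 1) (2 * K) := le_max_of_le_left (by linarith)
  refine ⟨⟨L, hL, ?_⟩, fun R hR => ?_⟩
  · intro ξ β τ 𝕏 H Y S B' hY
    have key : ∀ Z : Set ξ, Z = 𝕏.restrict Y B' ∨ Z = Y →
        ∃ ρ : ξ → ξ, IsCoarseLipRetraction 𝕏.X L Z ρ := by
      intro Z hZ
      obtain ⟨ρ, h1, h2, h3⟩ := hmain ξ β τ 𝕏 N k D H Y S B' hY Z hZ
      exact ⟨ρ, isCoarseLipRetraction_of_joined hR₀ hL h1 h2 𝕏.connected_X (h3 _ le_rfl)⟩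
    exact ⟨key _ (Or.inl rfl), key _ (Or.inr rfl)⟩
  · have hR' : 0 ≤ R := hR₀.trans hR
    have hM : 0 ≤ 1 + L + 2 * L * R + 2 * R := by positivity
    have hM1 : 1 ≤ 1 + L + 2 * L * R + 2 * R := by
      have : 0 ≤ 2 * L * R := by positivity
      linarith
    lift 1 + L + 2 * L * R + 2 * R to ℝ≥0 using hM with M hMe
    refine ⟨fun r => M * r + M, M, isProperFun_affine M M (by exact_mod_cast hM1), hM1, ?_⟩
    intro ξ β τ 𝕏 H Y S B' hY Z hZ
    obtain ⟨ρ, h1, h2, h3⟩ := hmain ξ β τ 𝕏 N k D H Y S B' hY Z hZ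
    exact nbhd_embedded_of_joined hR' hL h1 h2 𝕏.connected_X (h3 R hR) hMe
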